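/- **Setting.** Let $\phi_n$ ($n\in\mathbb Z$) be neutral fermions, $\phi_m\phi_n+\phi_n\phi_m=(-1)^m\delta_{m,-n}$, acting on the Fock space with basis $\phi_{n_1}\cdots\phi_{n_k}|0\rangle$, $n_1>\dots>n_k\ge 0$, where $\phi_m|0\rangle=0$ for $m<0$, $\langle 0|\phi_m=0$ for $m>0$, $\langle 0|0\rangle=1$ and $\langle 0|\phi_0|0\rangle=0$; put $\phi(z)=\sum_k z^k\phi_k$. Let $r:\mathbb Z\to\mathbb C$ satisfy $r(n)=r(1-n)$. For odd $n$ and odd $k>0$ let $$H_n=\tfrac12\sum_{j\in\mathbb Z}(-1)^{j+1}\phi_j\phi_{-j-n},\qquad B_k=\tfrac12\sum_{n\in\mathbb Z}(-1)^n\phi_n\phi_{k-n}\,r(n)r(n-1)\cdots r(n-k+1).$$ For independent variables $\mathbf t=(t_1,t_3,\dots)$, $\mathbf t^*=(t_1^*,t_3^*,\dots)$ put $H(\mathbf t)=\sum_{n\text{ odd}>0}t_nH_n$, $B(\mathbf t^*)=\sum_{n\text{ odd}>0}t_n^*B_n$, and let $$\tau_r(\mathbf t,\mathbf t^*)=\langle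 0|e^{H(\mathbf t)}e^{-B(\mathbf t^*)}|0\rangle ,$$ a formal power series in $\mathbf t,\mathbf t^*$. For variables $x_1,\dots,x_M$ let $\mathbf t(x_1,\dots,x_M)$ be given by $m\,t_m=2\sum_i x_i^m$ ($m$ odd), let $\mathbf x^N=(x_1,\dots,x_N)$, and let $\Delta(\mathbf x^N)=\prod_{i<j}\frac{x_i-x_j}{x_i+x_j}$. Let $h_n$ be given by $\sum_n z^nh_n(\mathbf t^*)=\exp\sum_{m\text{ odd}>0}z^mt^*_m$, and for $n>m\ge0$ let $r_{(n,m)}=\prod_{j=1}^n r(j)\prod_{j=1}^m r(j)$ and let $Q_{(n,m)}(\mathbf t^*/2)=h_n(\mathbf t^*)h_m(\mathbf t^*)+2\sum_{i=1}^m(-1)^ih_{n+i}(\mathbf t^*)h_{m-i}(\mathbf t^*)$ be the projective Schur function. **Statement.** Let $N\ge 0$ and $$R_{ik}=\frac12\,\frac{x_i-x_k}{x_i+x_k}\,\tau_r(\mathbf t(x_i,x_k),\mathbf t^*),\qquad 1\le i,k\le N .$$ The following hold, the first two as identities in the field of fractions of $\mathbb C[[x_1,\dots,x_N,t^*_1,t^*_3,\dots]]$.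 1. If $N$ is even, then $$\tau_r(\mathbf t(\mathbf x^N),\mathbf t^*)=2^{N/2}\,\frac{\mathrm{Pfaff}\,(R_{ik})_{i,k=1}^{N}}{\Delta(\mathbf x^N)} .$$ 2. If $N$ is odd, extend $R$ by $R_{i,N+1}=-R_{N+1,i}=\tau_r(\mathbf t(x_i),\mathbf t^*)$ for $i\le N$ and $R_{N+1,N+1}=0$; then $$\tau_r(\mathbf t(\mathbf x^N),\mathbf t^*)=2^{(N-1)/2}\,\frac{\mathrm{Pfaff}\,(R_{ik})_{i,k=1}^{N+1}}{\Delta(\mathbf x^N)} .$$ 3. For $i\ne k$, with $\frac{x_i-x_k}{x_i+x_k}$ expanded as $1+2\sum_{l\ge1}(-x_k/x_i)^l$, every coefficient of $x_i^px_k^q$ ($p,q\in\mathbb Z$) agrees in $$\frac12\,\frac{x_i-x_k}{x_i+x_k}\,\tau_r(\mathbf t(x_i,x_k),\mathbf t^*)=\langle 0|\phi(-\tfrac1{x_k})\,\phi(-\tfrac1{x_i})\,e^{-B(\mathbf t^*)}|0\rangle ;$$ moreover $$R_{ik}=\frac12\,\frac{x_i-x_k}{x_i+x_k}+\frac12\sum_{n>m\ge0}\left(x_i^{n}x_k^{m}-x_i^{m}x_k^{n}\right)r_{(n,m)}\,Q_{(n,m)}\!\left(\tfrac{\mathbf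 t^*}2\right).$$ 4. For every $i$, $\ \tau_r(\mathbf t(x_i),\mathbf t^*)=1+\sum_{n\ge1}r(1)r(2)\cdots r(n)\,x_i^n\,h_n(\mathbf t^*)$. -/

import Mathlib

set_option linter.unusedSimpArgs false

open scoped MvPowerSeries.WithPiTopology

namespace BKP

/-! ### Neutral free fermions -/

/-- The (right) Fock space of neutral fermions: the vector space with basis the strictly decreasing
sequences `n₁ > ⋯ > n_k ≥ 0`, recorded as finite sets. The basis vector of `{n₁, …, n_k}` is
`φ_{n₁} ⋯ φ_{n_k} |0⟩`, and the vacuum `|0⟩` is the basis vector of the empty set. -/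
abbrev Fock : Type := Finset ℕ →₀ ℂ

/-- The action of `φ_n` on a basis vector. With `m = |n|`, moving `φ_n` past the factors with index
greater than `m` gives the sign. Then `φ_n` creates `m` if `m` is absent and `n ≥ 0`, it removes `m`
if `m` is present and `n ≤ 0` (with the factor `(-1)^m`, and `1 / 2` if `m = 0`), and it gives `0`
in the remaining cases. -/
noncomputable def fermionOnBasis (n : ℤ) (S : Finset ℕ) : Fock :=
  (-1 : ℂ) ^ (S.filter (fun s => n.natAbs < s)).card •
    (if n.natAbs ∈ S then
      if 0 < n then 0
      else Finsupp.single (S.erase n.natAbs) (if n = 0 then 1 / 2 else (-1 : ℂ) ^ n.natAbs)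
    else
      if n < 0 then 0 else Finsupp.single (insert n.natAbs S) 1)

/-- The neutral fermion `φ_n`, satisfying `φ_m φ_n + φ_n φ_m = (-1)^m δ_{m,-n}`. -/
noncomputable def fermion (n : ℤ) : Module.End ℂ Fock :=
  Finsupp.linearCombination ℂ (fermionOnBasis n)

theorem fermion_single (n : ℤ) (S : Finset ℕ) :
    fermion n (Finsupp.single S 1) = fermionOnBasis n S := by
  simp [fermion]

theorem sign_insert {m n : ℕ} {S : Finset ℕ} (h : n ∉ S) :
    (-1 : ℂ) ^ ((insert n S).filter (fun s => m < s)).card =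
      (if m < n then -1 else 1) * (-1 : ℂ) ^ (S.filter (fun s => m < s)).card := by
  rw [Finset.filter_insert]
  split_ifs with hmn
  · rw [Finset.card_insert_of_notMem (by simp [h]), pow_succ]; ring
  · simp

theorem sign_erase {m n : ℕ} {S : Finset ℕ} (h : n ∈ S) :
    (-1 : ℂ) ^ ((S.erase n).filter (fun s => m < s)).card =
      (if m < n then -1 else 1) * (-1 : ℂ) ^ (S.filter (fun s => m < s)).card := by
  have := sign_insert (m := m) (Finset.notMem_erase n S)
  rw [Finset.insert_erase h] at this
  rw [this]
  split_ifs <;> simp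

theorem single_smul_one (S : Finset ℕ) (c : ℂ) :
    (Finsupp.single S c : Fock) = c • Finsupp.single S 1 := by simp

/-- Canonical anticommutation relations. -/
theorem fermion_anticomm (m n : ℤ) :
    fermion m * fermion n + fermion n * fermion m = if m + n = 0 then (-1 : ℂ) ^ m • 1 else 0 := by
  ext1 S
  ext1
  simp only [LinearMap.comp_apply, Finsupp.lsingle_apply, LinearMap.add_apply,
    Module.End.mul_apply, fermion_single]
  have key : ∀ a b : ℤ, fermion a (fermionOnBasis b S) = (-1 : ℂ) ^ (S.filter (fun s => b.natAbs < s)).card •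
    (if b.natAbs ∈ S then
      if 0 < b then 0
      else (if b = 0 then 1 / 2 else (-1 : ℂ) ^ b.natAbs) • fermionOnBasis a (S.erase b.natAbs)
    else
      if b < 0 then 0 else fermionOnBasis a (insert b.natAbs S)) := by
    intro a b
    rw [fermionOnBasis, map_smul]
    congr 1
    split_ifs
    · simp
    · rw [single_smul_one, map_smul, fermion_single]
    · rw [single_smul_one, map_smul, fermion_single]
    · simp
    · rw [fermion_single]
  rw [key, key]
  have hsq : ∀ j : ℕ, ((-1 : ℂ) ^ j) * (-1 : ℂ) ^ j = 1 := fun j => by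
    rw [← mul_pow]; simp
  have hsq' : ∀ (j : ℕ) (x : ℂ), ((-1 : ℂ) ^ j) * ((-1 : ℂ) ^ j * x) = x := fun j x => by
    rw [← mul_assoc, hsq, one_mul]
  by_cases hab : m.natAbs = n.natAbs
  · have hz : (-1 : ℂ) ^ m = (-1 : ℂ) ^ m.natAbs := by
      rcases Int.natAbs_eq m with h | h
      · conv_lhs => rw [h, zpow_natCast]
      · conv_lhs => rw [h, zpow_neg, zpow_natCast]
        rw [← inv_pow]
        norm_num
    rcases Int.natAbs_eq_natAbs_iff.1 hab with rfl | rfl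
    · by_cases hm0 : m = 0
      · subst hm0
        by_cases h0 : 0 ∈ S
        · simp [-Finsupp.single_mul, h0, fermionOnBasis, sign_erase, hsq, hsq', mul_left_comm, ← Finsupp.single_add]
          try norm_num
        · simp [-Finsupp.single_mul, h0, fermionOnBasis, sign_insert, hsq, hsq', mul_left_comm, ← Finsupp.single_add]
          try norm_num
      · have : m + m ≠ 0 := by omega
        rcases lt_or_gt_of_ne hm0 with h | h
        · have h' : ¬ 0 < m := by omega
          by_cases h0 : m.natAbs ∈ S <;> simp [h0, h, h', hm0, this, fermionOnBasis]
        · have h' : ¬ m < 0 := by omega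
          by_cases h0 : m.natAbs ∈ S <;> simp [h0, h, h', hm0, this, fermionOnBasis]
    · rw [hz]
      rcases lt_trichotomy n 0 with h | rfl | h
      · have h1 : ¬ 0 < n := by omega
        have h2 : n ≠ 0 := by omega
        by_cases h0 : n.natAbs ∈ S <;>
          simp [-Finsupp.single_mul, h0, h, h1, h2, h.le, fermionOnBasis, sign_erase, sign_insert, mul_left_comm, hsq, hsq']
      · by_cases h0 : 0 ∈ S
        · simp [-Finsupp.single_mul, h0, fermionOnBasis, sign_erase, hsq, hsq', mul_left_comm, ← Finsupp.single_add]
          try norm_num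
        · simp [-Finsupp.single_mul, h0, fermionOnBasis, sign_insert, hsq, hsq', mul_left_comm, ← Finsupp.single_add]
          try norm_num
      · have h1 : ¬ n < 0 := by omega
        have h2 : n ≠ 0 := by omega
        by_cases h0 : n.natAbs ∈ S <;>
          simp [-Finsupp.single_mul, h0, h, h1, h2, h.le, fermionOnBasis, sign_erase, sign_insert, mul_left_comm, hsq, hsq']
  · have hmn : m + n ≠ 0 := by omega
    have hba : n.natAbs ≠ m.natAbs := fun h => hab h.symm
    rw [if_neg hmn]
    have hlt : m.natAbs < n.natAbs ↔ ¬ n.natAbs < m.natAbs := by omega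
    by_cases hm : m.natAbs ∈ S <;> by_cases hn : n.natAbs ∈ S <;>
      by_cases hl : n.natAbs < m.natAbs <;>
      simp only [fermionOnBasis, hm, hn, hab, hba, hlt, hl, Finset.mem_erase, Finset.mem_insert,
        sign_erase, sign_insert, ne_eq, not_false_eq_true, not_true_eq_false, if_true, if_false,
        true_and, or_true, or_false, false_or, LinearMap.zero_apply] <;>
      split_ifs <;>
      simp only [smul_smul, Finset.erase_right_comm (a := n.natAbs), Finset.insert_comm m.natAbs,
        Finset.erase_insert_of_ne hab, Finset.erase_insert_of_ne hba, smul_zero, add_zero] <;>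
      (ext T
       simp only [Finsupp.coe_add, Finsupp.coe_smul, Pi.add_apply, Pi.smul_apply, smul_eq_mul,
         Finsupp.single_apply, Finsupp.coe_zero, Pi.zero_apply, mul_ite, mul_zero]
       try (split_ifs <;> ring))

/-- The vacuum expectation value `⟨0|A|0⟩`: the coefficient of the vacuum in `A |0⟩`. -/
noncomputable def vev (A : Module.End ℂ Fock) : ℂ :=
  A (Finsupp.single ∅ 1) ∅

/-- The bilinear operator `∑_{n ∈ ℤ} c(n) φ_n φ_{k-n}`, given on basis vectors. For `k ≠ 0` only
finitely many terms act nontrivially on each basis vector, see `bilinear_support_finite`. -/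
noncomputable def bilinear (c : ℤ → ℂ) (k : ℤ) : Module.End ℂ Fock :=
  Finsupp.linearCombination ℂ fun S =>
    ∑ᶠ n : ℤ, c n • (fermion n * fermion (k - n)) (Finsupp.single S 1)

theorem bilinear_support_finite (c : ℤ → ℂ) {k : ℤ} (hk : k ≠ 0) (S : Finset ℕ) :
    (Function.support fun n : ℤ =>
      c n • (fermion n * fermion (k - n)) (Finsupp.single S 1)).Finite := by
  obtain ⟨M, hM⟩ : ∃ M : ℕ, ∀ s ∈ S, s ≤ M := ⟨S.sup id, fun s hs => Finset.le_sup (f := id) hs⟩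
  refine (Set.finite_Icc (-(M : ℤ) - |k|) (M + |k|)).subset fun n hn => ?_
  by_contra hout
  apply hn
  have hS : ∀ j : ℤ, M < j.natAbs → j.natAbs ∉ S := fun j hj hmem => by
    have := hM _ hmem
    omega
  have hle := le_abs_self k
  have hle' := neg_abs_le k
  rw [Set.mem_Icc, not_and_or, not_le, not_le] at hout
  dsimp only
  rw [Module.End.mul_apply, fermion_single]
  rcases hout with h | h
  · have h1 : (k - n).natAbs ∉ S := hS _ (by omega)
    have h2 : n.natAbs ∉ insert (k - n).natAbs S := by
      rw [Finset.mem_insert, not_or]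
      exact ⟨by omega, hS _ (by omega)⟩
    have h3 : ¬ (k - n < 0) := by omega
    have h4 : n < 0 := by omega
    rw [fermionOnBasis, if_neg h1, if_neg h3, map_smul, fermion_single, fermionOnBasis, if_neg h2,
      if_pos h4]
    simp
  · have h1 : (k - n).natAbs ∉ S := hS _ (by omega)
    have h3 : k - n < 0 := by omega
    simp [fermionOnBasis, h1, show k < n by omega]

/-- The Hamiltonian `H_n = (1/2) ∑_{k ∈ ℤ} (-1)^{k+1} φ_k φ_{-k-n}`. -/
noncomputable def hamiltonian (n : ℤ) : Module.End ℂ Fock :=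
  bilinear (fun k => (1 / 2) * (-1 : ℂ) ^ (k + 1)) (-n)

/-- The operator `B_k = (1/2) ∑_{n ∈ ℤ} (-1)^n φ_n φ_{k-n} r(n) r(n-1) ⋯ r(n-k+1)`. -/
noncomputable def symmetryOp (r : ℤ → ℂ) (k : ℕ) : Module.End ℂ Fock :=
  bilinear (fun n => (1 / 2) * (-1 : ℂ) ^ n * ∏ j ∈ Finset.range k, r (n - j)) k

/-! ### Formal exponentials

Odd-numbered times `t = (t₁, t₃, t₅, …)` are indexed by `j : ℕ`, the index `j` standing for the odd
number `2 j + 1`. -/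

/-- The linear form `∑_s a_s X_s`, as a formal power series with coefficients in a ring that need
not be commutative. -/
noncomputable def linearSeries {σ A : Type*} [Ring A] (a : σ → A) : MvPowerSeries σ A :=
  fun d => if d.degree = 1 then d.sum fun s n => n • a s else 0

/-- The exponential `∑_i f^i / i!` of a formal power series `f` without constant term: such powers
`f^i` with `i > deg d` do not contribute to the coefficient at the exponent `d`. -/
noncomputable def formalExp {σ A : Type*} [Ring A] [Algebra ℂ A] (f : MvPowerSeries σ A) :
    MvPowerSeries σ A :=
  fun d => ∑ i ∈ Finset.range (d.degree + 1), ((i.factorial : ℂ)⁻¹) • MvPowerSeries.coeff d (f ^ i)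

/-- `e^{H(t)}` with `H(t) = ∑_{n = 1, 3, …} t_n H_n`, as an operator-valued power series in `t`. -/
noncomputable def expH : MvPowerSeries ℕ (Module.End ℂ Fock) :=
  formalExp (linearSeries fun j : ℕ => hamiltonian (2 * j + 1))

/-- `e^{-B(t*)}` with `B(t*) = ∑_{n = 1, 3, …} t*_n B_n`, as an operator-valued power series
in `t*`. -/
noncomputable def expNegB (r : ℤ → ℂ) : MvPowerSeries ℕ (Module.End ℂ Fock) :=
  formalExp (linearSeries fun j : ℕ => -symmetryOp r (2 * j + 1))

/-- The tau function `τ_r(t, t*) = ⟨0| e^{H(t)} e^{-B(t*)} |0⟩`, a formal power series in the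
variables `t` (left summand) and `t*` (right summand). -/
noncomputable def tau (r : ℤ → ℂ) : MvPowerSeries (ℕ ⊕ ℕ) ℂ :=
  fun d => vev
    (MvPowerSeries.coeff (Finsupp.sumFinsuppEquivProdFinsupp d).1 expH *
      MvPowerSeries.coeff (Finsupp.sumFinsuppEquivProdFinsupp d).2 (expNegB r))

/-! ### Restriction of the times `t` to finitely many variables -/

/-- The ring of formal power series in `x_1, …, x_N` and `t*_1, t*_3, t*_5, …`. -/
abbrev Series (N : ℕ) : Type := MvPowerSeries (Fin N ⊕ ℕ) ℂ

/-- The variable `x_i`. -/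
noncomputable def xVar {N : ℕ} (i : Fin N) : Series N := MvPowerSeries.X (Sum.inl i)

/-- The variable `t*_{2j+1}`. -/
noncomputable def tStar (N : ℕ) (j : ℕ) : Series N := MvPowerSeries.X (Sum.inr j)

/-- The times `t(x_{v 0}, …, x_{v (M-1)})`: `m t_m = ∑_a (x_{v a}^m - (-x_{v a})^m)` for odd
`m = 2 j + 1`. -/
noncomputable def xTimes {M N : ℕ} (v : Fin M → Fin N) (j : ℕ) : Series N :=
  ((2 * j + 1 : ℂ)⁻¹) • ∑ a, (xVar (v a) ^ (2 * j + 1) - (-xVar (v a)) ^ (2 * j + 1))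

/-- The substitution of these times into power series in `t` and `t*` is legitimate. -/
theorem hasSubst_times {M N : ℕ} (v : Fin M → Fin N) :
    MvPowerSeries.HasSubst (Sum.elim (xTimes v) (tStar N)) where
  const_coeff s := by
    rcases s with j | j
    · simp [xTimes, xVar, MvPowerSeries.smul_eq_C_mul]
    · simp [tStar]
  coeff_zero d := by
    classical
    have hfin : ((fun j : ℕ => (Sum.inl j : ℕ ⊕ ℕ)) '' Set.Iic d.degree ∪
        Sum.inr '' {j : ℕ | Finsupp.single (Sum.inr j) 1 = d}).Finite := by
      refine ((Set.finite_Iic _).image _).union (Set.Finite.image _ ?_)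
      refine Set.Subsingleton.finite fun a ha b hb => ?_
      have := (ha.trans hb.symm : Finsupp.single (Sum.inr a : Fin N ⊕ ℕ) 1 = Finsupp.single (Sum.inr b) 1)
      simpa using Finsupp.single_left_injective one_ne_zero this
    refine hfin.subset fun s hs => ?_
    rcases s with j | j
    · refine Or.inl ⟨j, ?_, rfl⟩
      by_contra hj
      refine hs ?_
      have hne : ∀ i : Fin N, MvPowerSeries.coeff d (xVar i ^ (2 * j + 1) : Series N) = 0 := by
        intro i
        rw [xVar, MvPowerSeries.coeff_X_pow, if_neg]
        rintro rfl
        simp [-Finsupp.single_mul] at hj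
        omega
      have hodd : ∀ i : Fin N, (-xVar i : Series N) ^ (2 * j + 1) = -xVar i ^ (2 * j + 1) :=
        fun i => Odd.neg_pow ⟨j, rfl⟩ _
      simp [xTimes, hodd, hne]
    · refine Or.inr ⟨j, ?_, rfl⟩
      by_contra hj
      refine hs ?_
      simp only [Sum.elim_inr, tStar, MvPowerSeries.coeff_X]
      rw [if_neg fun h => hj h.symm]

/-- `τ_r(t(x_{v 0}, …, x_{v (M-1)}), t*)`. -/
noncomputable def tauX (r : ℤ → ℂ) {M N : ℕ} (v : Fin M → Fin N) : Series N :=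
  MvPowerSeries.subst (Sum.elim (xTimes v) (tStar N)) (tau r)

/-- The field of fractions of the ring of formal power series in `x` and `t*`. -/
abbrev SeriesField (N : ℕ) : Type := FractionRing (Series N)

/-- The inclusion of the power series ring into its field of fractions. -/
noncomputable abbrev toField {N : ℕ} : Series N →+* SeriesField N :=
  algebraMap (Series N) (SeriesField N)

/-- `(x_i - x_k) / (x_i + x_k)`. -/
noncomputable def ratio {N : ℕ} (i k : Fin N) : SeriesField N :=
  toField (xVar i - xVar k) / toField (xVar i + xVar k)

/-- `Δ(x) = ∏_{i < j} (x_i - x_j) / (x_i + x_j)`. -/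
noncomputable def Delta (N : ℕ) : SeriesField N :=
  ∏ i : Fin N, ∏ j ∈ Finset.Ioi i, ratio i j

/-- The Pfaffian of a skew-symmetric matrix, by expansion along the first row. -/
def pfaffian {R : Type*} [CommRing R] : (m : ℕ) → Matrix (Fin m) (Fin m) R → R
  | 0, _ => 1
  | 1, _ => 0
  | m + 2, M => ∑ j : Fin (m + 1), (-1) ^ (j : ℕ) * M 0 j.succ *
      pfaffian m (M.submatrix (fun a => (j.succAbove a).succ) (fun a => (j.succAbove a).succ))

/-- The matrix `R_{ik} = (1/2) (x_i - x_k) / (x_i + x_k) τ_r(t(x_i, x_k), t*)`. -/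
noncomputable def matR (r : ℤ → ℂ) (N : ℕ) : Matrix (Fin N) (Fin N) (SeriesField N) :=
  fun i k => (1 / 2) * ratio i k * toField (tauX r ![i, k])

/-- The matrix `R` bordered by a last column `τ_r(t(x_i), t*)` and a last row
`-τ_r(t(x_k), t*)`. -/
noncomputable def matRBordered (r : ℤ → ℂ) (N : ℕ) :
    Matrix (Fin (N + 1)) (Fin (N + 1)) (SeriesField N) :=
  fun a b =>
    Fin.lastCases (motive := fun _ => SeriesField N)
      (Fin.lastCases (motive := fun _ => SeriesField N) 0 (fun k => -toField (tauX r ![k])) b)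
      (fun i => Fin.lastCases (motive := fun _ => SeriesField N)
        (toField (tauX r ![i])) (fun k => matR r N i k) b)
      a

/-! ### The entries of the matrix -/

/-- The polynomials `h_n(t)` in the times `t = (t₁, t₃, …)`, given by
`∑_n z^n h_n(t) = exp (∑_{m = 1, 3, …} z^m t_m)`. -/
noncomputable def hPoly {A : Type*} [CommRing A] [Algebra ℂ A] (t : ℕ → A) (n : ℕ) : A :=
  PowerSeries.coeff n
    (formalExp (PowerSeries.mk fun m => if Odd m then t (m / 2) else 0) : PowerSeries A)

/-- The projective Schur function `Q_{(a,b)}(t/2)` of a strict partition with parts `a > b ≥ 0`,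
where `Q_{(a)}(t/2) = h_a(t)`:
`Q_{(a,b)} = Q_{(a)} Q_{(b)} + 2 ∑_{i=1}^{b} (-1)^i Q_{(a+i)} Q_{(b-i)}`. -/
noncomputable def schurQ {A : Type*} [CommRing A] [Algebra ℂ A] (t : ℕ → A) (a b : ℕ) : A :=
  hPoly t a * hPoly t b +
    2 * ∑ i ∈ Finset.Icc 1 b, (-1) ^ i * hPoly t (a + i) * hPoly t (b - i)

/-- `r(1) r(2) ⋯ r(n)`. -/
def rProd (r : ℤ → ℂ) (n : ℕ) : ℂ := ∏ j ∈ Finset.range n, r (j + 1)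

/-- The coefficient of `x^p` in the field `φ(-1/x)`, where `φ(z) = ∑_{k ∈ ℤ} z^k φ_k`. -/
noncomputable def fieldCoeff (p : ℤ) : Module.End ℂ Fock := (-1 : ℂ) ^ p • fermion (-p)

/-- The coefficient of `x^p y^q` in `⟨0| φ(-1/y) φ(-1/x) e^{-B(t*)} |0⟩`, a power series
in `t*`. -/
noncomputable def twoPoint (r : ℤ → ℂ) (p q : ℤ) : MvPowerSeries ℕ ℂ :=
  fun d => vev (fieldCoeff q * fieldCoeff p * MvPowerSeries.coeff d (expNegB r))

/-- The coefficient of `x_i^p x_k^q` in `f` (for `i ≠ k`), a power series in `t*`; it is `0` if `p`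
or `q` is negative. -/
noncomputable def xyCoeff {N : ℕ} (i k : Fin N) (f : Series N) (p q : ℤ) : MvPowerSeries ℕ ℂ :=
  fun d =>
    if 0 ≤ p ∧ 0 ≤ q then
      MvPowerSeries.coeff
        (Finsupp.sumElim (Finsupp.single i p.toNat + Finsupp.single k q.toNat) d) f
    else 0

/-- The coefficient of `x_i^p x_k^q` in the expansion of `(x_i - x_k) / (x_i + x_k) * f` by means of
`(x_i - x_k) / (x_i + x_k) = 1 + 2 ∑_{l ≥ 1} (-x_k / x_i)^l`; the terms with `l > q` vanish. -/
noncomputable def ratioMulCoeff {N : ℕ} (i k : Fin N) (f : Series N) (p q : ℤ) :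
    MvPowerSeries ℕ ℂ :=
  ∑ l ∈ Finset.range (q.toNat + 1),
    (if l = 0 then 1 else 2 * (-1 : ℂ) ^ l) • xyCoeff i k f (p + l) (q - l)

end BKP

set_option linter.unusedSectionVars false

namespace BKP

open MvPowerSeries Finset

/-! ### Formal exponentials -/

section FormalExp

variable {σ A : Type*} [Ring A] [Algebra ℂ A]

/-! When `m t_m = 2 ∑ x_i^m`, the operator `e^{H(t)}` factors into commuting vertex operators
`V(x_i) = exp (∑_{n odd} (2/n) x_i^n H_n)` (`tauX_eq`). Since `[H_n, φ_m] = φ_{m-n}`, conjugation by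
`V(x)` multiplies the fermion field by the factor `(1 + z)/(1 - z)`; without denominators this is `V
φ_m = x V φ_{m-1} + φ_m V + x φ_{m-1} V` (`vertexCoeff_succ_mul_fermion`).

Against the left vacuum a vertex operator becomes a fermion field: `⟨0|φ_0 V(x) = ⟨0|φ(-1/x)`
(`ev₀_fer_zero_vx`), because a functional that kills the images of all `φ_m`, `m > 0`, is fixed by
its values at `|0⟩` and `φ_0|0⟩`. Parity is handled by `rightZero`, multiplication by `φ_0` from the
right: it commutes with every `φ_m`, has square `1/2`, and agrees with `φ_0` next to either vacuum.
Hence `⟨0|V(x) = 2 ⟨0|φ(-1/x) rz`.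

On the other side, `r(n) = r(1-n)` gives `[B_k, φ_m] = -r(m+1)⋯r(m+k) φ_{m+k}`, so moving `e^{-B}`
past `φ_m` only produces modes `φ_{m+l}` with `l ≥ 0` (`bop_mul_fop`, `fop_mul_bop`).

The Pfaffian comes from a recursion. For a set `J` of odd size and `w_j = ∏_{k≠j}
(y_j+y_k)/(y_j-y_k)`, the identity `⟨∏_J V(y_j) φ_m rz e^{-B}⟩ = ∑_j w_j τ(J∖j) ⟨V(y_j) φ_m rz
e^{-B}⟩` holds for every integer `m`. For `m > 0` it is a partial fraction argument
(`V_vprod_mul_fop`). With `φ_m` to the right of `e^{-B}` it is clear for `m < 0`, and follows for `m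
> 0` from the positive modes; for `m = 0` the two orders give the same obstruction with opposite
signs, so it vanishes (`defect_rzop_bop_fop`). Expanding `φ_m e^{-B}` in the operators `e^{-B}
φ_{m+l}` then gives all `m` (`defect_fop`).

Clearing the factors of the `V(y_j)` and summing over `m` with the powers of `-y_a` turns `φ` into
one more vertex operator `V(y_a)`. This expresses `τ(J ∪ a)` by the products `τ(J∖j) τ({a,j})`;
multiplied by the product of all ratios it is the expansion of a Pfaffian along its first row
(`upperProd_mul_tauSet`). For odd `N` the variable `0` is adjoined, where `V(0) = 1`.

The one- and two-point functions are computed by moving `e^{-B}` to the left vacuum, which absorbs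
it (`V_fop_rzop_bop`, `pairCoeff_eq`). -/

theorem coeff_pow_eq_zero {f : MvPowerSeries σ A} (hf : constantCoeff f = 0) {d : σ →₀ ℕ} {i : ℕ}
    (h : d.degree < i) : coeff d (f ^ i) = 0 :=
  coeff_of_lt_order (lt_of_lt_of_le (by exact_mod_cast h)
    (le_order_pow_of_constantCoeff_eq_zero i hf))

/-- Any cutoff above the degree is allowed, so one polynomial can replace the exponential in all
coefficients up to a given exponent. -/
theorem coeff_formalExp {f : MvPowerSeries σ A} (hf : constantCoeff f = 0) {d : σ →₀ ℕ} {n : ℕ}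
    (h : d.degree < n) :
    coeff d (formalExp f) = coeff d (∑ i ∈ range n, ((i.factorial : ℂ)⁻¹) • f ^ i) := by
  rw [map_sum]
  change ∑ i ∈ range (d.degree + 1), ((i.factorial : ℂ)⁻¹) • coeff d (f ^ i) = _
  refine Finset.sum_subset (range_mono h) fun i _ hi => ?_
  rw [coeff_pow_eq_zero hf (by simpa using hi), smul_zero]

/-- The coefficient of a product only depends on the coefficients of smaller exponents. -/
theorem coeff_mul_congr {f f' g g' : MvPowerSeries σ A} {d : σ →₀ ℕ}
    (hf : ∀ c ≤ d, coeff c f = coeff c f') (hg : ∀ c ≤ d, coeff c g = coeff c g') :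
    coeff d (f * g) = coeff d (f' * g') := by
  classical
  rw [coeff_mul, coeff_mul]
  refine Finset.sum_congr rfl fun p hp => ?_
  rw [HasAntidiagonal.mem_antidiagonal] at hp
  rw [hf _ (hp ▸ le_self_add), hg _ (hp ▸ le_add_self)]

theorem degree_le_of_le {c d : σ →₀ ℕ} (h : c ≤ d) : c.degree ≤ d.degree := by
  obtain ⟨e, rfl⟩ := exists_add_of_le h
  simp

theorem formalExp_zero : formalExp (0 : MvPowerSeries σ A) = 1 := by
  ext d
  rw [coeff_formalExp (by simp) (Nat.lt_succ_self _), sum_eq_single 0]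
  · simp
  · intro i _ hi
    simp [hi]
  · simp

theorem constantCoeff_formalExp (f : MvPowerSeries σ A) :
    constantCoeff (formalExp f) = 1 := by
  change ∑ i ∈ range ((0 : σ →₀ ℕ).degree + 1), ((i.factorial : ℂ)⁻¹) • coeff 0 (f ^ i) = _
  simp

theorem formalExp_add {f g : MvPowerSeries σ A} (hfg : Commute f g) (hf : constantCoeff f = 0)
    (hg : constantCoeff g = 0) : formalExp (f + g) = formalExp f * formalExp g := by
  ext d
  set n := d.degree + 1
  have hn : ∀ c ≤ d, c.degree < n := fun c hc => Nat.lt_succ_of_le (degree_le_of_le hc)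
  rw [coeff_mul_congr (fun c hc => coeff_formalExp hf (hn c hc))
    (fun c hc => coeff_formalExp hg (hn c hc)),
    coeff_formalExp (by simp [hf, hg]) (hn d le_rfl)]
  have key : (∑ i ∈ range n, ((i.factorial : ℂ)⁻¹) • (f + g) ^ i) =
      ∑ p ∈ (range n ×ˢ range n) with p.1 + p.2 < n,
        (((p.1.factorial : ℂ)⁻¹) • f ^ p.1) * (((p.2.factorial : ℂ)⁻¹) • g ^ p.2) := by
    have : ∀ i, ((i.factorial : ℂ)⁻¹) • (f + g) ^ i = ∑ p ∈ antidiagonal i,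
        (((p.1.factorial : ℂ)⁻¹) • f ^ p.1) * (((p.2.factorial : ℂ)⁻¹) • g ^ p.2) := by
      intro i
      rw [hfg.add_pow', Finset.smul_sum]
      refine Finset.sum_congr rfl fun p hp => ?_
      rw [HasAntidiagonal.mem_antidiagonal] at hp
      subst hp
      rw [smul_mul_smul_comm, ← Nat.cast_smul_eq_nsmul ℂ, smul_smul]
      congr 1
      rw [Nat.cast_choose ℂ le_self_add, Nat.add_sub_cancel_left]
      have := Nat.cast_ne_zero (R := ℂ).2 (p.1 + p.2).factorial_ne_zero
      field_simp
    simp_rw [this]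
    rw [Finset.sum_sigma']
    refine Finset.sum_bij' (fun x _ => x.2) (fun p _ => ⟨p.1 + p.2, p⟩) ?_ ?_ ?_ ?_ ?_
    · rintro ⟨i, p⟩ h
      simp only [mem_sigma, mem_range, HasAntidiagonal.mem_antidiagonal] at h
      simp only [mem_filter, mem_product, mem_range]
      omega
    · rintro p h
      simp only [mem_filter, mem_product, mem_range] at h
      simp [h.2]
    · rintro ⟨i, p⟩ h
      simp only [mem_sigma, mem_range, HasAntidiagonal.mem_antidiagonal] at h
      obtain ⟨_, rfl⟩ := h
      rfl
    · intros; rfl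
    · intros; rfl
  rw [key, Finset.sum_mul_sum, ← Finset.sum_product', map_sum, map_sum]
  -- The square of truncations has additional terms `f^i g^j` with `i + j ≥ n`; their order exceeds
  -- `deg d`.
  refine Finset.sum_subset (filter_subset _ _) fun p hp hp' => ?_
  have h1 : n ≤ p.1 + p.2 := by
    simp only [mem_filter, not_and, not_lt] at hp'
    exact hp' hp
  rw [smul_mul_smul_comm, LinearMap.map_smul_of_tower, coeff_of_lt_order, smul_zero]
  refine lt_of_lt_of_le ?_ le_order_mul
  refine lt_of_lt_of_le ?_ (add_le_add (le_order_pow_of_constantCoeff_eq_zero _ hf)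
    (le_order_pow_of_constantCoeff_eq_zero _ hg))
  have : d.degree < p.1 + p.2 := by omega
  exact_mod_cast this

theorem commute_formalExp {f g : MvPowerSeries σ A} (hf : constantCoeff f = 0)
    (h : Commute f g) : Commute (formalExp f) g := by
  change _ = _
  ext d
  have hn : ∀ c ≤ d, coeff c (formalExp f) =
      coeff c (∑ i ∈ range (d.degree + 1), ((i.factorial : ℂ)⁻¹) • f ^ i) :=
    fun c hc => coeff_formalExp hf (Nat.lt_succ_of_le (degree_le_of_le hc))
  rw [coeff_mul_congr hn (fun _ _ => rfl), coeff_mul_congr (fun _ _ => rfl) hn,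
    Finset.sum_mul, Finset.mul_sum]
  congr 1
  refine Finset.sum_congr rfl fun i _ => ?_
  rw [smul_mul_assoc, mul_smul_comm, (h.pow_left i).eq]

/-- A derivation that acts on coefficients satisfies `𝔇 e^f = (𝔇 f) e^f`. -/
theorem derivation_formalExp (𝔇 : MvPowerSeries σ A →ₗ[ℂ] MvPowerSeries σ A)
    (hmul : ∀ f g, 𝔇 (f * g) = 𝔇 f * g + f * 𝔇 g)
    (hloc : ∀ d, ∃ δ : A →ₗ[ℂ] A, ∀ f, coeff d (𝔇 f) = δ (coeff d f))
    {f : MvPowerSeries σ A} (hf : constantCoeff f = 0) (hcomm : Commute (𝔇 f) f) :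
    𝔇 (formalExp f) = 𝔇 f * formalExp f := by
  have hcongr : ∀ d (u v : MvPowerSeries σ A), coeff d u = coeff d v →
      coeff d (𝔇 u) = coeff d (𝔇 v) := fun d u v h => by
    obtain ⟨δ, hδ⟩ := hloc d
    rw [hδ, hδ, h]
  have hpow : ∀ i : ℕ, 𝔇 (f ^ i) = i • (𝔇 f * f ^ (i - 1)) := by
    intro i
    induction i with
    | zero =>
      have := hmul 1 1
      simpa using this
    | succ i ih =>
      rw [pow_succ, hmul, ih, smul_mul_assoc, mul_assoc]
      rcases i with _ | i
      · simp
      · rw [Nat.add_sub_cancel, ← pow_succ, ← (hcomm.pow_right (i + 1)).eq, Nat.add_sub_cancel,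
          succ_nsmul (𝔇 f * f ^ (i + 1)) (i + 1)]
  have h0 : constantCoeff (𝔇 f) = 0 := by
    obtain ⟨δ, hδ⟩ := hloc 0
    rw [← coeff_zero_eq_constantCoeff_apply, hδ, coeff_zero_eq_constantCoeff_apply, hf, map_zero]
  ext d
  have hn : ∀ c ≤ d, coeff c (formalExp f) =
      coeff c (∑ i ∈ range (d.degree + 1), ((i.factorial : ℂ)⁻¹) • f ^ i) :=
    fun c hc => coeff_formalExp hf (Nat.lt_succ_of_le (degree_le_of_le hc))
  -- One extra term is kept here, since `𝔇` sends `f^{i+1}/(i+1)!` to `𝔇 f · f^i/i!`. Locality of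
  -- `𝔇` allows it to be applied to the truncation.
  have hn' : coeff d (formalExp f) =
      coeff d (∑ i ∈ range (d.degree + 1 + 1), ((i.factorial : ℂ)⁻¹) • f ^ i) :=
    coeff_formalExp hf (by omega)
  rw [coeff_mul_congr (fun _ _ => rfl) hn, hcongr d _ _ hn', map_sum, sum_range_succ', mul_sum]
  simp only [map_smul, hpow, Nat.add_sub_cancel, zero_smul, smul_zero, add_zero, mul_smul_comm]
  congr 1
  refine Finset.sum_congr rfl fun i _ => ?_
  rw [← Nat.cast_smul_eq_nsmul ℂ, smul_smul]
  congr 1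
  rw [Nat.factorial_succ]
  have := Nat.cast_ne_zero (R := ℂ).2 i.factorial_ne_zero
  have h2 : ((i + 1 : ℕ) : ℂ) ≠ 0 := Nat.cast_ne_zero.2 (Nat.succ_ne_zero i)
  push_cast at h2 ⊢
  field_simp

/-- The derivation that multiplies monomials by their degree. -/
noncomputable def degreeD : MvPowerSeries σ A →ₗ[ℂ] MvPowerSeries σ A where
  toFun f := fun d => (d.degree : ℂ) • coeff d f
  map_add' f g := by
    funext d
    exact smul_add _ _ _
  map_smul' c f := by
    funext d
    exact smul_comm _ _ _

theorem coeff_degreeD (d : σ →₀ ℕ) (f : MvPowerSeries σ A) :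
    coeff d (degreeD f) = (d.degree : ℂ) • coeff d f := rfl

theorem degreeD_mul (f g : MvPowerSeries σ A) :
    degreeD (f * g) = degreeD f * g + f * degreeD g := by
  classical
  ext d
  rw [coeff_degreeD, map_add, coeff_mul, coeff_mul, coeff_mul, Finset.smul_sum,
    ← Finset.sum_add_distrib]
  refine Finset.sum_congr rfl fun p hp => ?_
  rw [HasAntidiagonal.mem_antidiagonal] at hp
  rw [coeff_degreeD, coeff_degreeD, ← hp, map_add, Nat.cast_add, add_smul, smul_mul_assoc,
    mul_smul_comm]

theorem degreeD_formalExp {f : MvPowerSeries σ A} (hf : constantCoeff f = 0)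
    (hcomm : Commute (degreeD f) f) : degreeD (formalExp f) = degreeD f * formalExp f :=
  derivation_formalExp _ degreeD_mul
    (fun d => ⟨(d.degree : ℂ) • LinearMap.id, fun _ => rfl⟩) hf hcomm

theorem degreeD_C (a : A) : degreeD (C a : MvPowerSeries σ A) = 0 := by
  classical
  ext d
  rw [coeff_degreeD, coeff_C]
  split_ifs with h <;> simp [h]

/-- A solution of `D Y = b Y` without constant term vanishes. -/
theorem eq_zero_of_degreeD_eq_mul {b Y : MvPowerSeries σ A} (hb : constantCoeff b = 0)
    (hY : constantCoeff Y = 0) (h : degreeD Y = b * Y) : Y = 0 := by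
  classical
  suffices ∀ n, ∀ d : σ →₀ ℕ, d.degree = n → coeff d Y = 0 by
    ext d
    exact this _ d rfl
  intro n
  induction n using Nat.strong_induction_on with
  | _ n ih =>
    intro d hd
    rcases Nat.eq_zero_or_pos n with rfl | hn
    · rw [(Finsupp.degree_eq_zero_iff d).1 hd]
      exact hY
    -- As `b` has no constant term, the coefficient of `b * Y` at `d` only involves coefficients of
    -- `Y` of smaller degree, which vanish by induction.
    have h1 : (d.degree : ℂ) • coeff d Y = 0 := by
      rw [← coeff_degreeD, h, coeff_mul]
      refine Finset.sum_eq_zero fun p hp => ?_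
      rw [HasAntidiagonal.mem_antidiagonal] at hp
      by_cases h0 : p.1 = 0
      · rw [h0, coeff_zero_eq_constantCoeff_apply, hb, zero_mul]
      · have : p.1.degree ≠ 0 := fun h => h0 ((Finsupp.degree_eq_zero_iff _).1 h)
        have h2 : p.1.degree + p.2.degree = n := by rw [← hd, ← hp, map_add]
        rw [ih p.2.degree (by omega) _ rfl, mul_zero]
    have h3 : (d.degree : ℂ) ≠ 0 := Nat.cast_ne_zero.2 (by omega)
    exact (smul_eq_zero.1 h1).resolve_left h3

/-- The mirror image of `eq_zero_of_degreeD_eq_mul`. -/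
theorem eq_zero_of_degreeD_eq_mul' {b Y : MvPowerSeries σ A} (hb : constantCoeff b = 0)
    (hY : constantCoeff Y = 0) (h : degreeD Y = Y * b) : Y = 0 := by
  classical
  suffices ∀ n, ∀ d : σ →₀ ℕ, d.degree = n → coeff d Y = 0 by
    ext d
    exact this _ d rfl
  intro n
  induction n using Nat.strong_induction_on with
  | _ n ih =>
    intro d hd
    rcases Nat.eq_zero_or_pos n with rfl | hn
    · rw [(Finsupp.degree_eq_zero_iff d).1 hd]
      exact hY
    have h1 : (d.degree : ℂ) • coeff d Y = 0 := by
      rw [← coeff_degreeD, h, coeff_mul]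
      refine Finset.sum_eq_zero fun p hp => ?_
      rw [HasAntidiagonal.mem_antidiagonal] at hp
      by_cases h0 : p.2 = 0
      · rw [h0, coeff_zero_eq_constantCoeff_apply, hb, mul_zero]
      · have : p.2.degree ≠ 0 := fun h => h0 ((Finsupp.degree_eq_zero_iff _).1 h)
        have h2 : p.1.degree + p.2.degree = n := by rw [← hd, ← hp, map_add]
        rw [ih p.1.degree (by omega) _ rfl, zero_mul]
    have h3 : (d.degree : ℂ) ≠ 0 := Nat.cast_ne_zero.2 (by omega)
    exact (smul_eq_zero.1 h1).resolve_left h3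

/-- If `[b, Φ] = D Φ`, then `e^b φ = Φ e^b`, where `φ` is the constant term of `Φ`. -/
theorem formalExp_mul_eq {b Φ : MvPowerSeries σ A} (hb : constantCoeff b = 0)
    (hcomm : Commute (degreeD b) b) (h : degreeD b * Φ - Φ * degreeD b = degreeD Φ) :
    formalExp b * C (constantCoeff Φ) = Φ * formalExp b := by
  rw [← sub_eq_zero]
  have hD := degreeD_formalExp hb hcomm
  have h0 : constantCoeff (degreeD b) = 0 := by
    rw [← coeff_zero_eq_constantCoeff_apply, coeff_degreeD, coeff_zero_eq_constantCoeff_apply, hb,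
      smul_zero]
  -- The difference `Y = e^b φ - Φ e^b` satisfies `D Y = (D b) Y`: the terms `Φ (D b) e^b` cancel by
  -- the hypothesis on `D Φ`.
  refine eq_zero_of_degreeD_eq_mul h0 ?_ ?_
  · simp [constantCoeff_formalExp]
  · rw [map_sub, degreeD_mul, degreeD_mul, degreeD_C, hD, ← h]
    noncomm_ring

/-- If `[Φ, b] = D Φ`, then `φ e^b = e^b Φ`, where `φ` is the constant term of `Φ`. -/
theorem mul_formalExp_eq {b Φ : MvPowerSeries σ A} (hb : constantCoeff b = 0)
    (hcomm : Commute (degreeD b) b) (h : Φ * degreeD b - degreeD b * Φ = degreeD Φ) :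
    C (constantCoeff Φ) * formalExp b = formalExp b * Φ := by
  rw [← sub_eq_zero]
  have hD := degreeD_formalExp hb hcomm
  have h0 : constantCoeff (degreeD b) = 0 := by
    rw [← coeff_zero_eq_constantCoeff_apply, coeff_degreeD, coeff_zero_eq_constantCoeff_apply, hb,
      smul_zero]
  have h1 : Commute (formalExp b) (degreeD b) := commute_formalExp hb hcomm.symm
  rw [← h1.eq] at hD
  refine eq_zero_of_degreeD_eq_mul' h0 ?_ ?_
  · simp [constantCoeff_formalExp]
  · rw [map_sub, degreeD_mul, degreeD_mul, degreeD_C, hD, ← h]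
    noncomm_ring

theorem coeff_linearSeries (a : σ → A) (s : σ) :
    coeff (Finsupp.single s 1) (linearSeries a) = a s := by
  change (if _ then _ else _) = _
  rw [if_pos (by simp)]
  simp

theorem coeff_linearSeries_of_degree_ne (a : σ → A) {d : σ →₀ ℕ} (h : d.degree ≠ 1) :
    coeff d (linearSeries a) = 0 := if_neg h

theorem constantCoeff_linearSeries (a : σ → A) : constantCoeff (linearSeries a) = 0 := by
  rw [← coeff_zero_eq_constantCoeff_apply, coeff_linearSeries_of_degree_ne _ (by simp)]

theorem degreeD_linearSeries (a : σ → A) : degreeD (linearSeries a) = linearSeries a := by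
  ext d
  rw [coeff_degreeD]
  by_cases h : d.degree = 1
  · simp [h]
  · rw [coeff_linearSeries_of_degree_ne _ h, smul_zero]

theorem exists_eq_single_of_degree_eq_one {d : σ →₀ ℕ} (h : d.degree = 1) :
    ∃ s, d = Finsupp.single s 1 := by
  classical
  obtain ⟨s, hs⟩ : ∃ s, d s ≠ 0 := by
    by_contra! h0
    rw [show d = 0 from Finsupp.ext h0] at h
    simp at h
  have hle : Finsupp.single s 1 ≤ d := by
    rw [Finsupp.single_le_iff]
    omega
  obtain ⟨e, rfl⟩ := exists_add_of_le hle
  rw [map_add, Finsupp.degree_single] at h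
  rw [(Finsupp.degree_eq_zero_iff e).1 (by omega)]
  exact ⟨s, add_zero _⟩

end FormalExp

end BKP

namespace BKP

open MvPowerSeries Finset

/-! ### Substitution into power series with noncommutative coefficients -/

section Substitution

variable {κ σ A : Type*} [Ring A] [Algebra ℂ A]

/-- The monomial `∏ a_s^{d_s}`. -/
noncomputable def monomialAt (a : κ → MvPowerSeries σ ℂ) (d : κ →₀ ℕ) : MvPowerSeries σ ℂ :=
  d.prod fun s e => a s ^ e

theorem monomialAt_add (a : κ → MvPowerSeries σ ℂ) (d e : κ →₀ ℕ) :
    monomialAt a (d + e) = monomialAt a d * monomialAt a e := by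
  classical
  exact Finsupp.prod_add_index' (fun _ => pow_zero _) (fun _ _ _ => pow_add _ _ _)

theorem monomialAt_zero (a : κ → MvPowerSeries σ ℂ) : monomialAt a 0 = 1 :=
  Finsupp.prod_zero_index

theorem monomialAt_single (a : κ → MvPowerSeries σ ℂ) (s : κ) (n : ℕ) :
    monomialAt a (Finsupp.single s n) = a s ^ n :=
  Finsupp.prod_single_index (pow_zero _)

/-- Application of a linear map to all coefficients. -/
noncomputable def coeffMap {B : Type*} [Ring B] [Algebra ℂ B] (ℓ : A →ₗ[ℂ] B) :
    MvPowerSeries σ A →ₗ[ℂ] MvPowerSeries σ B where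
  toFun G := fun d => ℓ (coeff d G)
  map_add' f g := by
    funext d
    exact map_add _ _ _
  map_smul' c f := by
    funext d
    exact map_smul _ _ _

theorem coeff_coeffMap {B : Type*} [Ring B] [Algebra ℂ B] (ℓ : A →ₗ[ℂ] B) (G : MvPowerSeries σ A)
    (d : σ →₀ ℕ) : coeff d (coeffMap ℓ G) = ℓ (coeff d G) := rfl

/-- Substitution of scalar power series `a` into a power series with coefficients in a ring that
need not be commutative. -/
noncomputable def substOp (a : κ → MvPowerSeries σ ℂ) (G : MvPowerSeries κ A) :
    MvPowerSeries σ A :=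
  fun c => ∑ᶠ d, coeff c (monomialAt a d) • coeff d G

variable {a : κ → MvPowerSeries σ ℂ}

theorem constantCoeff_of_hasSubst (ha : HasSubst a) (s : κ) : constantCoeff (a s) = 0 :=
  (ha.const_coeff s).eq_zero

theorem monomialAt_support_finite (ha : HasSubst a) (c : σ →₀ ℕ) :
    {d | coeff c (monomialAt a d) ≠ 0}.Finite := by
  have := coeff_subst_finite ha (fun _ => 1 : MvPowerSeries κ ℂ) c
  refine this.subset fun d hd => ?_
  change (1 : ℂ) • _ ≠ 0
  rw [one_smul]
  exact hd

theorem coeff_substOp {c : σ →₀ ℕ} {D : Finset (κ →₀ ℕ)}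
    (hD : ∀ d, coeff c (monomialAt a d) ≠ 0 → d ∈ D) (G : MvPowerSeries κ A) :
    coeff c (substOp a G) = ∑ d ∈ D, coeff c (monomialAt a d) • coeff d G := by
  refine finsum_eq_sum_of_support_subset _ fun d hd => ?_
  refine hD d fun h => hd ?_
  change _ • _ = _
  rw [h, zero_smul]

/-- One finite set serves all exponents below `c`; this is what products require, since their
coefficient at `c` involves all smaller exponents. -/
theorem exists_finset_monomialAt (ha : HasSubst a) (c : σ →₀ ℕ) :
    ∃ D : Finset (κ →₀ ℕ), ∀ c' ≤ c, ∀ d, coeff c' (monomialAt a d) ≠ 0 → d ∈ D := by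
  classical
  have h : (⋃ c' ∈ Set.Iic c, {d | coeff c' (monomialAt a d) ≠ 0}).Finite :=
    Set.Finite.biUnion (((antidiagonal c).image Prod.fst).finite_toSet.subset fun c' hc' => by
      obtain ⟨e, rfl⟩ := exists_add_of_le (Set.mem_Iic.1 hc')
      simp only [coe_image, Set.mem_image, mem_coe]
      exact ⟨(c', e), by simp⟩) fun c' _ => monomialAt_support_finite ha c'
  refine ⟨h.toFinset, fun c' hc' d hd => ?_⟩
  rw [Set.Finite.mem_toFinset]
  exact Set.mem_biUnion (x := c') hc' hd

theorem substOp_sum_smul (ha : HasSubst a) {ι : Type*} (s : Finset ι) (w : ι → ℂ)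
    (G : ι → MvPowerSeries κ A) :
    substOp a (∑ i ∈ s, w i • G i) = ∑ i ∈ s, w i • substOp a (G i) := by
  ext c
  obtain ⟨D, hD⟩ := exists_finset_monomialAt ha c
  rw [coeff_substOp (hD c le_rfl), map_sum]
  simp_rw [LinearMap.map_smul_of_tower, coeff_substOp (hD c le_rfl), map_sum,
    LinearMap.map_smul_of_tower, Finset.smul_sum]
  rw [sum_comm]
  simp_rw [smul_smul, mul_comm]

theorem substOp_one (ha : HasSubst a) : substOp a (1 : MvPowerSeries κ A) = 1 := by
  classical
  ext c
  obtain ⟨D, hD⟩ := exists_finset_monomialAt ha c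
  rw [coeff_substOp (D := insert 0 D) (fun d hd => mem_insert_of_mem (hD c le_rfl d hd)),
    sum_eq_single 0]
  · rw [monomialAt_zero, coeff_one, coeff_one, coeff_one]
    split_ifs <;> simp_all
  · intro d _ hd
    rw [coeff_one, if_neg hd, smul_zero]
  · simp

theorem substOp_mul (ha : HasSubst a) (G G' : MvPowerSeries κ A) :
    substOp a (G * G') = substOp a G * substOp a G' := by
  classical
  ext c
  obtain ⟨D, hD⟩ := exists_finset_monomialAt ha c
  set F : (κ →₀ ℕ) × (κ →₀ ℕ) → A := fun q =>
    coeff c (monomialAt a q.1 * monomialAt a q.2) • (coeff q.1 G * coeff q.2 G') with hF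
  have hF0 : ∀ q, F q ≠ 0 → q ∈ D ×ˢ D := by
    intro q hq
    have h1 : coeff c (monomialAt a q.1 * monomialAt a q.2) ≠ 0 := fun h => hq (by
      rw [hF]
      simp only [h, zero_smul])
    rw [coeff_mul] at h1
    obtain ⟨p, hp, hp'⟩ := Finset.exists_ne_zero_of_sum_ne_zero h1
    rw [HasAntidiagonal.mem_antidiagonal] at hp
    rw [mem_product]
    exact ⟨hD _ (hp ▸ le_self_add) _ (left_ne_zero_of_mul hp'),
      hD _ (hp ▸ le_add_self) _ (right_ne_zero_of_mul hp')⟩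
  have hR : coeff c (substOp a G * substOp a G') = ∑ q ∈ D ×ˢ D, F q := by
    rw [coeff_mul]
    have : ∀ p ∈ antidiagonal c, coeff p.1 (substOp a G) * coeff p.2 (substOp a G') =
        ∑ q ∈ D ×ˢ D, (coeff p.1 (monomialAt a q.1) * coeff p.2 (monomialAt a q.2)) •
          (coeff q.1 G * coeff q.2 G') := by
      intro p hp
      rw [HasAntidiagonal.mem_antidiagonal] at hp
      rw [coeff_substOp (hD p.1 (hp ▸ le_self_add)), coeff_substOp (hD p.2 (hp ▸ le_add_self)),
        Finset.sum_mul_sum, ← Finset.sum_product']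
      refine Finset.sum_congr rfl fun q _ => ?_
      rw [smul_mul_smul_comm]
    rw [Finset.sum_congr rfl this, sum_comm]
    refine Finset.sum_congr rfl fun q _ => ?_
    rw [hF]
    simp only [coeff_mul, Finset.sum_smul]
  rw [hR]
  -- The set is enlarged by all sums, so that every pair in `D ×ˢ D` lies on the antidiagonal of
  -- some member of `D2`. Both sides are then sums of `F`.
  set D2 := D ∪ (D ×ˢ D).image (fun q => q.1 + q.2)
  rw [coeff_substOp (D := D2) (fun d hd => mem_union_left _ (hD c le_rfl d hd))]
  have : ∀ d ∈ D2, coeff c (monomialAt a d) • coeff d (G * G') = ∑ q ∈ antidiagonal d, F q := by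
    intro d _
    rw [coeff_mul, Finset.smul_sum]
    refine Finset.sum_congr rfl fun q hq => ?_
    rw [HasAntidiagonal.mem_antidiagonal] at hq
    rw [hF, ← hq, monomialAt_add]
  rw [Finset.sum_congr rfl this, ← Finset.sum_biUnion]
  · symm
    refine Finset.sum_subset ?_ fun q _ hq => ?_
    · intro q hq
      rw [mem_biUnion]
      exact ⟨q.1 + q.2, mem_union_right _ (mem_image_of_mem _ hq), by simp⟩
    · by_contra h
      exact hq (hF0 q h)
  · intro x _ y _ hxy
    refine Finset.disjoint_left.2 fun q hq hq' => hxy ?_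
    rw [HasAntidiagonal.mem_antidiagonal] at hq hq'
    exact hq.symm.trans hq'

theorem substOp_pow (ha : HasSubst a) (G : MvPowerSeries κ A) (n : ℕ) :
    substOp a (G ^ n) = substOp a G ^ n := by
  induction n with
  | zero => rw [pow_zero, pow_zero, substOp_one ha]
  | succ n ih => rw [pow_succ, pow_succ, substOp_mul ha, ih]

theorem constantCoeff_substOp (ha : HasSubst a) {f : MvPowerSeries κ A}
    (hf : constantCoeff f = 0) : constantCoeff (substOp a f) = 0 := by
  change ∑ᶠ d, _ = _
  refine finsum_eq_zero_of_forall_eq_zero fun d => ?_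
  by_cases hd : d = 0
  · rw [hd, coeff_zero_eq_constantCoeff_apply f, hf, smul_zero]
  · obtain ⟨s, hs⟩ : ∃ s, d s ≠ 0 := by
      by_contra! h
      exact hd (Finsupp.ext h)
    have hle : Finsupp.single s 1 ≤ d := by
      rw [Finsupp.single_le_iff]
      omega
    obtain ⟨e, rfl⟩ := exists_add_of_le hle
    rw [monomialAt_add, monomialAt_single, pow_one, coeff_zero_eq_constantCoeff_apply, map_mul,
      constantCoeff_of_hasSubst ha, zero_mul, zero_smul]

theorem substOp_formalExp (ha : HasSubst a) {f : MvPowerSeries κ A} (hf : constantCoeff f = 0) :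
    substOp a (formalExp f) = formalExp (substOp a f) := by
  ext c
  obtain ⟨D, hD⟩ := exists_finset_monomialAt ha c
  -- This cutoff is valid both for the exponential before substitution, at every `d ∈ D`, and for
  -- the one after it, at `c`.
  set n := c.degree + D.sup Finsupp.degree + 1
  have h1 : coeff c (substOp a (formalExp f)) =
      coeff c (substOp a (∑ i ∈ range n, ((i.factorial : ℂ)⁻¹) • f ^ i)) := by
    rw [coeff_substOp (hD c le_rfl), coeff_substOp (hD c le_rfl)]
    refine Finset.sum_congr rfl fun d hd => ?_
    have := Finset.le_sup (f := Finsupp.degree) hd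
    rw [coeff_formalExp hf (by omega : d.degree < n)]
  rw [h1, coeff_formalExp (constantCoeff_substOp ha hf) (by omega : c.degree < n),
    substOp_sum_smul ha]
  simp_rw [substOp_pow ha]

/-- The coefficients of `substOp a (linearSeries h)`. -/
theorem coeff_substOp_linearSeries (h : κ → A) (c : σ →₀ ℕ) :
    coeff c (substOp a (linearSeries h)) = ∑ᶠ s, coeff c (a s) • h s := by
  classical
  change ∑ᶠ d, _ = _
  have hinj : Function.Injective fun s : κ => Finsupp.single s 1 :=
    Finsupp.single_left_injective one_ne_zero
  have h1 : ∀ s, coeff c (a s) • h s =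
      coeff c (monomialAt a (Finsupp.single s 1)) • coeff (Finsupp.single s 1) (linearSeries h) := by
    intro s
    rw [monomialAt_single, pow_one, coeff_linearSeries]
  rw [finsum_congr h1, ← finsum_mem_range
    (f := fun d => coeff c (monomialAt a d) • coeff d (linearSeries h)) hinj, finsum_mem_def]
  refine finsum_congr fun d => ?_
  rw [Set.indicator_apply]
  split_ifs with hd
  · rfl
  · rw [coeff_linearSeries_of_degree_ne, smul_zero]
    intro hd1
    obtain ⟨s, rfl⟩ := exists_eq_single_of_degree_eq_one hd1
    exact hd ⟨s, rfl⟩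

theorem subst_coeffMap (ha : HasSubst a) (ℓ : A →ₗ[ℂ] ℂ) (G : MvPowerSeries κ A) :
    subst a (coeffMap ℓ G) = coeffMap ℓ (substOp a G) := by
  ext c
  obtain ⟨D, hD⟩ := exists_finset_monomialAt ha c
  rw [coeff_subst ha, coeff_coeffMap, coeff_substOp (hD c le_rfl), map_sum]
  rw [finsum_eq_sum_of_support_subset (s := D)]
  · refine Finset.sum_congr rfl fun d _ => ?_
    rw [map_smul, smul_eq_mul, coeff_coeffMap, smul_eq_mul, mul_comm]
    rfl
  · intro d hd
    refine hD c le_rfl d fun h => hd ?_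
    change _ • coeff c (monomialAt a d) = _
    rw [h, smul_zero]

end Substitution

end BKP

namespace BKP

/-! ### Operators on the Fock space -/

/-- The vacuum vector. -/
noncomputable abbrev ket : Fock := Finsupp.single ∅ 1

/-- The dual vacuum: the coefficient of the vacuum. -/
noncomputable def bra : Fock →ₗ[ℂ] ℂ := Finsupp.lapply ∅

theorem fermion_neg_ket {m : ℤ} (hm : m < 0) : fermion m ket = 0 := by
  rw [fermion_single, fermionOnBasis]
  simp [hm]

theorem bra_fermion_pos {m : ℤ} (hm : 0 < m) (u : Fock) : bra (fermion m u) = 0 := by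
  have : bra ∘ₗ fermion m = 0 := by
    ext S
    simp only [LinearMap.comp_apply, Finsupp.lsingle_apply, fermion_single, fermionOnBasis, map_smul,
      LinearMap.zero_apply]
    split_ifs
    · simp
    · omega
    · simp [bra, Finsupp.single_apply]
  exact LinearMap.congr_fun this u

/-- Multiplication by `φ_0` from the right, acting on basis vectors `φ_{n₁} ⋯ φ_{n_k} |0⟩` as
`φ_{n₁} ⋯ φ_{n_k} φ_0 |0⟩`. -/
noncomputable def rightZero : Module.End ℂ Fock :=
  Finsupp.linearCombination ℂ fun S =>
    if 0 ∈ S then Finsupp.single (S.erase 0) (1 / 2) else Finsupp.single (insert 0 S) 1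

theorem rightZero_single (S : Finset ℕ) : rightZero (Finsupp.single S 1) =
    if 0 ∈ S then Finsupp.single (S.erase 0) (1 / 2) else Finsupp.single (insert 0 S) 1 := by
  simp [rightZero]

theorem rightZero_sq : rightZero * rightZero = (1 / 2 : ℂ) • 1 := by
  ext1 S
  ext1
  simp only [LinearMap.comp_apply, Finsupp.lsingle_apply, Module.End.mul_apply, rightZero_single,
    LinearMap.smul_apply, Module.End.one_apply]
  by_cases h : 0 ∈ S
  · rw [if_pos h, single_smul_one, map_smul, rightZero_single, if_neg (by simp),
      Finset.insert_erase h]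
  · rw [if_neg h, rightZero_single, if_pos (by simp), Finset.erase_insert h, single_smul_one]

/-- One factor acts at the left end of the word `φ_{n₁} ⋯ φ_{n_k}` and the other at its right end,
so no sign arises. This makes `rightZero` a way to change parity without disturbing any bilinear
operator. -/
theorem fermion_rightZero_commute (m : ℤ) : Commute (fermion m) rightZero := by
  change _ * _ = _ * _
  ext1 S
  ext1
  simp only [LinearMap.comp_apply, Finsupp.lsingle_apply, Module.End.mul_apply, rightZero_single,
    fermion_single]
  have h1 : ∀ T c, fermion m (Finsupp.single T c) = c • fermionOnBasis m T := fun T c => by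
    rw [single_smul_one, map_smul, fermion_single]
  have h2 : ∀ T c, rightZero (Finsupp.single T c) = c • (if 0 ∈ T then
      Finsupp.single (T.erase 0) (1 / 2) else Finsupp.single (insert 0 T) 1 : Fock) := fun T c => by
    rw [single_smul_one, map_smul, rightZero_single]
  have h0 : ∀ k : ℕ, ¬ (k < 0) := by omega
  rcases eq_or_ne m 0 with rfl | hm
  · by_cases h : 0 ∈ S <;>
      simp [-Finsupp.single_mul, h, h1, h2, fermionOnBasis, sign_erase, sign_insert, -Finsupp.smul_single]
    ext T
    simp [Finsupp.single_apply, h2, h]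
    split_ifs <;> simp [mul_comm]
  · have hm1 : m.natAbs ≠ 0 := by omega
    have hm2 : (0 : ℕ) ≠ m.natAbs := by omega
    by_cases h : 0 ∈ S <;> by_cases h' : m.natAbs ∈ S <;> by_cases hp : 0 < m <;>
      by_cases hn : m < 0 <;>
      simp [-Finsupp.single_mul, h, h', hp, hn, hm, hm1, hm2, h1, h2, fermionOnBasis, sign_erase,
        sign_insert, -Finsupp.smul_single, smul_smul, mul_comm, Finset.erase_right_comm (a := 0),
        Finset.insert_comm 0, Finset.erase_insert_of_ne hm1, Finset.erase_insert_of_ne hm2] <;>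
      (ext T
       simp [Finsupp.single_apply, mul_comm, mul_assoc, mul_left_comm])

theorem rightZero_ket : rightZero ket = fermion 0 ket := by
  rw [rightZero_single, fermion_single]
  simp [fermionOnBasis]

theorem bra_rightZero (u : Fock) : bra (rightZero u) = bra (fermion 0 u) := by
  have : bra ∘ₗ rightZero = bra ∘ₗ fermion 0 := by
    ext S
    simp only [LinearMap.comp_apply, Finsupp.lsingle_apply, fermion_single, fermionOnBasis,
      rightZero_single]
    by_cases h : 0 ∈ S
    · simp only [h, bra, Finsupp.lapply_apply]
      by_cases h2 : S.erase 0 = ∅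
      · have : S = {0} := by
          rw [← Finset.insert_erase h, h2]
          rfl
        simp [this, Finset.filter_singleton]
      · simp [h, Finsupp.single_apply, h2]
    · simp [h, bra, Finsupp.single_apply]
  exact LinearMap.congr_fun this u

/-- A linear functional that vanishes on the image of all `φ_m` with `m ≥ 1` is determined by its
values at `|0⟩` and `φ_0 |0⟩`. -/
theorem functional_eq_zero {f : Fock →ₗ[ℂ] ℂ} (h : ∀ m : ℤ, 0 < m → ∀ u, f (fermion m u) = 0)
    (h0 : f ket = 0) (h1 : f (fermion 0 ket) = 0) (u : Fock) : f u = 0 := by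
  have : f = 0 := by
    ext S
    simp only [LinearMap.comp_apply, Finsupp.lsingle_apply, LinearMap.zero_apply]
    rcases S.eq_empty_or_nonempty with rfl | hS
    · exact h0
    -- Creating the largest index last gives the basis vector of `S` as `φ_n` of the smaller one,
    -- without a sign.
    · set n := S.max' hS with hn
      have hnS : n ∈ S := S.max'_mem hS
      have hfil : (S.erase n).filter (fun s => n < s) = ∅ := by
        refine Finset.filter_eq_empty_iff.2 fun s hs => not_lt.2 (S.le_max' s ?_)
        exact Finset.mem_of_mem_erase hs
      have hSn : (Finsupp.single S 1 : Fock) = fermion n (Finsupp.single (S.erase n) 1) := by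
        rw [fermion_single, fermionOnBasis]
        simp [hfil, Finset.insert_erase hnS]
      rcases Nat.eq_zero_or_pos n with h00 | hpos
      · have hS0 : S = {0} := by
          refine Finset.eq_singleton_iff_unique_mem.2 ⟨h00 ▸ hnS, fun x hx => ?_⟩
          have := S.le_max' x hx
          omega
        have : fermion 0 ket = Finsupp.single S 1 := by
          rw [fermion_single, hS0]
          simp [fermionOnBasis]
        rw [← this]
        exact h1
      · rw [hSn]
        exact h _ (by exact_mod_cast hpos) _
  rw [this]
  rfl

/-! ### Bilinear operators and their commutators with the fermions. -/

theorem fermion_mul_fermion (m n : ℤ) : fermion m * fermion n =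
    (if m + n = 0 then (-1 : ℂ) ^ m • 1 else 0) - fermion n * fermion m := by
  rw [← fermion_anticomm m n]
  exact (add_sub_cancel_right (fermion m * fermion n) (fermion n * fermion m)).symm

theorem fermion_zero_sq : fermion 0 * fermion 0 = (1 / 2 : ℂ) • 1 := by
  have := fermion_anticomm 0 0
  rw [if_pos (by norm_num), zpow_zero, ← two_smul ℂ] at this
  rw [← inv_smul_smul₀ (two_ne_zero (α := ℂ)) (fermion 0 * fermion 0), this, smul_smul]
  norm_num

/-- Allowing every larger index set makes it possible to compare the operator on two different
vectors term by term over a common set. -/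
theorem bilinear_apply (c : ℤ → ℂ) {k : ℤ} (hk : k ≠ 0) (u : Fock) :
    ∃ F : Finset ℤ, ∀ G, F ⊆ G →
      bilinear c k u = ∑ n ∈ G, c n • (fermion n * fermion (k - n)) u := by
  induction u using Finsupp.induction_linear with
  | zero => exact ⟨∅, fun G _ => by simp⟩
  | add u v hu hv =>
    obtain ⟨F, hF⟩ := hu
    obtain ⟨F', hF'⟩ := hv
    refine ⟨F ∪ F', fun G hG => ?_⟩
    rw [map_add, hF G (Finset.union_subset_left hG), hF' G (Finset.union_subset_right hG),
      ← Finset.sum_add_distrib]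
    simp
  | single S a =>
    refine ⟨(bilinear_support_finite c hk S).toFinset, fun G hG => ?_⟩
    rw [bilinear, Finsupp.linearCombination_single, finsum_eq_sum_of_support_subset (s := G),
      Finset.smul_sum]
    · refine Finset.sum_congr rfl fun n _ => ?_
      rw [single_smul_one S a, map_smul, smul_comm]
    · intro n hn
      exact hG ((Set.Finite.mem_toFinset _).2 hn)

theorem neg_one_zpow_neg (m : ℤ) : (-1 : ℂ) ^ (-m) = (-1) ^ m := by
  rw [zpow_neg, ← inv_zpow]
  norm_num

/-- By `[ab, c] = a{b,c} - {a,c}b`, only the summands `n = k + m` and `n = -m` contribute, and both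
are multiples of `φ_{k+m}`. -/
theorem bilinear_fermion_commutator (c : ℤ → ℂ) {k : ℤ} (hk : k ≠ 0) (m : ℤ) :
    bilinear c k * fermion m - fermion m * bilinear c k =
      ((-1 : ℂ) ^ m * (c (k + m) - c (-m))) • fermion (k + m) := by
  refine LinearMap.ext fun u => ?_
  obtain ⟨F, hF⟩ := bilinear_apply c hk u
  obtain ⟨F', hF'⟩ := bilinear_apply c hk (fermion m u)
  set G := F ∪ F' ∪ {k + m, -m} with hG
  have h1 : F ⊆ G := fun x hx => by simp [hG, hx]
  have h2 : F' ⊆ G := fun x hx => by simp [hG, hx]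
  rw [LinearMap.sub_apply, Module.End.mul_apply, Module.End.mul_apply, hF G h1, hF' G h2, map_sum,
    ← Finset.sum_sub_distrib]
  have key : ∀ n, c n • (fermion n * fermion (k - n)) (fermion m u) -
      fermion m (c n • (fermion n * fermion (k - n)) u) =
      (if n = k + m then ((-1 : ℂ) ^ m * c (k + m)) • fermion (k + m) u else 0) -
      (if n = -m then ((-1 : ℂ) ^ m * c (-m)) • fermion (k + m) u else 0) := by
    intro n
    have e1 : (fermion n * fermion (k - n)) * fermion m - fermion m * (fermion n * fermion (k - n)) =
        fermion n * (fermion (k - n) * fermion m + fermion m * fermion (k - n)) -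
        (fermion n * fermion m + fermion m * fermion n) * fermion (k - n) := by noncomm_ring
    rw [map_smul, ← smul_sub]
    have e2 := LinearMap.congr_fun e1 u
    simp only [LinearMap.sub_apply, Module.End.mul_apply (fermion n * fermion (k - n)) (fermion m) u,
      Module.End.mul_apply (fermion m) (fermion n * fermion (k - n)) u] at e2
    rw [e2, fermion_anticomm, fermion_anticomm]
    have hA : (k - n + m = 0) ↔ n = k + m := by omega
    have hB : (n + m = 0) ↔ n = -m := by omega
    simp only [hA, hB]
    have t1 : (fermion n * (if n = k + m then (-1 : ℂ) ^ (k - n) • 1 else 0)) u =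
        if n = k + m then (-1 : ℂ) ^ m • fermion (k + m) u else 0 := by
      split_ifs with h
      · subst h
        rw [show k - (k + m) = -m by ring, neg_one_zpow_neg]
        simp
      · simp
    have t2 : ((if n = -m then (-1 : ℂ) ^ n • 1 else 0) * fermion (k - n)) u =
        if n = -m then (-1 : ℂ) ^ m • fermion (k + m) u else 0 := by
      split_ifs with h
      · subst h
        rw [show k - -m = k + m by ring, neg_one_zpow_neg]
        simp
      · simp
    rw [t1, t2, smul_sub]
    congr 1
    · split_ifs with h
      · rw [smul_smul, ← h, mul_comm]
      · rw [smul_zero]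
    · split_ifs with h
      · rw [smul_smul, ← h, mul_comm]
      · rw [smul_zero]
  simp_rw [key]
  rw [Finset.sum_sub_distrib, Finset.sum_ite_eq', Finset.sum_ite_eq', if_pos (by simp [hG]),
    if_pos (by simp [hG]), LinearMap.smul_apply, mul_sub, sub_smul]

/-- `[H_n, φ_m] = φ_{m-n}` for odd `n`. -/
theorem hamiltonian_fermion_commutator {n : ℕ} (hn : Odd n) (m : ℤ) :
    hamiltonian n * fermion m - fermion m * hamiltonian n = fermion (m - n) := by
  have h0 : (n : ℤ) ≠ 0 := by
    have := hn.pos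
    omega
  have hodd : Odd (-(n : ℤ)) := by
    exact Odd.neg (by exact_mod_cast hn)
  rw [hamiltonian, bilinear_fermion_commutator _ (neg_ne_zero.2 h0)]
  have h1 : (-1 : ℂ) ^ (-(n : ℤ) + m + 1) = (-1) ^ m := by
    rw [zpow_add₀ (by norm_num), zpow_add₀ (by norm_num), hodd.neg_one_zpow]
    simp
  have h2 : (-1 : ℂ) ^ (-m + 1) = - (-1) ^ m := by
    rw [zpow_add₀ (by norm_num), neg_one_zpow_neg]
    simp
  have h3 : (-1 : ℂ) ^ m * (-1) ^ m = 1 := by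
    rw [← mul_zpow]
    simp
  rw [h1, h2, show -(n : ℤ) + m = m - n by ring]
  rw [show (-1 : ℂ) ^ m * (1 / 2 * (-1) ^ m - 1 / 2 * -(-1) ^ m) = (-1) ^ m * (-1) ^ m by ring, h3,
    one_smul]

/-- The product `r(m+1) r(m+2) ⋯ r(m+l)`. -/
noncomputable def rShift (r : ℤ → ℂ) (m : ℤ) (l : ℕ) : ℂ := ∏ j ∈ Finset.range l, r (m + 1 + j)

theorem rShift_add (r : ℤ → ℂ) (m : ℤ) (l k : ℕ) :
    rShift r m (l + k) = rShift r m l * rShift r (m + l) k := by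
  rw [rShift, Finset.prod_range_add]
  refine congrArg _ (Finset.prod_congr rfl fun j _ => congrArg r ?_)
  push_cast
  ring

theorem rShift_zero (r : ℤ → ℂ) (m : ℤ) : rShift r m 0 = 1 := Finset.prod_range_zero _

theorem rShift_zero_left (r : ℤ → ℂ) (l : ℕ) : rShift r 0 l = rProd r l :=
  Finset.prod_congr rfl fun j _ => congrArg r (by ring)

/-- `[B_k, φ_m] = - r(m+1) ⋯ r(m+k) φ_{m+k}` for odd `k`. -/
theorem symmetryOp_fermion_commutator {r : ℤ → ℂ} (hr : ∀ n : ℤ, r n = r (1 - n)) {k : ℕ}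
    (hk : Odd k) (m : ℤ) :
    symmetryOp r k * fermion m - fermion m * symmetryOp r k =
      -(rShift r m k • fermion (m + k)) := by
  have h0 : (k : ℤ) ≠ 0 := by
    have := hk.pos
    omega
  rw [symmetryOp, bilinear_fermion_commutator _ h0]
  have h1 : (-1 : ℂ) ^ ((k : ℤ) + m) = -(-1) ^ m := by
    rw [zpow_add₀ (by norm_num), zpow_natCast, hk.neg_one_pow]
    simp
  have h3 : (-1 : ℂ) ^ m * (-1) ^ m = 1 := by
    rw [← mul_zpow]
    simp
  have p1 : ∏ j ∈ Finset.range k, r ((k : ℤ) + m - j) = rShift r m k := by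
    rw [← Finset.prod_range_reflect, rShift]
    refine Finset.prod_congr rfl fun j hj => congrArg r ?_
    rw [Finset.mem_range] at hj
    omega
  -- The symmetry `r(n) = r(1-n)` makes the two contributions equal; their sum cancels the factor
  -- `1/2` in `B_k`.
  have p2 : ∏ j ∈ Finset.range k, r (-m - j) = rShift r m k := by
    refine Finset.prod_congr rfl fun j hj => ?_
    rw [hr]
    exact congrArg r (by ring)
  rw [h1, p1, p2, neg_one_zpow_neg, add_comm (k : ℤ) m]
  refine Eq.trans ?_ (neg_smul (M := Module.End ℂ Fock) _ _)
  congr 1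
  linear_combination (-rShift r m k) * h3

theorem bilinear_ket (c : ℤ → ℂ) {k : ℤ} (hk : k < 0) : bilinear c k ket = 0 := by
  obtain ⟨F, hF⟩ := bilinear_apply c hk.ne ket
  rw [hF F subset_rfl]
  refine Finset.sum_eq_zero fun n _ => ?_
  rw [Module.End.mul_apply]
  rcases lt_or_ge (k - n) 0 with h | h
  · rw [fermion_neg_ket h, map_zero, smul_zero]
  · rw [← Module.End.mul_apply, fermion_mul_fermion, if_neg (by omega), LinearMap.sub_apply,
      LinearMap.zero_apply, zero_sub, Module.End.mul_apply, fermion_neg_ket (by omega : n < 0), map_zero,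
      neg_zero, smul_zero]

theorem bra_bilinear (c : ℤ → ℂ) {k : ℤ} (hk : 0 < k) (u : Fock) : bra (bilinear c k u) = 0 := by
  obtain ⟨F, hF⟩ := bilinear_apply c hk.ne' u
  rw [hF F subset_rfl, map_sum]
  refine Finset.sum_eq_zero fun n _ => ?_
  rw [map_smul]
  rcases lt_or_ge 0 n with h | h
  · rw [Module.End.mul_apply, bra_fermion_pos h, smul_zero]
  · rw [fermion_mul_fermion, if_neg (by omega), LinearMap.sub_apply,
      LinearMap.zero_apply, zero_sub, Module.End.mul_apply, map_neg, bra_fermion_pos (by omega : 0 < k - n),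
      neg_zero, smul_zero]

theorem hamiltonian_ket {n : ℕ} (hn : 0 < n) : hamiltonian n ket = 0 :=
  bilinear_ket _ (by omega)

theorem bra_symmetryOp (r : ℤ → ℂ) {k : ℕ} (hk : 0 < k) (u : Fock) :
    bra (symmetryOp r k u) = 0 :=
  bra_bilinear _ (by omega) u

theorem bilinear_rightZero_commute (c : ℤ → ℂ) {k : ℤ} (hk : k ≠ 0) :
    Commute (bilinear c k) rightZero := by
  refine LinearMap.ext fun u => ?_
  obtain ⟨F, hF⟩ := bilinear_apply c hk u
  obtain ⟨F', hF'⟩ := bilinear_apply c hk (rightZero u)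
  rw [Module.End.mul_apply, Module.End.mul_apply, hF (F ∪ F') Finset.subset_union_left,
    hF' (F ∪ F') Finset.subset_union_right, map_sum]
  refine Finset.sum_congr rfl fun n _ => ?_
  have := ((fermion_rightZero_commute n).mul_left (fermion_rightZero_commute (k - n))).eq
  rw [map_smul, ← Module.End.mul_apply, this, Module.End.mul_apply]

/-- An operator that commutes with all `φ_m` and kills the vacuum vanishes. -/
theorem operator_eq_zero {X : Module.End ℂ Fock} (h : ∀ m, Commute X (fermion m))
    (h0 : X ket = 0) : X = 0 := by
  ext1 S
  ext1
  simp only [LinearMap.comp_apply, Finsupp.lsingle_apply, LinearMap.zero_apply]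
  induction S using Finset.induction_on_max with
  | empty => exact h0
  | insert a S ha ih =>
    have hfil : S.filter (fun s => a < s) = ∅ :=
      Finset.filter_eq_empty_iff.2 fun s hs => not_lt.2 (ha s hs).le
    have haS : a ∉ S := fun h => lt_irrefl _ (ha a h)
    have : (Finsupp.single (insert a S) 1 : Fock) = fermion a (Finsupp.single S 1) := by
      rw [fermion_single, fermionOnBasis]
      simp [haS, hfil]
    rw [this, ← Module.End.mul_apply, (h a).eq, Module.End.mul_apply, ih, map_zero]

theorem commutator_commute {A : Type*} [Ring A] {X Y : A} {φ : ℤ → A} {n k : ℤ}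
    (hX : ∀ j, X * φ j = φ j * X + φ (j - n)) (hY : ∀ j, Y * φ j = φ j * Y + φ (j - k)) (m : ℤ) :
    Commute (X * Y - Y * X) (φ m) := by
  change _ * _ = _ * _
  rw [sub_mul, mul_sub, mul_assoc, mul_assoc, hX, hY, mul_add, mul_add, ← mul_assoc, ← mul_assoc,
    hX, hY, add_mul, add_mul, hX, hY, mul_assoc, mul_assoc, show m - k - n = m - n - k by ring]
  abel

theorem hamiltonian_mul_fermion {n : ℕ} (hn : Odd n) (m : ℤ) :
    hamiltonian n * fermion m = fermion m * hamiltonian n + fermion (m - n) := by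
  rw [← hamiltonian_fermion_commutator hn]
  exact (add_sub_cancel (fermion m * hamiltonian n) (hamiltonian n * fermion m)).symm

/-- Both operators act on fermions as index shifts, and shifts commute; so the commutator commutes
with all `φ_m`. It also kills the vacuum, hence it is zero and there is no central term. -/
theorem hamiltonian_commute {n k : ℕ} (hn : Odd n) (hk : Odd k) :
    Commute (hamiltonian n) (hamiltonian k) := by
  refine sub_eq_zero.1 (operator_eq_zero (commutator_commute (A := Module.End ℂ Fock) (hamiltonian_mul_fermion hn)
    (hamiltonian_mul_fermion hk)) ?_)
  exact (LinearMap.sub_apply _ _ _).trans (by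
    rw [Module.End.mul_apply, Module.End.mul_apply, hamiltonian_ket hn.pos,
      hamiltonian_ket hk.pos, map_zero, map_zero, sub_zero])

end BKP

namespace BKP

open MvPowerSeries Finset

/-! ### The vertex operator of one variable -/

section Commutation

variable {σ A : Type*} [Ring A] [Algebra ℂ A]

theorem commute_of_coeff {f g : MvPowerSeries σ A}
    (h : ∀ d e, Commute (coeff d f) (coeff e g)) : Commute f g := by
  classical
  change _ = _
  ext d
  rw [coeff_mul, coeff_mul]
  refine Finset.sum_nbij' Prod.swap Prod.swap ?_ ?_ ?_ ?_ ?_ <;>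
    simp [add_comm, (h _ _).eq]

theorem commute_C_iff {f : MvPowerSeries σ A} {X : A} :
    Commute f (C X) ↔ ∀ d, Commute (coeff d f) X := by
  refine ⟨fun h d => ?_, fun h => ?_⟩
  · have := congrArg (coeff d) h.eq
    rwa [coeff_mul_C, coeff_C_mul] at this
  · change _ = _
    ext d
    rw [coeff_mul_C, coeff_C_mul]
    exact h d

theorem commute_coeff_formalExp {f : MvPowerSeries σ A} (hf : constantCoeff f = 0) {X : A}
    (h : ∀ d, Commute (coeff d f) X) (d : σ →₀ ℕ) : Commute (coeff d (formalExp f)) X :=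
  commute_C_iff.1 (commute_formalExp hf (commute_C_iff.2 h)) d

end Commutation

section Vertex

variable {A : Type*} [Ring A] [Algebra ℂ A]

/-- The series `∑_{n odd} (2 / n) x^n H_n`. -/
noncomputable def vertexLog (H : ℕ → A) : PowerSeries A :=
  PowerSeries.mk fun n => if Odd n then (2 / n : ℂ) • H n else 0

/-- The coefficients of the vertex operator `exp (∑_{n odd} (2 / n) x^n H_n)`. -/
noncomputable def vertexCoeff (H : ℕ → A) (n : ℕ) : A :=
  PowerSeries.coeff n (formalExp (vertexLog H) : PowerSeries A)

theorem coeff_vertexLog (H : ℕ → A) (n : ℕ) :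
    PowerSeries.coeff n (vertexLog H) = if Odd n then (2 / n : ℂ) • H n else 0 :=
  PowerSeries.coeff_mk _ _

theorem unit_finsupp_eq (d : Unit →₀ ℕ) : d = Finsupp.single () (d ()) := by
  ext
  simp

theorem powerSeries_coeff_zero (f : PowerSeries A) :
    PowerSeries.coeff 0 f = MvPowerSeries.constantCoeff f := by
  rw [← coeff_zero_eq_constantCoeff_apply, PowerSeries.coeff, Finsupp.single_zero]

theorem constantCoeff_vertexLog (H : ℕ → A) :
    MvPowerSeries.constantCoeff (vertexLog H) = 0 := by
  rw [← powerSeries_coeff_zero, coeff_vertexLog, if_neg (by simp)]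

theorem coeff_degreeD_powerSeries (f : PowerSeries A) (n : ℕ) :
    PowerSeries.coeff n (degreeD f : PowerSeries A) = (n : ℂ) • PowerSeries.coeff n f := by
  rw [PowerSeries.coeff, coeff_degreeD, Finsupp.degree_single]

variable {H : ℕ → A}

theorem commute_coeff_vertexLog {X : A} (h : ∀ n : ℕ, Odd n → Commute (H n) X)
    (d : Unit →₀ ℕ) : Commute (MvPowerSeries.coeff d (vertexLog H)) X := by
  rw [unit_finsupp_eq d]
  change Commute (PowerSeries.coeff (d ()) (vertexLog H)) X
  rw [coeff_vertexLog]
  split_ifs with hd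
  · exact (h _ hd).smul_left _
  · exact Commute.zero_left _

theorem commute_vertexCoeff {X : A} (h : ∀ n : ℕ, Odd n → Commute (H n) X) (n : ℕ) :
    Commute (vertexCoeff H n) X :=
  commute_coeff_formalExp (constantCoeff_vertexLog H) (commute_coeff_vertexLog h) _

theorem vertexCoeff_commute (hH : ∀ n k, Odd n → Odd k → Commute (H n) (H k)) (n k : ℕ) :
    Commute (vertexCoeff H n) (vertexCoeff H k) :=
  commute_vertexCoeff (fun i hi =>
    (commute_vertexCoeff (fun j hj => hH j i hj hi) k).symm) n

theorem vertexCoeff_zero : vertexCoeff H 0 = 1 := by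
  rw [vertexCoeff, powerSeries_coeff_zero, constantCoeff_formalExp]

theorem degreeD_vertexLog_commute (hH : ∀ n k, Odd n → Odd k → Commute (H n) (H k)) :
    Commute (degreeD (vertexLog H)) (vertexLog H) := by
  refine commute_of_coeff fun d e => ?_
  rw [coeff_degreeD]
  refine Commute.smul_left ?_ _
  refine commute_coeff_vertexLog (fun n hn => ?_) d
  exact (commute_coeff_vertexLog (fun k hk => hH k n hk hn) e).symm

/-- The coefficients of `(1 + z) / (1 - z)`. -/
def cayleyCoeff (n : ℕ) : ℂ := if n = 0 then 1 else 2

/-- For `C(z) = (1+z)/(1-z)` this is `z C'(z) = (2z/(1-z²)) C(z)` in coefficients, where `2z/(1-z²)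
= ∑_{n odd} 2 z^n`. -/
theorem sum_cayleyCoeff (n : ℕ) :
    ∑ p ∈ antidiagonal n, (if Odd p.1 then (2 : ℂ) else 0) * cayleyCoeff p.2 =
      n * cayleyCoeff n := by
  rw [Finset.Nat.sum_antidiagonal_eq_sum_range_succ_mk, sum_range_succ]
  have h1 : ∀ n : ℕ, ∑ k ∈ range n, (if Odd k then (2 : ℂ) else 0) * cayleyCoeff (n - k) =
      ∑ k ∈ range n, (if Odd k then 4 else 0) := by
    intro n
    refine Finset.sum_congr rfl fun k hk => ?_
    rw [mem_range] at hk
    have hk' : n - k ≠ 0 := Nat.sub_ne_zero_of_lt hk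
    rw [cayleyCoeff, if_neg hk']
    split_ifs <;> norm_num
  have h2 : ∀ n : ℕ, ∑ k ∈ range n, (if Odd k then (4 : ℂ) else 0) + (if Odd n then 2 else 0) =
      2 * n := by
    intro n
    induction n with
    | zero => simp
    | succ n ih =>
      rw [sum_range_succ]
      by_cases h : Odd n
      · have : ¬ Odd (n + 1) := by
          rw [Nat.not_odd_iff_even]
          exact h.add_one
        rw [if_pos h] at ih ⊢
        rw [if_neg this]
        push_cast
        linear_combination ih
      · have : Odd (n + 1) := (Nat.not_odd_iff_even.1 h).add_one
        rw [if_neg h] at ih ⊢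
        rw [if_pos this]
        push_cast
        linear_combination ih
  rw [h1, Nat.sub_self, cayleyCoeff, if_pos rfl, mul_one, h2, cayleyCoeff]
  split_ifs with h
  · simp [h]
  · ring

theorem coeff_degreeD_vertexLog (n : ℕ) :
    PowerSeries.coeff n (degreeD (vertexLog H) : PowerSeries A) =
      (if Odd n then (2 : ℂ) else 0) • H n := by
  rw [coeff_degreeD_powerSeries, coeff_vertexLog]
  split_ifs with h
  · rw [smul_smul]
    congr 1
    have : (n : ℂ) ≠ 0 := Nat.cast_ne_zero.2 h.pos.ne'
    field_simp
  · simp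

/-- The commutation relation between the vertex operator and the fermions. -/
theorem vertexCoeff_mul_fermion (hH : ∀ n k, Odd n → Odd k → Commute (H n) (H k)) {φ : ℤ → A}
    (hφ : ∀ n, Odd n → ∀ m, H n * φ m = φ m * H n + φ (m - n)) (n : ℕ) (m : ℤ) :
    vertexCoeff H n * φ m = ∑ p ∈ antidiagonal n,
      cayleyCoeff p.1 • (φ (m - p.1) * vertexCoeff H p.2) := by
  -- The ansatz comes from `exp (∑_{n odd} (2/n) z^n) = (1+z)/(1-z)`, with `z` standing for `x`
  -- times the shift `φ_m ↦ φ_{m-1}`.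
  set Φ : PowerSeries A := PowerSeries.mk fun l => cayleyCoeff l • φ (m - l) with hΦ
  have hc : MvPowerSeries.constantCoeff Φ = φ m := by
    rw [← powerSeries_coeff_zero, hΦ, PowerSeries.coeff_mk, cayleyCoeff, if_pos rfl, one_smul,
      Nat.cast_zero, sub_zero]
  have hD : degreeD (vertexLog H) * Φ - Φ * degreeD (vertexLog H) = degreeD Φ := by
    rw [sub_eq_iff_eq_add']
    refine PowerSeries.ext fun n => ?_
    have e1 : PowerSeries.coeff n (degreeD Φ : PowerSeries A) =
        (n : ℂ) • (cayleyCoeff n • φ (m - n)) := by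
      rw [coeff_degreeD_powerSeries, hΦ, PowerSeries.coeff_mk]
    rw [map_add]
    refine Eq.trans ?_ (congrArg _ e1.symm)
    rw [smul_smul, ← sum_cayleyCoeff]
    have e3 : PowerSeries.coeff n (Φ * (degreeD (vertexLog H) : PowerSeries A)) =
        ∑ p ∈ antidiagonal n, PowerSeries.coeff p.2 Φ *
          PowerSeries.coeff p.1 (degreeD (vertexLog H) : PowerSeries A) := by
      rw [PowerSeries.coeff_mul]
      exact Finset.sum_nbij' Prod.swap Prod.swap (by simp [add_comm]) (by simp [add_comm])
        (by simp) (by simp) (by simp)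
    rw [e3, PowerSeries.coeff_mul, Finset.sum_smul, ← Finset.sum_add_distrib]
    refine Finset.sum_congr rfl fun p hp => ?_
    rw [HasAntidiagonal.mem_antidiagonal] at hp
    rw [coeff_degreeD_vertexLog, hΦ, PowerSeries.coeff_mk]
    rw [smul_mul_smul_comm, smul_mul_smul_comm, mul_comm (cayleyCoeff p.2)]
    split_ifs with h
    · rw [hφ _ h, smul_add]
      congr 3
      rw [← hp]
      push_cast
      ring
    · simp
  have key := formalExp_mul_eq (constantCoeff_vertexLog H) (degreeD_vertexLog_commute hH) hD
  rw [hc] at key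
  have key' : PowerSeries.coeff n ((formalExp (vertexLog H) : PowerSeries A) * PowerSeries.C (φ m)) =
    PowerSeries.coeff n (Φ * (formalExp (vertexLog H) : PowerSeries A)) :=
    congrArg (PowerSeries.coeff n) key
  rw [PowerSeries.coeff_mul_C, PowerSeries.coeff_mul] at key'
  refine Eq.trans key' (Finset.sum_congr rfl fun p _ => ?_)
  rw [hΦ, PowerSeries.coeff_mk, smul_mul_assoc]
  rfl

/-- The commutation relation between the vertex operator and the fermions, as a recursion. -/
theorem vertexCoeff_succ_mul_fermion (hH : ∀ n k, Odd n → Odd k → Commute (H n) (H k)) {φ : ℤ → A}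
    (hφ : ∀ n, Odd n → ∀ m, H n * φ m = φ m * H n + φ (m - n)) (n : ℕ) (m : ℤ) :
    vertexCoeff H (n + 1) * φ m = vertexCoeff H n * φ (m - 1) +
      φ m * vertexCoeff H (n + 1) + φ (m - 1) * vertexCoeff H n := by
  -- The recursion is the Cayley expansion multiplied by its denominator `1 - z`.
  rw [vertexCoeff_mul_fermion hH hφ, vertexCoeff_mul_fermion hH hφ,
    Finset.Nat.sum_antidiagonal_succ]
  rcases n with _ | n
  · simp [cayleyCoeff, two_smul]
    abel
  · rw [Finset.Nat.sum_antidiagonal_succ, Finset.Nat.sum_antidiagonal_succ]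
    simp only [cayleyCoeff]
    have : ∀ p : ℕ × ℕ, m - ((p.1 + 1 + 1 : ℕ) : ℤ) = m - 1 - ((p.1 + 1 : ℕ) : ℤ) := fun p => by
      push_cast
      ring
    simp only [Nat.cast_add, Nat.cast_one] at this
    simp [this, two_smul]
    abel

/-- The logarithmic derivative of the vertex operator, written with `H` on the right so that it can
act on the vacuum; it yields `V(x)|0⟩ = |0⟩` in `ev₀_mul_vx`. -/
theorem natCast_smul_vertexCoeff (hH : ∀ n k, Odd n → Odd k → Commute (H n) (H k)) (n : ℕ) :
    (n : ℂ) • vertexCoeff H n =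
      ∑ p ∈ antidiagonal n, vertexCoeff H p.1 * ((if Odd p.2 then (2 : ℂ) else 0) • H p.2) := by
  have hD := degreeD_formalExp (constantCoeff_vertexLog H) (degreeD_vertexLog_commute hH)
  rw [← (commute_formalExp (constantCoeff_vertexLog H) (degreeD_vertexLog_commute hH).symm).eq] at hD
  have h1 : PowerSeries.coeff n (degreeD (formalExp (vertexLog H)) : PowerSeries A) =
    PowerSeries.coeff n ((formalExp (vertexLog H) : PowerSeries A) *
      (degreeD (vertexLog H) : PowerSeries A)) := congrArg (PowerSeries.coeff n) hD
  rw [coeff_degreeD_powerSeries, PowerSeries.coeff_mul] at h1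
  simp_rw [coeff_degreeD_vertexLog] at h1
  exact h1

end Vertex

end BKP

namespace BKP

open Finset

/-! ### The algebra of operators -/

/-- The algebra of operators on the Fock space. -/
def Op : Type := Module.End ℂ Fock

noncomputable instance : Ring Op := inferInstanceAs (Ring (Module.End ℂ Fock))

noncomputable instance : Algebra ℂ Op := inferInstanceAs (Algebra ℂ (Module.End ℂ Fock))

/-- An element of `Op` as a linear map. -/
def toEnd (X : Op) : Module.End ℂ Fock := X

/-- The fermion `φ_m`. -/
noncomputable def fer (m : ℤ) : Op := fermion m

/-- The Hamiltonian `H_n`. -/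
noncomputable def ham (n : ℕ) : Op := hamiltonian n

/-- The operator `-B_k`. -/
noncomputable def negSym (r : ℤ → ℂ) (k : ℕ) : Op := -symmetryOp r k

/-- Right multiplication by `φ_0`. -/
noncomputable def rz : Op := rightZero

/-- The coefficients of the vertex operator. -/
noncomputable def vx (n : ℕ) : Op := vertexCoeff ham n

/-- The vacuum expectation value, as a linear functional. -/
noncomputable def ev₀ : Op →ₗ[ℂ] ℂ where
  toFun X := vev X
  map_add' _ _ := rfl
  map_smul' _ _ := rfl

/-! ### Relations in the operator algebra and vacuum rules. -/

theorem fer_anticomm (m n : ℤ) :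
    fer m * fer n + fer n * fer m = if m + n = 0 then (-1 : ℂ) ^ m • (1 : Op) else 0 :=
  fermion_anticomm m n

theorem fer_mul_fer (m n : ℤ) :
    fer m * fer n = (if m + n = 0 then (-1 : ℂ) ^ m • (1 : Op) else 0) - fer n * fer m := by
  rw [← fer_anticomm, add_sub_cancel_right]

theorem fer_zero_sq : fer 0 * fer 0 = (1 / 2 : ℂ) • (1 : Op) := fermion_zero_sq

theorem rz_sq : rz * rz = (1 / 2 : ℂ) • (1 : Op) := rightZero_sq

theorem rz_mul_rz_mul (Z : Op) : rz * (rz * Z) = (1 / 2 : ℂ) • Z := by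
  rw [← mul_assoc, rz_sq, smul_mul_assoc, one_mul]

theorem rz_mul_fer (m : ℤ) : rz * fer m = fer m * rz := (fermion_rightZero_commute m).eq.symm

theorem ham_commute (n k : ℕ) (hn : Odd n) (hk : Odd k) : Commute (ham n) (ham k) :=
  hamiltonian_commute hn hk

theorem ham_mul_fer (n : ℕ) (hn : Odd n) (m : ℤ) :
    ham n * fer m = fer m * ham n + fer (m - n) := hamiltonian_mul_fermion hn m

theorem ham_commute_rz (n : ℕ) (hn : Odd n) : Commute (ham n) rz :=
  bilinear_rightZero_commute _ (by have := hn.pos; omega)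

theorem negSym_mul_fer {r : ℤ → ℂ} (hr : ∀ n : ℤ, r n = r (1 - n)) {k : ℕ} (hk : Odd k) (m : ℤ) :
    negSym r k * fer m = fer m * negSym r k + rShift r m k • fer (m + k) := by
  have h : (-negSym r k) * fer m - fer m * (-negSym r k) = -(rShift r m k • fer (m + k)) := by
    rw [negSym]
    have := symmetryOp_fermion_commutator hr hk m
    rw [← neg_neg (symmetryOp r k)] at this
    exact this
  rw [neg_mul, mul_neg] at h
  rw [sub_neg_eq_add, neg_add_eq_sub, sub_eq_iff_eq_add] at h
  rw [h]
  abel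

theorem negSym_commute_rz (r : ℤ → ℂ) {k : ℕ} (hk : Odd k) : Commute (negSym r k) rz :=
  Commute.neg_left (bilinear_rightZero_commute (k := k) _ (by have := hk.pos; omega) : Commute (S := Op) (symmetryOp r k) rz)

theorem vx_commute (n k : ℕ) : Commute (vx n) (vx k) := vertexCoeff_commute ham_commute n k

theorem rz_mul_vx (n : ℕ) : rz * vx n = vx n * rz :=
  (commute_vertexCoeff ham_commute_rz n).eq.symm

theorem vx_zero : vx 0 = 1 := vertexCoeff_zero

theorem vx_mul_fer (n : ℕ) (m : ℤ) :
    vx n * fer m = ∑ p ∈ antidiagonal n, cayleyCoeff p.1 • (fer (m - p.1) * vx p.2) :=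
  vertexCoeff_mul_fermion ham_commute ham_mul_fer n m

theorem vx_succ_mul_fer (n : ℕ) (m : ℤ) :
    vx (n + 1) * fer m = vx n * fer (m - 1) + fer m * vx (n + 1) + fer (m - 1) * vx n :=
  vertexCoeff_succ_mul_fermion ham_commute ham_mul_fer n m

theorem ev₀_fer_pos {m : ℤ} (hm : 0 < m) (Z : Op) : ev₀ (fer m * Z) = 0 :=
  bra_fermion_pos hm _

theorem ev₀_mul_fer_neg {m : ℤ} (hm : m < 0) (Z : Op) : ev₀ (Z * fer m) = 0 := by
  have h : (fermion m : Module.End ℂ Fock) ket = 0 := fermion_neg_ket hm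
  change bra (toEnd Z ((fermion m) ket)) = 0
  rw [h, map_zero, map_zero]

theorem ev₀_fer_zero (Z : Op) : ev₀ (fer 0 * Z) = ev₀ (rz * Z) := (bra_rightZero _).symm

theorem ev₀_mul_fer_zero (Z : Op) : ev₀ (Z * fer 0) = ev₀ (Z * rz) :=
  congrArg (fun u => bra (toEnd Z u)) rightZero_ket.symm

theorem ev₀_one : ev₀ 1 = 1 := Finsupp.single_eq_same

theorem ev₀_negSym (r : ℤ → ℂ) {k : ℕ} (hk : 0 < k) (Z : Op) : ev₀ (negSym r k * Z) = 0 := by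
  rw [negSym]
  change bra (-(symmetryOp r k _)) = 0
  rw [map_neg, bra_symmetryOp r hk, neg_zero]

theorem ev₀_mul_ham {n : ℕ} (hn : 0 < n) (Z : Op) : ev₀ (Z * ham n) = 0 := by
  have h : (hamiltonian n : Module.End ℂ Fock) ket = 0 := hamiltonian_ket hn
  change bra (toEnd Z ((hamiltonian n) ket)) = 0
  rw [h, map_zero, map_zero]

theorem ev₀_mul_vx {n : ℕ} (hn : n ≠ 0) (Z : Op) : ev₀ (Z * vx n) = 0 := by
  have h := congrArg (fun X => ev₀ (Z * X)) (natCast_smul_vertexCoeff ham_commute n)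
  simp only [mul_smul_comm, map_smul, Finset.mul_sum, map_sum, ← mul_assoc] at h
  rw [Finset.sum_eq_zero] at h
  · exact (smul_eq_zero.1 h).resolve_left (Nat.cast_ne_zero.2 hn)
  · intro p _
    split_ifs with hp
    · rw [ev₀_mul_ham hp.pos, smul_zero]
    · rw [zero_smul]

theorem ev₀_fer_zero_self : ev₀ (fer 0) = 0 := by
  change bra (fermion 0 ket) = 0
  rw [← rightZero_ket, rightZero_single]
  simp [bra, Finsupp.single_apply]

/-! ### Vertex operators against the left vacuum. -/

theorem ev₀_mul_eq_zero {X : Op} (h : ∀ m : ℤ, 0 < m → ∀ Z, ev₀ (X * (fer m * Z)) = 0)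
    (h0 : ev₀ X = 0) (h1 : ev₀ (X * fer 0) = 0) (Z : Op) : ev₀ (X * Z) = 0 := by
  refine functional_eq_zero (f := bra ∘ₗ toEnd X) (fun m hm u => ?_) h0 h1
    (toEnd Z ket)
  -- The rank-one operator `u ⊗ ⟨0|` sends the vacuum to `u`, so a hypothesis about operators `Z`
  -- reaches every vector.
  have h2 : LinearMap.toSpanSingleton ℂ Fock u (bra ket) = u := by
    simp [bra, LinearMap.toSpanSingleton_apply]
  have h3 := h m hm (LinearMap.toSpanSingleton ℂ Fock u ∘ₗ bra : Module.End ℂ Fock)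
  change bra (toEnd X (fermion m (LinearMap.toSpanSingleton ℂ Fock u (bra ket)))) = 0
    at h3
  rw [h2] at h3
  exact h3

/-- One writes `1 = 2 rz²` and exchanges the left `rz` for `φ_0` at the dual vacuum. The vertex
operator then stands behind a `φ_0`, where it can be absorbed. -/
theorem ev₀_half (Z : Op) : ev₀ Z = 2 * ev₀ (fer 0 * (rz * Z)) := by
  rw [ev₀_fer_zero, rz_mul_rz_mul, map_smul, smul_eq_mul]
  ring

theorem fer_zero_mul_fer {m : ℤ} (hm : m ≠ 0) (Z : Op) :
    fer 0 * (fer m * Z) = -(fer m * (fer 0 * Z)) := by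
  rw [← mul_assoc, fer_mul_fer, if_neg (by omega), zero_sub, neg_mul, mul_assoc]

/-- Each step of the recursion lowers both indices by one, because a positive mode that reaches the
left end gives zero. At the last step the two terms that remain have `φ_0` and, after `φ_0² = rz²`,
the operator `rz` behind the vertex coefficient. -/
theorem ev₀_vx_fer_aux (n m : ℕ) (Z : Op) : ev₀ (fer 0 * (vx n * (fer (m + 1 : ℕ) * Z))) =
    if m + 1 ≤ n then ev₀ (fer 0 * (vx (n - (m + 1)) * ((fer 0 + rz) * Z))) else 0 := by
  induction n generalizing m with
  | zero =>
    rw [if_neg (by omega), vx_zero, one_mul, fer_zero_mul_fer (by omega), map_neg,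
      ev₀_fer_pos (by omega), neg_zero]
  | succ n ih =>
    rw [← mul_assoc (vx (n + 1)), vx_succ_mul_fer, add_mul, add_mul, mul_add, mul_add, map_add,
      map_add]
    simp only [mul_assoc]
    rw [fer_zero_mul_fer (m := (m + 1 : ℕ)) (by omega), map_neg,
      ev₀_fer_pos (m := (m + 1 : ℕ)) (by omega), neg_zero, add_zero]
    rcases m with _ | m
    · have e1 : ((0 + 1 : ℕ) : ℤ) - 1 = 0 := by norm_num
      rw [e1, if_pos (by omega), ← mul_assoc (fer 0) (fer 0), fer_zero_sq, ← rz_sq,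
        mul_assoc rz, ← ev₀_fer_zero, add_mul, mul_add, mul_add, map_add]
      congr 1
      rw [← mul_assoc rz, rz_mul_vx, mul_assoc]
      rfl
    · have e1 : ((m + 1 + 1 : ℕ) : ℤ) - 1 = (m + 1 : ℕ) := by push_cast; ring
      rw [e1, ih, fer_zero_mul_fer (m := (m + 1 : ℕ)) (by omega) (vx n * Z), map_neg,
        ev₀_fer_pos (m := (m + 1 : ℕ)) (by omega), neg_zero, add_zero]
      have e2 : n - (m + 1) = n + 1 - (m + 1 + 1) := by omega
      simp only [e2, Nat.add_le_add_iff_right]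

/-- For `m ≠ 0`, `(φ_0 + rz) φ_m = φ_m (rz - φ_0)`, while `(φ_0 + rz)(rz - φ_0) = 0`. So the
functional kills the images of the positive modes, and only its values at `|0⟩` and `φ_0|0⟩` remain
to be compared. -/
theorem ev₀_vx_add_rz (n : ℕ) (Z : Op) :
    ev₀ (fer 0 * (vx n * ((fer 0 + rz) * Z))) = if n = 0 then ev₀ Z else 0 := by
  have key := ev₀_mul_eq_zero (X := fer 0 * (vx n * (fer 0 + rz)) - (if n = 0 then (1 : ℂ) else 0) • 1)
    ?_ ?_ ?_ Z
  · rw [sub_mul, map_sub, sub_eq_zero, smul_mul_assoc, one_mul, map_smul] at key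
    simp only [mul_assoc] at key
    rw [key]
    split_ifs <;> simp
  · intro m hm Z
    obtain ⟨k, rfl⟩ : ∃ k : ℕ, m = (k + 1 : ℕ) := ⟨(m - 1).toNat, by omega⟩
    rw [sub_mul, smul_mul_assoc, one_mul, map_sub, map_smul, ev₀_fer_pos hm, smul_zero, sub_zero]
    have e1 : (fer 0 + rz) * (fer (k + 1 : ℕ) * Z) = fer (k + 1 : ℕ) * ((rz - fer 0) * Z) := by
      rw [add_mul, fer_zero_mul_fer (by omega), ← mul_assoc rz, rz_mul_fer, sub_mul, mul_sub,
        mul_assoc]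
      abel
    have e2 : (fer 0 + rz) * ((rz - fer 0) * Z) = 0 := by
      rw [← mul_assoc, add_mul, mul_sub, mul_sub, rz_sq, fer_zero_sq, rz_mul_fer]
      simp
    simp only [mul_assoc]
    rw [e1, ev₀_vx_fer_aux, e2]
    simp
  · rw [map_sub, mul_add, mul_add, map_add, ← mul_assoc, ev₀_mul_fer_zero, mul_assoc, ← two_mul,
      ev₀_fer_zero, ← mul_assoc rz, rz_mul_vx, mul_assoc, rz_sq, map_smul, ev₀_one]
    rcases eq_or_ne n 0 with rfl | hn
    · simp [vx_zero, ev₀_one]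
    · have := ev₀_mul_vx hn 1
      rw [one_mul] at this
      simp [hn, this]
  · have e1 : (fer 0 + rz) * fer 0 = (1 / 2 : ℂ) • 1 + rz * fer 0 := by rw [add_mul, fer_zero_sq]
    rw [sub_mul, smul_mul_assoc, one_mul, map_sub, map_smul, ev₀_fer_zero_self, smul_zero, sub_zero,
      mul_assoc, mul_assoc, e1, mul_add, mul_add, map_add, ← mul_assoc (vx n) rz,
      ← mul_assoc (fer 0) (vx n * rz), ev₀_mul_fer_zero]
    simp only [mul_assoc, rz_sq]
    rcases eq_or_ne n 0 with rfl | hn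
    · simp [vx_zero, ev₀_fer_zero_self]
    · simp [ev₀_mul_vx hn]

theorem ev₀_fer_zero_vx_fer {m : ℕ} (hm : 0 < m) (n : ℕ) (Z : Op) :
    ev₀ (fer 0 * (vx n * (fer m * Z))) = if n = m then ev₀ Z else 0 := by
  obtain ⟨k, rfl⟩ : ∃ k : ℕ, m = k + 1 := ⟨m - 1, by omega⟩
  rw [ev₀_vx_fer_aux]
  split_ifs with h1 h2 h2
  · rw [ev₀_vx_add_rz, if_pos (by omega)]
  · rw [ev₀_vx_add_rz, if_neg (by omega)]
  · omega
  · rfl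

/-- `⟨0| φ_0 e^{H(t(x))} = ⟨0| φ(-1/x)`. -/
theorem ev₀_fer_zero_vx (n : ℕ) (Z : Op) :
    ev₀ (fer 0 * (vx n * Z)) = (-1) ^ n * ev₀ (fer (-n) * Z) := by
  rcases eq_or_ne n 0 with rfl | hn
  · simp [vx_zero]
  have key := ev₀_mul_eq_zero (X := fer 0 * vx n - ((-1 : ℂ) ^ n) • fer (-n)) ?_ ?_ ?_ Z
  · rw [sub_mul, map_sub, sub_eq_zero, smul_mul_assoc, map_smul, mul_assoc] at key
    exact key
  · intro m hm Z
    obtain ⟨k, rfl⟩ : ∃ k : ℕ, m = k := ⟨m.toNat, by omega⟩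
    rw [sub_mul, mul_assoc, map_sub, ev₀_fer_zero_vx_fer (by omega), smul_mul_assoc, map_smul,
      ← mul_assoc, fer_mul_fer, sub_mul, map_sub, mul_assoc, ev₀_fer_pos hm, sub_zero]
    by_cases h : n = k
    · subst h
      rw [if_pos rfl, if_pos (by omega), neg_one_zpow_neg, zpow_natCast, smul_mul_assoc, one_mul,
        map_smul, smul_smul, ← mul_pow]
      simp
    · rw [if_neg h, if_neg (by omega)]
      simp
  · rw [map_sub, ev₀_mul_vx hn, map_smul, ← one_mul (fer (-n)), ev₀_mul_fer_neg (by omega)]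
    simp
  · rw [sub_mul, map_sub, ev₀_mul_fer_zero, smul_mul_assoc, map_smul, fer_mul_fer,
      if_neg (by omega), zero_sub, map_neg, ev₀_mul_fer_neg (by omega), mul_assoc, ev₀_fer_zero,
      ← rz_mul_vx, rz_mul_rz_mul, map_smul, ← one_mul (vx n), ev₀_mul_vx hn]
    simp

theorem ev₀_vx_fer {m : ℕ} (hm : 0 < m) (n : ℕ) (Z : Op) :
    ev₀ (vx n * (fer m * Z)) = if n = m then 2 * ev₀ (fer 0 * Z) else 0 := by
  rw [ev₀_half, ← mul_assoc rz, rz_mul_vx, mul_assoc, ← mul_assoc rz, rz_mul_fer, mul_assoc,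
    ev₀_fer_zero_vx_fer hm, ev₀_fer_zero]
  split_ifs <;> simp

theorem ev₀_vx_fer_zero (n : ℕ) (Z : Op) :
    ev₀ (vx n * (fer 0 * Z)) =
      (if n = 0 then 2 * ev₀ (fer 0 * Z) else 0) - ev₀ (fer 0 * (vx n * Z)) := by
  have h := ev₀_vx_add_rz n (rz * Z)
  rw [add_mul, rz_mul_rz_mul, mul_add, mul_add, map_add, mul_smul_comm, mul_smul_comm, map_smul,
    smul_eq_mul, ← ev₀_fer_zero] at h
  rw [ev₀_half, ← mul_assoc rz, rz_mul_vx, mul_assoc, ← mul_assoc rz, rz_mul_fer, mul_assoc]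
  split_ifs at h ⊢ <;> linear_combination 2 * h

theorem ev₀_vx (n : ℕ) (Z : Op) : ev₀ (vx n * Z) = 2 * (-1) ^ n * ev₀ (fer (-n) * (rz * Z)) := by
  rw [ev₀_half, ← mul_assoc rz, rz_mul_vx, mul_assoc, ev₀_fer_zero_vx, mul_assoc]

end BKP

namespace BKP

open MvPowerSeries Finset

/-! ### Locally finite sums of power series -/

section Sums

variable {σ : Type*}

noncomputable instance seriesOpAlgebra : Algebra (MvPowerSeries σ ℂ) (MvPowerSeries σ Op) :=
  (MvPowerSeries.map (algebraMap ℂ Op)).toAlgebra' fun f Z => by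
    refine (commute_of_coeff fun d e => ?_).eq
    rw [coeff_map]
    exact Algebra.commutes _ _

/-- Power series with coefficients in `A` on which scalar power series act by convolution. -/
class SeriesModule (σ A : Type*) [Ring A] [Algebra ℂ A]
    [Module (MvPowerSeries σ ℂ) (MvPowerSeries σ A)] : Prop where
  coeff_smul [DecidableEq σ] (c : σ →₀ ℕ) (f : MvPowerSeries σ ℂ) (Z : MvPowerSeries σ A) :
    coeff c (f • Z) = ∑ p ∈ antidiagonal c, coeff p.1 f • coeff p.2 Z

instance : SeriesModule σ ℂ where
  coeff_smul c f Z := by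
    rw [smul_eq_mul, coeff_mul]
    rfl

instance : SeriesModule σ Op where
  coeff_smul c f Z := by
    rw [Algebra.smul_def]
    change coeff c (MvPowerSeries.map (algebraMap ℂ Op) f * Z) = _
    rw [coeff_mul]
    simp only [coeff_map, ← Algebra.smul_def]

variable {A B : Type*} [Ring A] [Algebra ℂ A] [Module (MvPowerSeries σ ℂ) (MvPowerSeries σ A)]
  [SeriesModule σ A] [Ring B] [Algebra ℂ B] [Module (MvPowerSeries σ ℂ) (MvPowerSeries σ B)]
  [SeriesModule σ B]

theorem coeff_smul_eq_zero_left {c : σ →₀ ℕ} {f : MvPowerSeries σ ℂ} (Z : MvPowerSeries σ A)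
    (h : ∀ c' ≤ c, coeff c' f = 0) : coeff c (f • Z) = 0 := by
  classical
  rw [SeriesModule.coeff_smul]
  refine Finset.sum_eq_zero fun p hp => ?_
  rw [HasAntidiagonal.mem_antidiagonal] at hp
  rw [h _ (hp ▸ le_self_add), zero_smul]

theorem coeff_smul_eq_zero_right {c : σ →₀ ℕ} (f : MvPowerSeries σ ℂ) {Z : MvPowerSeries σ A}
    (h : ∀ c' ≤ c, coeff c' Z = 0) : coeff c (f • Z) = 0 := by
  classical
  rw [SeriesModule.coeff_smul]
  refine Finset.sum_eq_zero fun p hp => ?_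
  rw [HasAntidiagonal.mem_antidiagonal] at hp
  rw [h _ (hp ▸ le_add_self), smul_zero]

theorem coeff_smul_C (c : σ →₀ ℕ) (f : MvPowerSeries σ ℂ) (X : A) :
    coeff c (f • (C X : MvPowerSeries σ A)) = coeff c f • X := by
  classical
  rw [SeriesModule.coeff_smul, Finset.sum_eq_single (c, 0)]
  · simp
  · rintro ⟨a, b⟩ hp hne
    rw [HasAntidiagonal.mem_antidiagonal] at hp
    rw [coeff_C, if_neg, smul_zero]
    rintro rfl
    simp at hp
    exact hne (by rw [hp])
  · simp

/-- A family of scalar power series of which only finitely many members contribute to each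
coefficient. -/
def LocFin (f : ℕ → MvPowerSeries σ ℂ) : Prop :=
  ∀ c, ∃ n, ∀ l ≥ n, ∀ c' ≤ c, coeff c' (f l) = 0

/-- The sum `∑_l f_l s_l`, for a locally finite family `f`. -/
noncomputable def lsum (f : ℕ → MvPowerSeries σ ℂ) (s : ℕ → MvPowerSeries σ A) :
    MvPowerSeries σ A := fun c => ∑ᶠ l, coeff c (f l • s l)

theorem coeff_lsum {f : ℕ → MvPowerSeries σ ℂ} (s : ℕ → MvPowerSeries σ A) {c : σ →₀ ℕ} {n : ℕ}
    (hn : ∀ l ≥ n, ∀ c' ≤ c, coeff c' (f l) = 0) :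
    coeff c (lsum f s) = coeff c (∑ l ∈ range n, f l • s l) := by
  rw [map_sum]
  refine finsum_eq_sum_of_support_subset _ fun l hl => ?_
  by_contra h
  exact hl (coeff_smul_eq_zero_left _ (hn l (by simpa using h)))

/-- A linear map for which each coefficient of the image only depends on the coefficients of
smaller exponents. -/
def Causal (Λ : MvPowerSeries σ A →ₗ[MvPowerSeries σ ℂ] MvPowerSeries σ B) : Prop :=
  ∀ c Z, (∀ c' ≤ c, coeff c' Z = 0) → coeff c (Λ Z) = 0

theorem map_lsum {Λ : MvPowerSeries σ A →ₗ[MvPowerSeries σ ℂ] MvPowerSeries σ B} (hΛ : Causal Λ)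
    {f : ℕ → MvPowerSeries σ ℂ} (hf : LocFin f) (s : ℕ → MvPowerSeries σ A) :
    Λ (lsum f s) = lsum f fun l => Λ (s l) := by
  ext c
  obtain ⟨n, hn⟩ := hf c
  rw [coeff_lsum _ hn]
  -- The tail has no coefficients at exponents up to `c`, so causality removes it.
  have h1 : coeff c (Λ (lsum f s - ∑ l ∈ range n, f l • s l)) = 0 := by
    refine hΛ c _ fun c' hc' => ?_
    rw [map_sub, coeff_lsum s fun l hl c'' hc'' => hn l hl c'' (hc''.trans hc'), sub_self]
  rw [map_sub, map_sub, sub_eq_zero] at h1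
  rw [h1, map_sum]
  simp_rw [map_smul]

theorem lsum_add {f : ℕ → MvPowerSeries σ ℂ} (hf : LocFin f) (s s' : ℕ → MvPowerSeries σ A) :
    lsum f (fun l => s l + s' l) = lsum f s + lsum f s' := by
  ext c
  obtain ⟨n, hn⟩ := hf c
  rw [map_add, coeff_lsum _ hn, coeff_lsum _ hn, coeff_lsum _ hn, ← map_add,
    ← Finset.sum_add_distrib]
  simp_rw [smul_add]

theorem lsum_smul {f : ℕ → MvPowerSeries σ ℂ} (hf : LocFin f) (g : MvPowerSeries σ ℂ)
    (s : ℕ → MvPowerSeries σ A) : lsum f (fun l => g • s l) = g • lsum f s := by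
  refine (map_lsum (Λ := g • LinearMap.id) ?_ hf s).symm
  intro c Z hZ
  exact coeff_smul_eq_zero_right g hZ

theorem lsum_eq_single {f : ℕ → MvPowerSeries σ ℂ} {s : ℕ → MvPowerSeries σ A} (k : ℕ)
    (h : ∀ l, l ≠ k → s l = 0) : lsum f s = f k • s k := by
  ext c
  refine finsum_eq_single _ k fun l hl => ?_
  rw [h l hl, smul_zero, map_zero]

/-- The convolution of two families. -/
noncomputable def conv (f g : ℕ → MvPowerSeries σ ℂ) (n : ℕ) : MvPowerSeries σ ℂ :=
  ∑ p ∈ antidiagonal n, f p.1 * g p.2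

theorem coeff_mul_eq_zero_left {c : σ →₀ ℕ} {f : MvPowerSeries σ ℂ} (g : MvPowerSeries σ ℂ)
    (h : ∀ c' ≤ c, coeff c' f = 0) : coeff c (f * g) = 0 := by
  rw [← smul_eq_mul]
  exact coeff_smul_eq_zero_left g h

theorem coeff_mul_eq_zero_right {c : σ →₀ ℕ} (f : MvPowerSeries σ ℂ) {g : MvPowerSeries σ ℂ}
    (h : ∀ c' ≤ c, coeff c' g = 0) : coeff c (f * g) = 0 := by
  rw [← smul_eq_mul]
  exact coeff_smul_eq_zero_right f h

theorem lsum_lsum {f g : ℕ → MvPowerSeries σ ℂ} (hf : LocFin f) (hg : LocFin g)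
    (s : ℕ → MvPowerSeries σ A) :
    lsum f (fun l => lsum g fun k => s (l + k)) = lsum (conv f g) s := by
  ext c
  obtain ⟨n₁, h₁⟩ := hf c
  obtain ⟨n₂, h₂⟩ := hg c
  set n := max n₁ n₂
  have hf' : ∀ l ≥ n, ∀ c' ≤ c, coeff c' (f l) = 0 := fun l hl => h₁ l (le_trans (le_max_left _ _) hl)
  have hg' : ∀ l ≥ n, ∀ c' ≤ c, coeff c' (g l) = 0 := fun l hl => h₂ l (le_trans (le_max_right _ _) hl)
  have hz : ∀ l k, n ≤ l ∨ n ≤ k → ∀ c' ≤ c, coeff c' (f l * g k) = 0 := by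
    intro l k h c' hc'
    rcases h with h | h
    · exact coeff_mul_eq_zero_left _ fun c'' hc'' => hf' l h c'' (hc''.trans hc')
    · exact coeff_mul_eq_zero_right _ fun c'' hc'' => hg' k h c'' (hc''.trans hc')
  have hconv : ∀ l ≥ 2 * n, ∀ c' ≤ c, coeff c' (conv f g l) = 0 := by
    intro l hl c' hc'
    rw [conv, map_sum]
    refine Finset.sum_eq_zero fun p hp => hz _ _ ?_ c' hc'
    rw [HasAntidiagonal.mem_antidiagonal] at hp
    omega
  rw [coeff_lsum _ hf', coeff_lsum _ hconv]
  have e1 : coeff c (∑ l ∈ range n, f l • lsum g fun k => s (l + k)) =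
      coeff c (∑ l ∈ range n, f l • ∑ k ∈ range n, g k • s (l + k)) := by
    rw [map_sum, map_sum]
    refine Finset.sum_congr rfl fun l _ => ?_
    rw [← sub_eq_zero, ← map_sub, ← smul_sub]
    refine coeff_smul_eq_zero_right _ fun c' hc' => ?_
    rw [map_sub, coeff_lsum _ fun l hl c'' hc'' => hg' l hl c'' (hc''.trans hc'), sub_self]
  rw [e1]
  simp_rw [Finset.smul_sum, smul_smul, conv, Finset.sum_smul]
  rw [← Finset.sum_product', Finset.sum_sigma', map_sum, map_sum]
  symm
  -- The triangle `l + k < 2n` contains the square `l, k < n`; outside the square one of the two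
  -- factors vanishes up to `c`.
  refine Finset.sum_bij_ne_zero (fun x _ _ => x.2) ?_ ?_ ?_ ?_
  · rintro ⟨i, p⟩ h h0
    rw [mem_product, mem_range, mem_range]
    by_contra hcon
    refine h0 (coeff_smul_eq_zero_left _ (hz _ _ ?_))
    dsimp only at hcon ⊢
    omega
  · rintro ⟨i, p⟩ h _ ⟨j, q⟩ h' _ heq
    simp only [mem_sigma, HasAntidiagonal.mem_antidiagonal] at h h'
    dsimp only at heq
    subst heq
    obtain ⟨_, rfl⟩ := h
    obtain ⟨_, rfl⟩ := h'
    rfl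
  · rintro p hp h0
    rw [mem_product, mem_range, mem_range] at hp
    refine ⟨⟨p.1 + p.2, p⟩, ?_, h0, rfl⟩
    simp only [mem_sigma, mem_range, HasAntidiagonal.mem_antidiagonal, and_true]
    omega
  · rintro ⟨i, p⟩ h _
    simp only [mem_sigma, HasAntidiagonal.mem_antidiagonal] at h
    rw [h.2]

theorem locFin_pow {y : MvPowerSeries σ ℂ} (hy : constantCoeff y = 0) : LocFin fun l => y ^ l := by
  intro c
  refine ⟨c.degree + 1, fun l hl c' hc' => coeff_pow_eq_zero hy ?_⟩
  have := degree_le_of_le hc'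
  omega

/-- A sequence shifted by one place. -/
def shiftSeq {M : Type*} [Zero M] (s : ℕ → M) : ℕ → M
  | 0 => 0
  | l + 1 => s l

theorem lsum_pow_shift {y : MvPowerSeries σ ℂ} (hy : constantCoeff y = 0)
    (s : ℕ → MvPowerSeries σ A) :
    lsum (fun l => y ^ l) (shiftSeq s) = y • lsum (fun l => y ^ l) s := by
  ext c
  obtain ⟨n, hn⟩ := locFin_pow hy c
  have hn' : ∀ l ≥ n + 1, ∀ c' ≤ c, coeff c' (y ^ l) = 0 := fun l hl => hn l (by omega)
  have e1 : coeff c (y • lsum (fun l => y ^ l) s) =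
      coeff c (y • ∑ l ∈ range n, y ^ l • s l) := by
    rw [← sub_eq_zero, ← map_sub, ← smul_sub]
    refine coeff_smul_eq_zero_right _ fun c' hc' => ?_
    rw [map_sub, coeff_lsum _ fun l hl c'' hc'' => hn l hl c'' (hc''.trans hc'), sub_self]
  rw [e1, coeff_lsum _ hn', sum_range_succ', Finset.smul_sum]
  simp only [shiftSeq, smul_zero, add_zero, smul_smul, pow_succ']

theorem lsum_pow_zero (s : ℕ → MvPowerSeries σ A) :
    lsum (fun l => (0 : MvPowerSeries σ ℂ) ^ l) s = s 0 := by
  ext c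
  refine (finsum_eq_single _ 0 fun l hl => ?_).trans ?_
  · simp [zero_pow hl]
  · simp

end Sums

/-! ### Vacuum expectation values of operator-valued power series -/

section Expectation

variable {σ : Type*}

/-- The vacuum expectation value of an operator-valued power series. -/
noncomputable def V : MvPowerSeries σ Op →ₗ[MvPowerSeries σ ℂ] MvPowerSeries σ ℂ where
  toFun Z := coeffMap ev₀ Z
  map_add' _ _ := map_add _ _ _
  map_smul' f Z := by
    classical
    ext c
    rw [RingHom.id_apply, smul_eq_mul, coeff_mul, coeff_coeffMap, SeriesModule.coeff_smul, map_sum]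
    simp only [map_smul, smul_eq_mul, coeff_coeffMap]

theorem coeff_V (c : σ →₀ ℕ) (Z : MvPowerSeries σ Op) : coeff c (V Z) = ev₀ (coeff c Z) := rfl

theorem causal_V : Causal (V (σ := σ)) := fun c Z h => by
  rw [coeff_V, h c le_rfl, map_zero]

theorem Causal.comp {A B D : Type*} [Ring A] [Algebra ℂ A]
    [Module (MvPowerSeries σ ℂ) (MvPowerSeries σ A)] [Ring B] [Algebra ℂ B]
    [Module (MvPowerSeries σ ℂ) (MvPowerSeries σ B)] [Ring D] [Algebra ℂ D]
    [Module (MvPowerSeries σ ℂ) (MvPowerSeries σ D)]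
    {Λ : MvPowerSeries σ B →ₗ[MvPowerSeries σ ℂ] MvPowerSeries σ D}
    {Λ' : MvPowerSeries σ A →ₗ[MvPowerSeries σ ℂ] MvPowerSeries σ B}
    (h : Causal Λ) (h' : Causal Λ') : Causal (Λ ∘ₗ Λ') :=
  fun c Z hZ => h c _ fun c' hc' => h' c' Z fun c'' hc'' => hZ c'' (hc''.trans hc')

theorem causal_mulLeft (X : MvPowerSeries σ Op) :
    Causal (LinearMap.mulLeft (MvPowerSeries σ ℂ) X) := fun c Z h => by
  have := coeff_mul_congr (f := X) (f' := X) (g := Z) (g' := 0) (d := c) (fun _ _ => rfl)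
    (fun c' hc' => by rw [h c' hc', map_zero])
  rw [LinearMap.mulLeft_apply, this, mul_zero, map_zero]

theorem causal_mulRight (X : MvPowerSeries σ Op) :
    Causal (LinearMap.mulRight (MvPowerSeries σ ℂ) X) := fun c Z h => by
  have := coeff_mul_congr (f := Z) (f' := 0) (g := X) (g' := X) (d := c)
    (fun c' hc' => by rw [h c' hc', map_zero]) (fun _ _ => rfl)
  rw [LinearMap.mulRight_apply, this, zero_mul, map_zero]

theorem mul_lsum {f : ℕ → MvPowerSeries σ ℂ} (hf : LocFin f) (X : MvPowerSeries σ Op)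
    (s : ℕ → MvPowerSeries σ Op) : X * lsum f s = lsum f fun l => X * s l :=
  map_lsum (causal_mulLeft X) hf s

theorem lsum_mul {f : ℕ → MvPowerSeries σ ℂ} (hf : LocFin f) (X : MvPowerSeries σ Op)
    (s : ℕ → MvPowerSeries σ Op) : lsum f s * X = lsum f fun l => s l * X :=
  map_lsum (causal_mulRight X) hf s

theorem V_lsum {f : ℕ → MvPowerSeries σ ℂ} (hf : LocFin f) (s : ℕ → MvPowerSeries σ Op) :
    V (lsum f s) = lsum f fun l => V (s l) :=
  map_lsum causal_V hf s

theorem V_C_mul_eq {X Y : Op} {a : ℂ} (h : ∀ Z, ev₀ (X * Z) = a * ev₀ (Y * Z))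
    (Z : MvPowerSeries σ Op) : V (C X * Z) = a • V (C Y * Z) := by
  ext c
  rw [LinearMap.map_smul_of_tower, coeff_V, coeff_V, coeff_C_mul, coeff_C_mul, h, smul_eq_mul]

theorem V_C_mul_eq_zero {X : Op} (h : ∀ Z, ev₀ (X * Z) = 0) (Z : MvPowerSeries σ Op) :
    V (C X * Z) = 0 := by
  ext c
  rw [coeff_V, coeff_C_mul, h, map_zero]

theorem V_mul_C_eq {X Y : Op} (h : ∀ Z, ev₀ (Z * X) = ev₀ (Z * Y))
    (Z : MvPowerSeries σ Op) : V (Z * C X) = V (Z * C Y) := by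
  ext c
  rw [coeff_V, coeff_V, coeff_mul_C, coeff_mul_C, h]

theorem V_mul_C_eq_zero {X : Op} (h : ∀ Z, ev₀ (Z * X) = 0) (Z : MvPowerSeries σ Op) :
    V (Z * C X) = 0 := by
  ext c
  rw [coeff_V, coeff_mul_C, h, map_zero]

end Expectation

end BKP

namespace BKP

open MvPowerSeries Finset

/-! ### Vertex operators at power series -/

section VertexOperators

variable {σ : Type*}

/-- The fermion `φ_m` as a constant power series. -/
noncomputable def fop (m : ℤ) : MvPowerSeries σ Op := C (fer m)

/-- Right multiplication by `φ_0` as a constant power series. -/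
noncomputable def rzop : MvPowerSeries σ Op := C rz

/-- The vertex operator `exp (∑_{n odd} (2 / n) y^n H_n)` at the power series `y`. -/
noncomputable def vop (y : MvPowerSeries σ ℂ) : MvPowerSeries σ Op :=
  lsum (fun l => y ^ l) fun l => C (vx l)

/-- The exponent `∑_{n odd} (2 / n) y^n H_n` of the vertex operator. -/
noncomputable def vlog (y : MvPowerSeries σ ℂ) : MvPowerSeries σ Op :=
  substOp (fun _ : Unit => y) (vertexLog ham)

variable {y y' : MvPowerSeries σ ℂ}

theorem hasSubst_unit (hy : constantCoeff y = 0) : HasSubst fun _ : Unit => y :=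
  hasSubst_of_constantCoeff_zero fun _ => hy

theorem constantCoeff_vlog (hy : constantCoeff y = 0) : constantCoeff (vlog y) = 0 :=
  constantCoeff_substOp (hasSubst_unit hy) (constantCoeff_vertexLog ham)

theorem commute_vlog (hy : constantCoeff y = 0) (hy' : constantCoeff y' = 0) :
    Commute (vlog y) (vlog y') := by
  refine commute_of_coeff fun d e => ?_
  obtain ⟨D, hD⟩ := exists_finset_monomialAt (hasSubst_unit hy) d
  obtain ⟨D', hD'⟩ := exists_finset_monomialAt (hasSubst_unit hy') e
  rw [vlog, vlog, coeff_substOp (hD d le_rfl), coeff_substOp (hD' e le_rfl)]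
  refine Commute.sum_left _ _ _ fun i _ => Commute.sum_right _ _ _ fun j _ =>
    (Commute.smul_left ?_ _).smul_right _
  exact commute_coeff_vertexLog (fun n hn =>
    (commute_coeff_vertexLog (fun k hk => ham_commute k n hk hn) j).symm) i

theorem coeff_substOp_unit (G : PowerSeries Op) (c : σ →₀ ℕ) :
    coeff c (substOp (fun _ : Unit => y) G) = ∑ᶠ l : ℕ, coeff c (y ^ l) • PowerSeries.coeff l G := by
  change ∑ᶠ d, _ = _
  symm
  refine finsum_eq_of_bijective (fun l : ℕ => Finsupp.single () l) ⟨?_, fun d => ?_⟩ fun l => ?_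
  · exact Finsupp.single_injective ()
  · exact ⟨d (), (unit_finsupp_eq d).symm⟩
  · rw [monomialAt_single]
    rfl

/-- The sum over modes is suited to vacuum calculations; the exponential form is suited to products
and to the substituted times. -/
theorem vop_eq_formalExp (hy : constantCoeff y = 0) : vop y = formalExp (vlog y) := by
  rw [vlog, ← substOp_formalExp (hasSubst_unit hy) (constantCoeff_vertexLog ham)]
  ext c
  rw [coeff_substOp_unit]
  exact finsum_congr fun l => coeff_smul_C _ _ _

theorem coeff_vop (hy : constantCoeff y = 0) (c : σ →₀ ℕ) :
    coeff c (vop y) = ∑ l ∈ range (c.degree + 1), coeff c (y ^ l) • vx l := by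
  rw [vop, coeff_lsum (n := c.degree + 1), map_sum]
  · simp_rw [coeff_smul_C]
  · intro l hl c' hc'
    have := degree_le_of_le hc'
    exact coeff_pow_eq_zero hy (by omega)

theorem vop_zero : vop (0 : MvPowerSeries σ ℂ) = 1 := by
  rw [vop, lsum_pow_zero, vx_zero, map_one]

theorem vop_commute (hy : constantCoeff y = 0) (hy' : constantCoeff y' = 0) :
    Commute (vop y) (vop y') := by
  refine commute_of_coeff fun d e => ?_
  rw [coeff_vop hy, coeff_vop hy']
  exact Commute.sum_left _ _ _ fun i _ => Commute.sum_right _ _ _ fun j _ =>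
    ((vx_commute i j).smul_left _).smul_right _

theorem rzop_mul_vop (hy : constantCoeff y = 0) : rzop * vop y = vop y * rzop := by
  refine (commute_C_iff.2 fun d => ?_ : Commute (vop y) (C rz)).eq.symm
  rw [coeff_vop hy]
  exact Commute.sum_left _ _ _ fun i _ => Commute.smul_left (rz_mul_vx i).symm _

theorem rzop_mul_fop (m : ℤ) : (rzop * fop m : MvPowerSeries σ Op) = fop m * rzop := by
  rw [rzop, fop, ← map_mul, ← map_mul, rz_mul_fer]

theorem vop_mul_fop (hy : constantCoeff y = 0) (m : ℤ) :
    vop y * fop m = y • (vop y * fop (m - 1)) + fop m * vop y + y • (fop (m - 1) * vop y) := by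
  have hl := locFin_pow hy
  rw [vop, lsum_mul hl, lsum_mul hl, mul_lsum hl, mul_lsum hl, ← lsum_pow_shift hy,
    ← lsum_pow_shift hy, ← lsum_add hl, ← lsum_add hl]
  congr 1
  funext l
  rcases l with _ | l
  · simp [shiftSeq, vx_zero]
  · simp only [shiftSeq, fop, ← map_mul, ← map_add, vx_succ_mul_fer]

theorem V_fop_zero_vop (hy : constantCoeff y = 0) (Z : MvPowerSeries σ Op) :
    V (fop 0 * (vop y * Z)) =
      lsum (fun l => y ^ l) fun l => (-1) ^ l * V (fop (-l) * Z) := by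
  have hl := locFin_pow hy
  rw [vop, lsum_mul hl, mul_lsum hl, V_lsum hl]
  congr 1
  funext l
  rw [fop, ← mul_assoc, ← map_mul, V_C_mul_eq (a := (-1) ^ l) (Y := fer (-l)), fop]
  · rw [Algebra.smul_def]
    simp
  · intro Z
    rw [mul_assoc, ev₀_fer_zero_vx]

theorem V_vop_fop_pos (hy : constantCoeff y = 0) {m : ℕ} (hm : 0 < m) (Z : MvPowerSeries σ Op) :
    V (vop y * (fop m * Z)) = 2 * y ^ m * V (fop 0 * Z) := by
  have hl := locFin_pow hy
  rw [vop, lsum_mul hl, V_lsum hl, lsum_eq_single m]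
  · rw [fop, ← mul_assoc, ← map_mul, V_C_mul_eq (a := 2) (Y := fer 0), fop]
    · rw [Algebra.smul_def (2 : ℂ), smul_eq_mul, map_ofNat]
      ring
    · intro Z
      rw [mul_assoc, ev₀_vx_fer hm, if_pos rfl]
  · intro l hlm
    rw [fop, ← mul_assoc, ← map_mul]
    refine V_C_mul_eq_zero (fun Z => ?_) Z
    rw [mul_assoc, ev₀_vx_fer hm, if_neg hlm]

theorem V_vop_fop_zero (hy : constantCoeff y = 0) (Z : MvPowerSeries σ Op) :
    V (vop y * (fop 0 * Z)) = 2 * V (fop 0 * Z) - V (fop 0 * (vop y * Z)) := by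
  have hl := locFin_pow hy
  have h : ∀ l, V (C (vx l) * (fop 0 * Z)) =
      (if l = 0 then 2 * V (fop 0 * Z) else 0) + (-1 : MvPowerSeries σ ℂ) • V (fop 0 * (C (vx l) * Z)) := by
    intro l
    ext c
    simp only [fop, ← mul_assoc, ← map_mul]
    rw [map_add, neg_one_smul, map_neg, coeff_V, coeff_V, coeff_C_mul, coeff_C_mul, mul_assoc,
      ev₀_vx_fer_zero, sub_eq_add_neg, mul_assoc]
    congr 1
    split_ifs
    · have : (2 : MvPowerSeries σ ℂ) = C 2 := (map_ofNat C 2).symm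
      rw [this, coeff_C_mul, coeff_V, coeff_C_mul]
    · rw [map_zero]
  rw [vop, lsum_mul hl, V_lsum hl, funext h, lsum_add hl, lsum_smul hl, lsum_eq_single 0,
    ← V_lsum hl, ← mul_lsum hl, ← lsum_mul hl, if_pos rfl, neg_one_smul, ← sub_eq_add_neg, pow_zero,
    one_smul]
  intro l hl
  exact if_neg hl

theorem V_eq_fop_rzop (Z : MvPowerSeries σ Op) : V Z = 2 * V (fop 0 * (rzop * Z)) := by
  ext c
  rw [fop, rzop, ← mul_assoc, ← map_mul, V_C_mul_eq (a := 1 / 2) (Y := 1)]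
  · rw [map_one, one_mul, Algebra.smul_def, ← mul_assoc]
    have : (2 : MvPowerSeries σ ℂ) = algebraMap ℂ _ 2 := (map_ofNat _ 2).symm
    rw [this, ← map_mul]
    norm_num
  · intro Z
    rw [mul_assoc, one_mul, ev₀_half Z]
    ring

/-- This is `⟨0|V(y) = 2 ⟨0|φ(-1/y) rz`: a vertex operator at the left end is a single fermion
field. -/
theorem V_vop (hy : constantCoeff y = 0) (Z : MvPowerSeries σ Op) :
    V (vop y * Z) = 2 * lsum (fun l => y ^ l) fun l => (-1) ^ l * V (fop (-l) * (rzop * Z)) := by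
  rw [V_eq_fop_rzop, ← mul_assoc rzop, rzop_mul_vop hy, mul_assoc, V_fop_zero_vop hy]

theorem V_fop_pos {m : ℤ} (hm : 0 < m) (Z : MvPowerSeries σ Op) : V (fop m * Z) = 0 :=
  V_C_mul_eq_zero (ev₀_fer_pos hm) Z

theorem V_mul_fop_neg {m : ℤ} (hm : m < 0) (Z : MvPowerSeries σ Op) : V (Z * fop m) = 0 :=
  V_mul_C_eq_zero (ev₀_mul_fer_neg hm) Z

theorem V_mul_fop_zero (Z : MvPowerSeries σ Op) : V (Z * fop 0) = V (Z * rzop) :=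
  V_mul_C_eq ev₀_mul_fer_zero Z

theorem rzop_mul_rzop_mul (Z : MvPowerSeries σ Op) :
    rzop * (rzop * Z) = (1 / 2 : ℂ) • Z := by
  rw [rzop, ← mul_assoc, ← map_mul, rz_sq]
  ext c
  rw [coeff_C_mul, smul_mul_assoc, one_mul]
  rfl

theorem V_one : V (1 : MvPowerSeries σ Op) = 1 := by
  classical
  ext c
  rw [coeff_V, coeff_one, coeff_one]
  split_ifs
  · exact ev₀_one
  · exact map_zero _

theorem V_C (X : Op) : V (C X : MvPowerSeries σ Op) = C (ev₀ X) := by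
  classical
  ext c
  rw [coeff_V, coeff_C, coeff_C]
  split_ifs
  · rfl
  · exact map_zero _

end VertexOperators

end BKP

namespace BKP

open MvPowerSeries Finset

/-! ### The symmetry operator -/

section Symmetry

variable {N : ℕ}

/-- The weight of an exponent, where `t*_n` has weight `n` and the `x_i` have weight `0`. -/
noncomputable def timeWeight : (Fin N ⊕ ℕ →₀ ℕ) →+ ℕ :=
  Finsupp.weight (Sum.elim (fun _ => 0) fun j => 2 * j + 1)

/-- Series of weight `l` in the times `t*`. -/
def HasWeight (l : ℕ) (f : Series N) : Prop := ∀ c, coeff c f ≠ 0 → timeWeight c = l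

theorem HasWeight.mul {l k : ℕ} {f g : Series N} (hf : HasWeight l f) (hg : HasWeight k g) :
    HasWeight (l + k) (f * g) := by
  classical
  intro c hc
  rw [coeff_mul] at hc
  obtain ⟨p, hp, h⟩ := Finset.exists_ne_zero_of_sum_ne_zero hc
  rw [HasAntidiagonal.mem_antidiagonal] at hp
  rw [← hp, map_add, hf _ (left_ne_zero_of_mul h), hg _ (right_ne_zero_of_mul h)]

theorem HasWeight.sum {ι : Type*} {l : ℕ} {s : Finset ι} {f : ι → Series N}
    (hf : ∀ i ∈ s, HasWeight l (f i)) : HasWeight l (∑ i ∈ s, f i) := by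
  intro c hc
  rw [map_sum] at hc
  obtain ⟨i, hi, h⟩ := Finset.exists_ne_zero_of_sum_ne_zero hc
  exact hf i hi c h

theorem HasWeight.smul {l : ℕ} {f : Series N} (hf : HasWeight l f) (a : ℂ) :
    HasWeight l (a • f) := fun c hc => hf c fun h => hc (by
  rw [LinearMap.map_smul_of_tower, h, smul_zero])

theorem hasWeight_zero (l : ℕ) : HasWeight l (0 : Series N) := fun _ hc => absurd (map_zero _) hc

theorem hasWeight_one : HasWeight 0 (1 : Series N) := by
  classical
  intro c hc
  rw [coeff_one] at hc
  rw [(ite_ne_right_iff.1 hc).1, map_zero]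

/-- Weights are additive and nonnegative, so exponents below `c` have weight at most that of `c`. -/
theorem locFin_of_hasWeight {f : ℕ → Series N} (hf : ∀ l, HasWeight l (f l)) : LocFin f := by
  refine fun c => ⟨timeWeight c + 1, fun l hl c' hc' => ?_⟩
  by_contra h
  obtain ⟨e, rfl⟩ := exists_add_of_le hc'
  have := hf l c' h
  rw [map_add] at hl
  omega

/-- The times `t*_k`, for odd `k`. -/
noncomputable def oddTime (k : ℕ) : Series N := if Odd k then tStar N (k / 2) else 0

theorem hasWeight_oddTime (k : ℕ) : HasWeight k (oddTime k : Series N) := by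
  classical
  rw [oddTime]
  split_ifs with hk
  · intro c hc
    rw [tStar, coeff_X] at hc
    rw [(ite_ne_right_iff.1 hc).1, timeWeight, Finsupp.weight_single]
    obtain ⟨j, rfl⟩ := hk
    simp
    omega
  · exact hasWeight_zero k

theorem degreeD_oddTime (k : ℕ) : degreeD (oddTime k : Series N) = oddTime k := by
  classical
  rw [oddTime]
  split_ifs
  · ext d
    rw [coeff_degreeD, tStar, coeff_X]
    split_ifs with h
    · simp [h]
    · simp
  · exact map_zero _

/-- The functions `h_l(t*)`. -/
noncomputable def hTime (l : ℕ) : Series N := hPoly (tStar N) l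

/-- The generating series of the odd times. -/
noncomputable def oddTimeSeries : PowerSeries (Series N) := PowerSeries.mk oddTime

theorem hTime_eq (l : ℕ) : (hTime l : Series N) =
    PowerSeries.coeff l (formalExp oddTimeSeries : PowerSeries (Series N)) := rfl

theorem constantCoeff_oddTimeSeries :
    MvPowerSeries.constantCoeff (oddTimeSeries : PowerSeries (Series N)) = 0 := by
  rw [← powerSeries_coeff_zero, oddTimeSeries, PowerSeries.coeff_mk, oddTime, if_neg (by simp)]

theorem hTime_zero : (hTime 0 : Series N) = 1 := by
  rw [hTime_eq, powerSeries_coeff_zero, constantCoeff_formalExp]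

theorem hasWeight_hTime (l : ℕ) : HasWeight l (hTime l : Series N) := by
  have hpow : ∀ i l, HasWeight l (PowerSeries.coeff l ((oddTimeSeries : PowerSeries (Series N)) ^ i)) := by
    intro i
    induction i with
    | zero =>
      intro l
      rw [pow_zero, PowerSeries.coeff_one]
      split_ifs with h
      · rw [h]; exact hasWeight_one
      · exact hasWeight_zero _
    | succ i ih =>
      intro l
      rw [pow_succ, PowerSeries.coeff_mul]
      refine HasWeight.sum fun p hp => ?_
      rw [HasAntidiagonal.mem_antidiagonal] at hp
      rw [← hp]
      refine (ih _).mul ?_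
      rw [oddTimeSeries, PowerSeries.coeff_mk]
      exact hasWeight_oddTime _
  change HasWeight l (∑ i ∈ range ((Finsupp.single () l).degree + 1),
    ((i.factorial : ℂ)⁻¹) • PowerSeries.coeff l ((oddTimeSeries : PowerSeries (Series N)) ^ i))
  exact HasWeight.sum fun i _ => (hpow i l).smul _

theorem degreeD_hTime (l : ℕ) : degreeD (hTime l : Series N) = conv oddTime hTime l := by
  have hself : coeffMap degreeD (oddTimeSeries : PowerSeries (Series N)) = oddTimeSeries := by
    refine MvPowerSeries.ext fun d => ?_
    rw [coeff_coeffMap, unit_finsupp_eq d]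
    change degreeD (PowerSeries.coeff (d ()) oddTimeSeries) = PowerSeries.coeff (d ()) oddTimeSeries
    rw [oddTimeSeries, PowerSeries.coeff_mk, degreeD_oddTime]
  -- Each time has degree one, so the degree derivation, applied coefficientwise in `z`, fixes `T(z)
  -- = ∑ z^m t*_m`. Hence it sends `e^{T(z)}` to `T(z) e^{T(z)}`.
  have key := derivation_formalExp (coeffMap (degreeD (σ := Fin N ⊕ ℕ) (A := ℂ))) (fun f g => by
    classical
    refine MvPowerSeries.ext fun d => ?_
    rw [map_add, coeff_coeffMap, coeff_mul, coeff_mul, coeff_mul, map_sum,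
      ← Finset.sum_add_distrib]
    simp only [degreeD_mul, coeff_coeffMap]) (fun d => ⟨degreeD, fun f => coeff_coeffMap _ _ _⟩)
    constantCoeff_oddTimeSeries (by rw [hself])
  rw [hself] at key
  have := congrArg (MvPowerSeries.coeff (Finsupp.single () l)) key
  rw [coeff_coeffMap] at this
  change degreeD (PowerSeries.coeff l (formalExp oddTimeSeries : PowerSeries (Series N))) =
    PowerSeries.coeff l (oddTimeSeries * formalExp oddTimeSeries : PowerSeries (Series N)) at this
  rw [hTime_eq, this, PowerSeries.coeff_mul]
  simp only [conv, oddTimeSeries, PowerSeries.coeff_mk]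
  rfl

/-- The exponent `-B(t*)`. -/
noncomputable def bser (r : ℤ → ℂ) : MvPowerSeries (Fin N ⊕ ℕ) Op :=
  linearSeries (Sum.elim (fun _ => 0) fun j => negSym r (2 * j + 1))

/-- The operator `e^{-B(t*)}`. -/
noncomputable def bop (r : ℤ → ℂ) : MvPowerSeries (Fin N ⊕ ℕ) Op := formalExp (bser r)

theorem bser_eq (r : ℤ → ℂ) :
    (bser r : MvPowerSeries (Fin N ⊕ ℕ) Op) = lsum oddTime fun k => C (negSym r k) := by
  classical
  ext c
  change _ = ∑ᶠ l, _
  simp_rw [coeff_smul_C]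
  by_cases hc : ∃ j : ℕ, c = Finsupp.single (Sum.inr j) 1
  · obtain ⟨j, rfl⟩ := hc
    rw [bser, coeff_linearSeries, finsum_eq_single _ (2 * j + 1)]
    · rw [oddTime, if_pos ⟨j, rfl⟩, tStar, coeff_X, if_pos, one_smul]
      · rfl
      · congr 2
        omega
    · intro k hk
      rw [oddTime]
      split_ifs with h
      · rw [tStar, coeff_X, if_neg, zero_smul]
        intro h'
        have := Finsupp.single_left_injective one_ne_zero h'
        have := Sum.inr_injective this
        obtain ⟨i, rfl⟩ := h
        omega
      · rw [map_zero, zero_smul]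
  · rw [finsum_eq_zero_of_forall_eq_zero]
    · by_cases h1 : c.degree = 1
      · obtain ⟨s | j, rfl⟩ := exists_eq_single_of_degree_eq_one h1
        · rw [bser, coeff_linearSeries, Sum.elim_inl]
        · exact absurd ⟨j, rfl⟩ hc
      · exact coeff_linearSeries_of_degree_ne _ h1
    · intro k
      rw [oddTime]
      split_ifs
      · rw [tStar, coeff_X, if_neg fun h => hc ⟨_, h⟩, zero_smul]
      · rw [map_zero, zero_smul]

theorem constantCoeff_bser (r : ℤ → ℂ) :
    constantCoeff (bser r : MvPowerSeries (Fin N ⊕ ℕ) Op) = 0 := constantCoeff_linearSeries _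

theorem degreeD_bser (r : ℤ → ℂ) :
    degreeD (bser r : MvPowerSeries (Fin N ⊕ ℕ) Op) = bser r := degreeD_linearSeries _

theorem locFin_oddTime : LocFin (oddTime : ℕ → Series N) := locFin_of_hasWeight hasWeight_oddTime

theorem locFin_hTime : LocFin (hTime : ℕ → Series N) := locFin_of_hasWeight hasWeight_hTime

/-- The families `∑_l g_l r(m+1) ⋯ r(m+l) φ_{m+l}`. -/
noncomputable def dressed (r : ℤ → ℂ) (g : ℕ → Series N) (m : ℤ) : MvPowerSeries (Fin N ⊕ ℕ) Op :=
  lsum g fun l => rShift r m l • fop (m + l)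

theorem bser_mul_fop {r : ℤ → ℂ} (hr : ∀ n : ℤ, r n = r (1 - n)) (m : ℤ) :
    (bser r : MvPowerSeries (Fin N ⊕ ℕ) Op) * fop m = fop m * bser r + dressed r oddTime m := by
  have hl := locFin_oddTime (N := N)
  rw [bser_eq, lsum_mul hl, mul_lsum hl, dressed, ← lsum_add hl]
  ext c
  refine finsum_congr fun k => ?_
  by_cases hk : Odd k
  · congr 2
    dsimp only
    rw [fop, ← map_mul, ← map_mul, negSym_mul_fer hr hk, map_add]
    congr 1
    ext d
    classical
    rw [LinearMap.map_smul_of_tower, fop, coeff_C, coeff_C]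
    split_ifs
    · rfl
    · rw [smul_zero]
  · rw [oddTime, if_neg hk, zero_smul, zero_smul]

theorem constantCoeff_dressed (r : ℤ → ℂ) {g : ℕ → Series N} (hg : ∀ l, HasWeight l (g l))
    (h0 : g 0 = 1) (m : ℤ) : constantCoeff (dressed r g m) = fer m := by
  rw [← coeff_zero_eq_constantCoeff_apply]
  refine (finsum_eq_single _ 0 fun l hl => ?_).trans ?_
  · refine coeff_smul_eq_zero_left _ fun c' hc' => ?_
    by_contra h
    rw [nonpos_iff_eq_zero] at hc'
    exact hl (by rw [← hg l c' h, hc', map_zero])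
  · dsimp only
    rw [h0, one_smul, rShift_zero, one_smul, fop, Nat.cast_zero, add_zero]
    simp

theorem degreeD_dressed (r : ℤ → ℂ) (g : ℕ → Series N) (m : ℤ) :
    degreeD (dressed r g m) = dressed r (fun l => degreeD (g l)) m := by
  ext c
  rw [coeff_degreeD]
  have h : ∀ (f : Series N) (l : ℕ), coeff c (f • (rShift r m l • fop (m + l) : MvPowerSeries (Fin N ⊕ ℕ) Op)) =
      coeff c f • (rShift r m l • fer (m + l)) := fun f l => by
    rw [← coeff_smul_C]
    congr 2
    ext d
    classical
    rw [LinearMap.map_smul_of_tower, fop, coeff_C, coeff_C]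
    split_ifs
    · rfl
    · rw [smul_zero]
  change _ • (∑ᶠ l, _) = ∑ᶠ l, _
  simp_rw [h, coeff_degreeD]
  rw [smul_finsum]
  exact finsum_congr fun l => by rw [smul_assoc]

/-- The products `r(m+1)⋯r(m+l)` concatenate, so two successive shifts by `l` and `k` form one shift
by `l + k`, and the coefficient families are convolved. -/
theorem bser_mul_dressed {r : ℤ → ℂ} (hr : ∀ n : ℤ, r n = r (1 - n)) {g : ℕ → Series N}
    (hg : LocFin g) (m : ℤ) :
    bser r * dressed r g m = dressed r g m * bser r + dressed r (conv g oddTime) m := by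
  rw [dressed, mul_lsum hg, lsum_mul hg, dressed, ← lsum_lsum hg locFin_oddTime, ← lsum_add hg]
  congr 1
  funext l
  rw [mul_smul_comm, bser_mul_fop hr, smul_add, smul_mul_assoc]
  congr 1
  rw [dressed]
  ext c
  rw [LinearMap.map_smul_of_tower]
  change _ • (∑ᶠ l, _) = ∑ᶠ l, _
  rw [smul_finsum]
  refine finsum_congr fun k => ?_
  rw [← LinearMap.map_smul_of_tower, smul_comm, smul_smul, ← rShift_add]
  dsimp only
  rw [Nat.cast_add, add_assoc]

theorem conv_comm (f g : ℕ → Series N) : conv f g = conv g f := by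
  funext n
  rw [conv, conv, ← Finset.Nat.sum_antidiagonal_swap]
  exact Finset.sum_congr rfl fun p _ => mul_comm _ _

/-- By the preceding convolution rule, the commutator equation of `formalExp_mul_eq` becomes `D h_l
= ∑ t*_k h_{l-k}`. What matters later is that only indices `m + l` with `l ≥ 0` occur. -/
theorem bop_mul_fop {r : ℤ → ℂ} (hr : ∀ n : ℤ, r n = r (1 - n)) (m : ℤ) :
    bop r * fop m = dressed r (hTime (N := N)) m * bop r := by
  rw [fop, ← constantCoeff_dressed r hasWeight_hTime hTime_zero m, bop, formalExp_mul_eq]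
  · exact constantCoeff_bser r
  · rw [degreeD_bser]
  · rw [degreeD_bser, bser_mul_dressed hr locFin_hTime, add_sub_cancel_left, degreeD_dressed,
      conv_comm]
    congr 1
    funext l
    rw [degreeD_hTime]

/-- The functions `(-1)^l h_l(t*)`. -/
noncomputable def hTimeNeg (l : ℕ) : Series N := (-1) ^ l * hTime l

theorem hasWeight_hTimeNeg (l : ℕ) : HasWeight l (hTimeNeg l : Series N) := by
  have : (hTimeNeg l : Series N) = ((-1 : ℂ) ^ l) • hTime l := by
    rw [hTimeNeg, Algebra.smul_def, map_pow, map_neg, map_one]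
  rw [this]
  exact (hasWeight_hTime l).smul _

theorem degreeD_hTimeNeg (l : ℕ) :
    degreeD (hTimeNeg l : Series N) = -conv hTimeNeg oddTime l := by
  have : (hTimeNeg l : Series N) = ((-1 : ℂ) ^ l) • hTime l := by
    rw [hTimeNeg, Algebra.smul_def, map_pow, map_neg, map_one]
  rw [this, map_smul, degreeD_hTime, conv_comm, conv, conv, Finset.smul_sum,
    ← Finset.sum_neg_distrib]
  refine Finset.sum_congr rfl fun p hp => ?_
  rw [HasAntidiagonal.mem_antidiagonal] at hp
  rw [← hp, Algebra.smul_def, map_pow, map_neg, map_one, hTimeNeg, oddTime]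
  split_ifs with h
  · rw [pow_add, h.neg_one_pow]
    ring
  · simp

/-- Only odd times occur, so the inverse of `∑ z^l h_l` is `∑ (-z)^l h_l`; this is the source of the
signs. -/
theorem fop_mul_bop {r : ℤ → ℂ} (hr : ∀ n : ℤ, r n = r (1 - n)) (m : ℤ) :
    fop m * bop r = bop r * dressed r (hTimeNeg (N := N)) m := by
  rw [fop, ← constantCoeff_dressed (N := N) r hasWeight_hTimeNeg
    (by rw [hTimeNeg, hTime_zero, pow_zero, one_mul]) m,
    bop, mul_formalExp_eq]
  · exact constantCoeff_bser r
  · rw [degreeD_bser]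
  · rw [degreeD_bser, bser_mul_dressed hr (locFin_of_hasWeight hasWeight_hTimeNeg),
      sub_add_cancel_left, degreeD_dressed]
    simp_rw [degreeD_hTimeNeg]
    ext c
    rw [map_neg]
    change -(∑ᶠ l, _) = ∑ᶠ l, _
    rw [← finsum_neg_distrib]
    exact finsum_congr fun l => by rw [← map_neg, ← neg_smul]

theorem V_smul {σ : Type*} (a : ℂ) (Z : MvPowerSeries σ Op) : V (a • Z) = a • V Z :=
  map_smul (coeffMap ev₀) a Z

theorem V_bser_mul (r : ℤ → ℂ) (Z : MvPowerSeries (Fin N ⊕ ℕ) Op) : V (bser r * Z) = 0 := by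
  rw [bser_eq, lsum_mul locFin_oddTime, V_lsum locFin_oddTime]
  ext c
  refine finsum_eq_zero_of_forall_eq_zero fun k => ?_
  by_cases hk : Odd k
  · dsimp only
    rw [V_C_mul_eq_zero (ev₀_negSym r hk.pos), smul_zero, map_zero]
  · rw [oddTime, if_neg hk, zero_smul, map_zero]

/-- Since `⟨0|B_k = 0`, only the zeroth power in the exponential survives. -/
theorem V_bop_mul (r : ℤ → ℂ) (Z : MvPowerSeries (Fin N ⊕ ℕ) Op) : V (bop r * Z) = V Z := by
  ext d
  have h : coeff d (bop r * Z) =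
      coeff d ((∑ i ∈ range (d.degree + 1), ((i.factorial : ℂ)⁻¹) • bser r ^ i) * Z) :=
    coeff_mul_congr (fun c hc => coeff_formalExp (constantCoeff_bser r)
      (Nat.lt_succ_of_le (degree_le_of_le hc))) fun _ _ => rfl
  rw [coeff_V, h, ← coeff_V, Finset.sum_mul, map_sum, Finset.sum_eq_single 0]
  · simp
  · intro i _ hi
    obtain ⟨i, rfl⟩ := Nat.exists_eq_succ_of_ne_zero hi
    rw [smul_mul_assoc, V_smul, pow_succ', mul_assoc, V_bser_mul, smul_zero]
  · simp

theorem rzop_mul_bop (r : ℤ → ℂ) :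
    (rzop * bop r : MvPowerSeries (Fin N ⊕ ℕ) Op) = bop r * rzop := by
  refine (commute_formalExp (constantCoeff_bser r) ?_).eq.symm
  have hl := locFin_oddTime (N := N)
  change bser r * rzop = rzop * bser r
  rw [bser_eq, lsum_mul hl, mul_lsum hl]
  ext c
  refine finsum_congr fun k => ?_
  by_cases hk : Odd k
  · dsimp only
    rw [rzop, ← map_mul, ← map_mul, (negSym_commute_rz r hk).eq]
  · rw [oddTime, if_neg hk, zero_smul, zero_smul]

end Symmetry

end BKP

namespace BKP

open MvPowerSeries Finset

/-! ### Products of vertex operators -/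

section VertexProducts

variable {N : ℕ} {ι : Type*} [DecidableEq ι] {y : ι → Series N}

/-- The product of the vertex operators at `y j`, for `j ∈ J`. -/
noncomputable def vprod (y : ι → Series N) (J : Finset ι) : MvPowerSeries (Fin N ⊕ ℕ) Op :=
  formalExp (∑ j ∈ J, vlog (y j))

theorem vprod_empty : vprod y ∅ = 1 := by
  rw [vprod, sum_empty, formalExp_zero]

theorem vprod_insert (hy : ∀ j, constantCoeff (y j) = 0) {a : ι} {J : Finset ι} (ha : a ∉ J) :
    vprod y (insert a J) = vop (y a) * vprod y J := by
  rw [vprod, sum_insert ha, formalExp_add, vop_eq_formalExp (hy a), vprod]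
  · exact Commute.sum_right _ _ _ fun j _ => commute_vlog (hy a) (hy j)
  · exact constantCoeff_vlog (hy a)
  · rw [map_sum]
    exact Finset.sum_eq_zero fun j _ => constantCoeff_vlog (hy j)

theorem vprod_singleton (hy : ∀ j, constantCoeff (y j) = 0) (a : ι) :
    vprod y {a} = vop (y a) := by
  rw [← insert_empty_eq, vprod_insert hy (notMem_empty a), vprod_empty, mul_one]

theorem vprod_mul_vop (hy : ∀ j, constantCoeff (y j) = 0) (J : Finset ι) (a : ι) :
    vprod y J * vop (y a) = vop (y a) * vprod y J := by
  induction J using Finset.induction_on with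
  | empty => rw [vprod_empty, one_mul, mul_one]
  | insert b J hb ih =>
    rw [vprod_insert hy hb, mul_assoc, ih, ← mul_assoc, (vop_commute (hy b) (hy a)).eq, mul_assoc]

theorem rzop_mul_vprod (hy : ∀ j, constantCoeff (y j) = 0) (J : Finset ι) :
    rzop * vprod y J = vprod y J * rzop := by
  induction J using Finset.induction_on with
  | empty => rw [vprod_empty, one_mul, mul_one]
  | insert b J hb ih =>
    rw [vprod_insert hy hb, ← mul_assoc, rzop_mul_vop (hy b), mul_assoc, ih, mul_assoc]

theorem V_vprod_insert_mul_fop (hy : ∀ j, constantCoeff (y j) = 0) {a : ι} {J : Finset ι}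
    (ha : a ∉ J) (m : ℤ) (Z : MvPowerSeries (Fin N ⊕ ℕ) Op) :
    V (vprod y (insert a J) * (fop m * Z)) =
      y a * V (vprod y (insert a J) * (fop (m - 1) * Z)) +
        V (vprod y J * (fop m * (vop (y a) * Z))) +
        y a * V (vprod y J * (fop (m - 1) * (vop (y a) * Z))) := by
  have h : vprod y (insert a J) * (fop m * Z) =
      y a • (vprod y (insert a J) * (fop (m - 1) * Z)) + vprod y J * (fop m * (vop (y a) * Z)) +
        y a • (vprod y J * (fop (m - 1) * (vop (y a) * Z))) := by
    rw [vprod_insert hy ha, ← vprod_mul_vop hy, ← mul_assoc, mul_assoc _ _ (fop m),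
      vop_mul_fop (hy a)]
    simp only [mul_add, add_mul, mul_smul_comm, smul_mul_assoc, mul_assoc]
  rw [h, map_add, map_add, map_smul, map_smul, smul_eq_mul, smul_eq_mul]

/-- `∏_{k ≠ j} (y_j + y_k) / (y_j - y_k)`. -/
noncomputable def cauchyWeight (y : ι → Series N) (J : Finset ι) (j : ι) : SeriesField N :=
  ∏ k ∈ J.erase j, (toField (y j) + toField (y k)) / (toField (y j) - toField (y k))

theorem toField_sub_ne_zero (hinj : Function.Injective y) {i j : ι} (h : i ≠ j) :
    toField (y i) - toField (y j) ≠ 0 :=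
  sub_ne_zero.2 fun h' => h (hinj (IsFractionRing.injective (Series N) (SeriesField N) h'))

/-- A partial fraction expansion of `∏_j (1 + y_j z)/(1 - y_j z)`: the residues are the Cauchy
weights, and the value `(-1)^{|J|}` at infinity is the correction at `n = 0`. -/
theorem V_vprod_mul_fop (hy : ∀ j, constantCoeff (y j) = 0) (hinj : Function.Injective y)
    (J : Finset ι) (n : ℕ) (Z : MvPowerSeries (Fin N ⊕ ℕ) Op) :
    toField (V (vprod y J * (fop n * Z))) =
      2 * ∑ j ∈ J, cauchyWeight y J j * toField (y j) ^ n *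
        toField (V (fop 0 * (vprod y (J.erase j) * Z))) +
      if n = 0 then (-1) ^ J.card * toField (V (fop 0 * (vprod y J * Z))) else 0 := by
  induction J using Finset.strongInduction generalizing n Z with
  | H J ih =>
  rcases J.eq_empty_or_nonempty with rfl | ⟨a, ha⟩
  · rw [sum_empty, mul_zero, zero_add, vprod_empty, one_mul, one_mul, card_empty, pow_zero, one_mul]
    split_ifs with hn
    · rw [hn, Nat.cast_zero]
    · rw [V_fop_pos (by omega), map_zero]
  set w : ℕ → SeriesField N := fun n => toField (V (vprod y J * (fop n * Z))) -
      (2 * ∑ j ∈ J, cauchyWeight y J j * toField (y j) ^ n *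
        toField (V (fop 0 * (vprod y (J.erase j) * Z))) +
      if n = 0 then (-1) ^ J.card * toField (V (fop 0 * (vprod y J * Z))) else 0) with hw
  suffices h : w n = 0 from sub_eq_zero.1 h
  -- The difference `w` of the two sides is a geometric sequence with ratio `y_a` for every `a ∈ J`;
  -- two distinct ratios force `w n = 0`, and only a singleton needs a direct check.
  have hstep : ∀ a ∈ J, w (n + 1) = toField (y a) * w n := by
    intro a ha
    have h1 := V_vprod_insert_mul_fop hy (notMem_erase a J) ((n + 1 : ℕ) : ℤ) Z
    rw [insert_erase ha, show ((n + 1 : ℕ) : ℤ) - 1 = n by push_cast; ring] at h1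
    have h2 := congrArg toField h1
    rw [map_add, map_add, map_mul toField, map_mul toField, ih _ (erase_ssubset ha) (n + 1),
      ih _ (erase_ssubset ha) n, if_neg n.succ_ne_zero] at h2
    have hE : vprod y (J.erase a) * (vop (y a) * Z) = vprod y J * Z := by
      rw [← mul_assoc, vprod_mul_vop hy, ← vprod_insert hy (notMem_erase a J), insert_erase ha]
    have hE' : ∀ j ∈ J.erase a, vprod y ((J.erase a).erase j) * (vop (y a) * Z) =
        vprod y (J.erase j) * Z := by
      intro j hj
      rw [mem_erase] at hj
      rw [← mul_assoc, vprod_mul_vop hy, ← vprod_insert hy (by simp), erase_right_comm,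
        insert_erase (mem_erase.2 ⟨hj.1.symm, ha⟩)]
    have hs : ∀ n, ∑ j ∈ J.erase a, cauchyWeight y (J.erase a) j * toField (y j) ^ n *
        toField (V (fop 0 * (vprod y ((J.erase a).erase j) * (vop (y a) * Z)))) =
        ∑ j ∈ J.erase a, cauchyWeight y (J.erase a) j * toField (y j) ^ n *
        toField (V (fop 0 * (vprod y (J.erase j) * Z))) := fun n =>
      sum_congr rfl fun j hj => by rw [hE' j hj]
    rw [hs, hs, hE] at h2
    have hc : J.card = (J.erase a).card + 1 := (card_erase_add_one ha).symm
    have hsum : ∑ j ∈ J, cauchyWeight y J j * toField (y j) ^ (n + 1) *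
          toField (V (fop 0 * (vprod y (J.erase j) * Z))) -
        toField (y a) * ∑ j ∈ J, cauchyWeight y J j * toField (y j) ^ n *
          toField (V (fop 0 * (vprod y (J.erase j) * Z))) =
        ∑ j ∈ J.erase a, cauchyWeight y (J.erase a) j * toField (y j) ^ (n + 1) *
          toField (V (fop 0 * (vprod y (J.erase j) * Z))) +
        toField (y a) * ∑ j ∈ J.erase a, cauchyWeight y (J.erase a) j * toField (y j) ^ n *
          toField (V (fop 0 * (vprod y (J.erase j) * Z))) := by
      rw [mul_sum, mul_sum, ← sum_sub_distrib, ← sum_add_distrib, ← add_sum_erase J _ ha]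
      rw [show ∀ u v x z : SeriesField N, u * v ^ (n + 1) * x - v * (u * v ^ n * x) + z = z by
        intros; ring]
      refine sum_congr rfl fun j hj => ?_
      have hj' := mem_erase.1 hj
      have hne := toField_sub_ne_zero hinj hj'.1
      have : cauchyWeight y J j * (toField (y j) - toField (y a)) =
          cauchyWeight y (J.erase a) j * (toField (y j) + toField (y a)) := by
        rw [cauchyWeight, ← mul_prod_erase _ _ (mem_erase.2 ⟨hj'.1.symm, ha⟩), cauchyWeight,
          erase_right_comm]
        field_simp
      linear_combination toField (y j) ^ n *
          toField (V (fop 0 * (vprod y (J.erase j) * Z))) * this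
    rw [hw]
    simp only [n.succ_ne_zero, if_false]
    rw [h2]
    split_ifs with hn
    · rw [hc, pow_succ]
      linear_combination (-2) * hsum
    · linear_combination (-2) * hsum
  by_cases hJ : J = {a}
  · rw [hw]
    simp only [hJ, sum_singleton, cauchyWeight, erase_singleton, prod_empty, vprod_empty,
      card_singleton, vprod_singleton hy, one_mul, pow_one]
    rcases Nat.eq_zero_or_pos n with rfl | hn
    · rw [Nat.cast_zero, V_vop_fop_zero (hy a), if_pos rfl]
      simp only [map_sub, map_mul, map_ofNat]
      ring
    · rw [V_vop_fop_pos (hy a) hn, if_neg hn.ne']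
      simp only [map_mul, map_ofNat, map_pow]
      ring
  · obtain ⟨b, hb, hab⟩ : ∃ b ∈ J, b ≠ a := by
      by_contra! h
      exact hJ (eq_singleton_iff_unique_mem.2 ⟨ha, h⟩)
    have h1 := hstep a ha
    rw [hstep b hb, ← sub_eq_zero, ← sub_mul] at h1
    exact (mul_eq_zero.1 h1).resolve_left (toField_sub_ne_zero hinj hab)

end VertexProducts

end BKP

namespace BKP

open MvPowerSeries Finset

/-! ### Reduction of a vertex product to single vertex operators -/

section Causality

variable {σ A B : Type*} [Ring A] [Algebra ℂ A] [Module (MvPowerSeries σ ℂ) (MvPowerSeries σ A)]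
  [SeriesModule σ A] [Ring B] [Algebra ℂ B] [Module (MvPowerSeries σ ℂ) (MvPowerSeries σ B)]
  [SeriesModule σ B]

theorem Causal.smul {Λ : MvPowerSeries σ A →ₗ[MvPowerSeries σ ℂ] MvPowerSeries σ B}
    (h : Causal Λ) (f : MvPowerSeries σ ℂ) : Causal (f • Λ) := fun _ Z hZ =>
  coeff_smul_eq_zero_right f fun c' hc' => h c' Z fun c'' hc'' => hZ c'' (hc''.trans hc')

theorem Causal.sub {Λ Λ' : MvPowerSeries σ A →ₗ[MvPowerSeries σ ℂ] MvPowerSeries σ B}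
    (h : Causal Λ) (h' : Causal Λ') : Causal (Λ - Λ') := fun c Z hZ => by
  rw [LinearMap.sub_apply, map_sub, h c Z hZ, h' c Z hZ, sub_zero]

theorem Causal.sum {ι : Type*} (s : Finset ι)
    {Λ : ι → MvPowerSeries σ A →ₗ[MvPowerSeries σ ℂ] MvPowerSeries σ B}
    (h : ∀ i, Causal (Λ i)) : Causal (∑ i ∈ s, Λ i) := fun c Z hZ => by
  rw [LinearMap.sum_apply, map_sum]
  exact Finset.sum_eq_zero fun i _ => h i c Z hZ

end Causality

section Reduction

variable {N : ℕ} {ι : Type*} [DecidableEq ι] {y : ι → Series N} {r : ℤ → ℂ}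

/-- The tau function with the times `t` restricted to the variables `y j`, for `j ∈ J`. -/
noncomputable def tauSet (r : ℤ → ℂ) (y : ι → Series N) (J : Finset ι) : Series N :=
  V (vprod y J * bop r)

theorem tauSet_empty (r : ℤ → ℂ) (y : ι → Series N) : tauSet r y ∅ = 1 := by
  rw [tauSet, vprod_empty, one_mul, ← mul_one (bop r), V_bop_mul, V_one]

/-- The common denominator of the weights `cauchyWeight`. -/
noncomputable def discr (y : ι → Series N) (J : Finset ι) : Series N :=
  ∏ a ∈ J, ∏ b ∈ J.erase a, (y a - y b)

/-- The numerators of the weights `cauchyWeight`. -/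
noncomputable def cauchyNum (y : ι → Series N) (J : Finset ι) (j : ι) : Series N :=
  (∏ k ∈ J.erase j, (y j + y k)) * ∏ a ∈ J.erase j, ∏ b ∈ J.erase a, (y a - y b)

theorem toField_discr_ne_zero (hinj : Function.Injective y) (J : Finset ι) :
    toField (discr y J) ≠ 0 := by
  rw [discr, map_prod]
  refine prod_ne_zero_iff.2 fun a _ => ?_
  rw [map_prod]
  refine prod_ne_zero_iff.2 fun b hb => ?_
  rw [map_sub]
  exact toField_sub_ne_zero hinj (mem_erase.1 hb).1.symm

theorem toField_cauchyNum (hinj : Function.Injective y) {J : Finset ι} {j : ι} (hj : j ∈ J) :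
    toField (cauchyNum y J j) = toField (discr y J) * cauchyWeight y J j := by
  rw [discr, ← mul_prod_erase _ _ hj, cauchyNum, cauchyWeight, prod_div_distrib]
  simp only [map_mul, map_prod, map_add, map_sub]
  have : ∏ k ∈ J.erase j, (toField (y j) - toField (y k)) ≠ 0 := prod_ne_zero_iff.2 fun k hk =>
    toField_sub_ne_zero hinj (mem_erase.1 hk).1.symm
  field_simp

/-- The difference of the two sides of the reduction of a vertex product to single vertex
operators. -/
noncomputable def defect (r : ℤ → ℂ) (y : ι → Series N) (J : Finset ι) :
    MvPowerSeries (Fin N ⊕ ℕ) Op →ₗ[Series N] Series N :=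
  discr y J • (V ∘ₗ LinearMap.mulLeft (Series N) (vprod y J)) -
    ∑ j ∈ J, (cauchyNum y J j * tauSet r y (J.erase j)) •
      (V ∘ₗ LinearMap.mulLeft (Series N) (vop (y j)))

theorem defect_apply (r : ℤ → ℂ) (y : ι → Series N) (J : Finset ι)
    (Z : MvPowerSeries (Fin N ⊕ ℕ) Op) :
    defect r y J Z = discr y J * V (vprod y J * Z) -
      ∑ j ∈ J, cauchyNum y J j * tauSet r y (J.erase j) * V (vop (y j) * Z) := by
  rw [defect, LinearMap.sub_apply, LinearMap.sum_apply]
  rfl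

/-- With denominators cleared, the functional takes values in power series, so it can be exchanged
with the infinite sums over dressed modes. -/
theorem causal_defect (r : ℤ → ℂ) (y : ι → Series N) (J : Finset ι) : Causal (defect r y J) :=
  ((causal_V.comp (causal_mulLeft _)).smul _).sub
    (Causal.sum _ fun _ => (causal_V.comp (causal_mulLeft _)).smul _)

theorem two_mul_V_fop_rzop_bop (hy : ∀ j, constantCoeff (y j) = 0) (J : Finset ι) :
    2 * V (fop 0 * (vprod y J * (rzop * bop r))) = tauSet r y J := by
  rw [← mul_assoc (vprod y J), ← rzop_mul_vprod hy, mul_assoc, ← V_eq_fop_rzop, tauSet]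

/-- For positive modes `⟨V(y_j) φ_n rz e^{-B}⟩ = y_j^n`, and the partial fraction expansion of the
whole product has exactly the matching residues. -/
theorem defect_fop_pos (hy : ∀ j, constantCoeff (y j) = 0) (hinj : Function.Injective y)
    (J : Finset ι) {n : ℕ} (hn : 0 < n) : defect r y J (fop n * (rzop * bop r)) = 0 := by
  have h1 : ∀ j, V (vop (y j) * (fop n * (rzop * bop r))) = y j ^ n := fun j => by
    have h := two_mul_V_fop_rzop_bop (r := r) hy ∅
    rw [tauSet_empty, vprod_empty, one_mul] at h
    rw [V_vop_fop_pos (hy j) hn, mul_assoc, mul_left_comm, h, mul_one]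
  apply IsFractionRing.injective (Series N) (SeriesField N)
  rw [defect_apply, map_sub, map_mul, V_vprod_mul_fop hy hinj, if_neg hn.ne', map_zero, add_zero,
    map_sum, mul_sum, mul_sum, sub_eq_zero]
  refine sum_congr rfl fun j hj => ?_
  have h2 := congrArg toField (two_mul_V_fop_rzop_bop (r := r) hy (J.erase j))
  rw [map_mul toField, map_ofNat] at h2
  rw [h1, map_mul toField _ (y j ^ n), map_mul toField (cauchyNum y J j),
    toField_cauchyNum hinj hj, map_pow, ← h2]
  ring

/-- The obstruction to the reduction of a vertex product to single vertex operators. -/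
noncomputable def obstruction (r : ℤ → ℂ) (y : ι → Series N) (J : Finset ι) : Series N :=
  discr y J * tauSet r y J - ∑ j ∈ J, cauchyNum y J j * tauSet r y (J.erase j) * tauSet r y {j}

/-- The oddness of `J` enters here: the boundary terms at `n = 0` have the sign `(-1)^{|J|} = -1`
for `J` as for a single variable, so together they form minus the obstruction. -/
theorem defect_fop_zero (hy : ∀ j, constantCoeff (y j) = 0) (hinj : Function.Injective y)
    {J : Finset ι} (hJ : Odd J.card) :
    2 * defect r y J (fop 0 * (rzop * bop r)) = -obstruction r y J := by
  have h1 : ∀ j, 2 * V (vop (y j) * (fop 0 * (rzop * bop r))) = 2 - tauSet r y {j} := fun j => by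
    have h := two_mul_V_fop_rzop_bop (r := r) hy ∅
    rw [tauSet_empty, vprod_empty, one_mul] at h
    rw [V_vop_fop_zero (hy j), mul_sub, mul_left_comm 2, h, mul_one, ← vprod_singleton hy,
      two_mul_V_fop_rzop_bop hy]
  apply IsFractionRing.injective (Series N) (SeriesField N)
  have h0 := V_vprod_mul_fop hy hinj J 0 (rzop * bop r)
  rw [if_pos rfl, hJ.neg_one_pow, Nat.cast_zero] at h0
  have h2 : (2 : Series N) * defect r y J (fop 0 * (rzop * bop r)) =
      discr y J * (2 * V (vprod y J * (fop 0 * (rzop * bop r)))) -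
      ∑ j ∈ J, cauchyNum y J j * tauSet r y (J.erase j) * (2 - tauSet r y {j}) := by
    rw [defect_apply, mul_sub, mul_sum, mul_left_comm]
    congr 1
    exact sum_congr rfl fun j _ => by rw [← h1]; ring
  have h3 := congrArg toField (two_mul_V_fop_rzop_bop (r := r) hy J)
  rw [map_mul, map_ofNat] at h3
  rw [h2, obstruction]
  simp only [map_sub, map_mul, map_ofNat, map_neg, map_sum]
  rw [h0, mul_add, ← mul_assoc (2 : SeriesField N), mul_sum, neg_one_mul, mul_neg, h3]
  have h4 : ∑ j ∈ J, 2 * 2 * (cauchyWeight y J j * toField (y j) ^ 0 *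
        toField (V (fop 0 * (vprod y (J.erase j) * (rzop * bop r))))) =
      ∑ j ∈ J, 2 * (cauchyWeight y J j * toField (tauSet r y (J.erase j))) := by
    refine sum_congr rfl fun j _ => ?_
    rw [← two_mul_V_fop_rzop_bop hy, map_mul toField, map_ofNat]
    ring
  rw [h4, neg_sub, mul_add, mul_sum]
  have h5 : ∀ j ∈ J, toField (cauchyNum y J j) * toField (tauSet r y (J.erase j)) *
      (2 - toField (tauSet r y {j})) =
      toField (discr y J) * (2 * (cauchyWeight y J j * toField (tauSet r y (J.erase j)))) -
      toField (cauchyNum y J j) * toField (tauSet r y (J.erase j)) * toField (tauSet r y {j}) := by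
    intro j hj
    rw [toField_cauchyNum hinj hj]
    ring
  rw [sum_congr rfl h5, sum_sub_distrib]
  ring

/-- At the right vacuum `φ_0` may be replaced by `rz`, which moves left and cancels the other `rz`;
hence the plus sign, opposite to that of `defect_fop_zero`. -/
theorem defect_rzop_bop_fop_zero (hy : ∀ j, constantCoeff (y j) = 0) (J : Finset ι) :
    2 * defect r y J (rzop * bop r * fop 0) = obstruction r y J := by
  have h1 : ∀ J, 2 * V (vprod y J * (rzop * bop r * fop 0)) = tauSet r y J := by
    intro J
    rw [← mul_assoc, V_mul_fop_zero, mul_assoc, mul_assoc, ← rzop_mul_bop, rzop_mul_rzop_mul,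
      mul_smul_comm, V_smul, ← tauSet, Algebra.smul_def, ← mul_assoc]
    have : (2 : Series N) = algebraMap ℂ _ 2 := (map_ofNat _ 2).symm
    rw [this, ← map_mul]
    norm_num
  rw [defect_apply, mul_sub, mul_sum, mul_left_comm, h1, obstruction]
  congr 1
  refine sum_congr rfl fun j _ => ?_
  rw [mul_left_comm, ← vprod_singleton hy, h1]

theorem smul_fop_mul_comm_rzop (m : ℤ) (a : ℂ) (Z : MvPowerSeries (Fin N ⊕ ℕ) Op) :
    rzop * ((a • fop m) * Z) = a • (fop m * (rzop * Z)) := by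
  rw [smul_mul_assoc, mul_smul_comm, ← mul_assoc, rzop_mul_fop, mul_assoc]

theorem map_complex_smul (Λ : MvPowerSeries (Fin N ⊕ ℕ) Op →ₗ[Series N] Series N) (a : ℂ)
    (Z : MvPowerSeries (Fin N ⊕ ℕ) Op) : Λ (a • Z) = a • Λ Z := by
  have h : a • Z = (algebraMap ℂ (Series N) a) • Z := by
    classical
    ext c
    rw [SeriesModule.coeff_smul, Finset.sum_eq_single (0, c)]
    · rw [LinearMap.map_smul_of_tower]
      simp [MvPowerSeries.algebraMap_apply]
    · rintro ⟨p, q⟩ hp hne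
      rw [HasAntidiagonal.mem_antidiagonal] at hp
      rw [MvPowerSeries.algebraMap_apply, coeff_C, if_neg, zero_smul]
      rintro rfl
      simp at hp
      exact hne (by rw [hp])
    · simp
  rw [h, map_smul, ← algebraMap_smul (Series N) a (Λ Z)]

theorem map_dressed {Λ : MvPowerSeries (Fin N ⊕ ℕ) Op →ₗ[Series N] Series N} (hΛ : Causal Λ)
    {g : ℕ → Series N} (hg : LocFin g) (m : ℤ)
    (h : ∀ l : ℕ, Λ (fop (m + l)) = 0) : Λ (dressed r g m) = 0 := by
  rw [dressed, map_lsum hΛ hg]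
  ext c
  refine finsum_eq_zero_of_forall_eq_zero fun l => ?_
  dsimp only
  rw [map_complex_smul, h, smul_zero, smul_zero, map_zero]

theorem defect_rzop_bop_fop (hr : ∀ n : ℤ, r n = r (1 - n)) (hy : ∀ j, constantCoeff (y j) = 0)
    (hinj : Function.Injective y) {J : Finset ι} (hJ : Odd J.card) (m : ℤ) :
    defect r y J (rzop * bop r * fop m) = 0 := by
  have hlt : ∀ Z : MvPowerSeries (Fin N ⊕ ℕ) Op, m < 0 → V (Z * (rzop * bop r * fop m)) = 0 :=
    fun Z hm => by rw [← mul_assoc, V_mul_fop_neg hm]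
  have hexp : ∀ n : ℕ, rzop * bop r * fop n =
      lsum hTime fun l => rShift r n l • (fop (n + l : ℕ) * (rzop * bop r) : MvPowerSeries (Fin N ⊕ ℕ) Op) := by
    intro n
    rw [mul_assoc, bop_mul_fop hr, dressed, lsum_mul locFin_hTime, mul_lsum locFin_hTime]
    congr 1
    funext l
    rw [smul_fop_mul_comm_rzop, Nat.cast_add]
  rcases lt_or_ge m 0 with hm | hm
  · rw [defect_apply, hlt _ hm, mul_zero, zero_sub, neg_eq_zero]
    exact sum_eq_zero fun j _ => by rw [hlt _ hm, mul_zero]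
  lift m to ℕ using hm
  rcases Nat.eq_zero_or_pos m with rfl | hm
  · have h1 : defect r y J (rzop * bop r * fop (0 : ℕ)) = defect r y J (fop 0 * (rzop * bop r)) := by
      rw [hexp, map_lsum (causal_defect r y J) locFin_hTime, lsum_eq_single 0]
      · rw [hTime_zero, one_smul, Nat.cast_zero, rShift_zero, one_smul]
      · intro l hl
        rw [map_complex_smul, defect_fop_pos hy hinj J (by omega), smul_zero]
    have h2 := defect_fop_zero (r := r) hy hinj hJ
    have h3 := defect_rzop_bop_fop_zero (r := r) hy J
    rw [Nat.cast_zero] at h1 ⊢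
    rw [← h1, ← h3] at h2
    -- Moving `φ_0` across `e^{-B}` only adds positive modes, where the defect vanishes. So both
    -- orders have the same defect, which is its own negative.
    have h4 : (4 : Series N) * defect r y J (rzop * bop r * fop 0) = 0 := by
      linear_combination h2
    refine (mul_eq_zero.1 h4).resolve_left ?_
    have : (4 : Series N) = algebraMap ℂ _ 4 := (map_ofNat _ 4).symm
    rw [this]
    exact (map_ne_zero_iff _ (algebraMap ℂ (Series N)).injective).2 (by norm_num)
  · rw [hexp, map_lsum (causal_defect r y J) locFin_hTime]
    ext c
    refine finsum_eq_zero_of_forall_eq_zero fun l => ?_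
    dsimp only
    rw [map_complex_smul, defect_fop_pos hy hinj J (by omega), smul_zero, smul_zero, map_zero]

/-- Moving `φ_m` to the right through `e^{-B}` expresses this case by the reverse order, for which
all modes are already settled. -/
theorem defect_fop (hr : ∀ n : ℤ, r n = r (1 - n)) (hy : ∀ j, constantCoeff (y j) = 0)
    (hinj : Function.Injective y) {J : Finset ι} (hJ : Odd J.card) (m : ℤ) :
    defect r y J (fop m * (rzop * bop r)) = 0 := by
  have h := map_dressed (r := r) (g := hTimeNeg)
    (Λ := defect r y J ∘ₗ LinearMap.mulLeft (Series N) (rzop * bop r))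
    ((causal_defect r y J).comp (causal_mulLeft (rzop * bop r)))
    (locFin_of_hasWeight hasWeight_hTimeNeg) m
    fun l => by
      rw [LinearMap.comp_apply, LinearMap.mulLeft_apply]
      exact defect_rzop_bop_fop hr hy hinj hJ (m + l)
  rw [LinearMap.comp_apply, LinearMap.mulLeft_apply, mul_assoc, ← fop_mul_bop hr, ← mul_assoc,
    rzop_mul_fop, mul_assoc] at h
  exact h

end Reduction

end BKP

namespace BKP

open MvPowerSeries Finset

/-! ### Recursion for the tau function -/

section Sequences

variable {σ : Type*}

/-- The shift of bi-infinite sequences by one place. -/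
noncomputable def shift (R : Type*) [CommRing R] : Module.End R (ℤ → R) :=
  LinearMap.funLeft R R fun p => p - 1

theorem shift_apply {R : Type*} [CommRing R] (f : ℤ → R) (p : ℤ) : shift R f p = f (p - 1) := rfl

/-- Summation against `b^l` over `l ≥ 0` turns the shift into multiplication by `b`. Vanishing at
negative places is needed so that a shift carries nothing across zero. -/
theorem lsum_aeval_shift {b : MvPowerSeries σ ℂ} (hb : constantCoeff b = 0)
    (P : Polynomial (MvPowerSeries σ ℂ)) {f : ℤ → MvPowerSeries σ ℂ} (hf : ∀ p < 0, f p = 0) :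
    (∀ p < 0, Polynomial.aeval (shift (MvPowerSeries σ ℂ)) P f p = 0) ∧
    lsum (fun l => b ^ l) (fun l : ℕ => Polynomial.aeval (shift (MvPowerSeries σ ℂ)) P f l) =
      P.eval b * lsum (fun l => b ^ l) fun l : ℕ => f l := by
  have hl := locFin_pow hb
  induction P using Polynomial.induction_on with
  | C c =>
    rw [Polynomial.aeval_C, Polynomial.eval_C]
    simp only [Module.algebraMap_end_apply, Pi.smul_apply]
    exact ⟨fun p hp => by rw [hf p hp, smul_zero], lsum_smul hl c _⟩
  | add P Q hP hQ =>
    simp only [map_add, LinearMap.add_apply, Pi.add_apply, Polynomial.eval_add]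
    exact ⟨fun p hp => by rw [hP.1 p hp, hQ.1 p hp, add_zero], by
      rw [lsum_add hl, hP.2, hQ.2, add_mul]⟩
  | monomial n c h =>
    have hX : Polynomial.aeval (shift (MvPowerSeries σ ℂ))
        (Polynomial.C c * Polynomial.X ^ (n + 1)) f =
        shift (MvPowerSeries σ ℂ) (Polynomial.aeval (shift (MvPowerSeries σ ℂ))
          (Polynomial.C c * Polynomial.X ^ n) f) := by
      rw [pow_succ, ← mul_assoc, mul_comm, map_mul, Polynomial.aeval_X, Module.End.mul_apply]
    rw [hX]
    refine ⟨fun p hp => h.1 (p - 1) (by omega), ?_⟩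
    have : (fun l : ℕ => shift (MvPowerSeries σ ℂ) (Polynomial.aeval (shift (MvPowerSeries σ ℂ))
        (Polynomial.C c * Polynomial.X ^ n) f) l) = shiftSeq fun l : ℕ =>
        Polynomial.aeval (shift (MvPowerSeries σ ℂ)) (Polynomial.C c * Polynomial.X ^ n) f l := by
      funext l
      rcases l with _ | l
      · exact h.1 _ (by simp)
      · rw [shift_apply, shiftSeq, Nat.cast_add, Nat.cast_one, add_sub_cancel_right]
    rw [this, lsum_pow_shift hb, h.2]
    simp only [Polynomial.eval_mul, Polynomial.eval_C, Polynomial.eval_pow, Polynomial.eval_X,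
      smul_eq_mul]
    ring

end Sequences

section Recursion

variable {N : ℕ} {ι : Type*} [DecidableEq ι] {y : ι → Series N} {r : ℤ → ℂ}

/-- The modes `⟨Φ φ_{-p} Z⟩` of a fermion field. -/
noncomputable def modes (Φ Z : MvPowerSeries (Fin N ⊕ ℕ) Op) (p : ℤ) : Series N :=
  V (Φ * (fop (-p) * Z))

/-- In generating-function form, passing `φ` through `V(y_j)` costs the factor `(S + y_j)/(S - y_j)`
in the shift `S`; here the denominators are on the other side. -/
theorem aeval_shift_modes (hy : ∀ j, constantCoeff (y j) = 0) (J : Finset ι)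
    (Z : MvPowerSeries (Fin N ⊕ ℕ) Op) :
    Polynomial.aeval (shift (Series N)) (∏ j ∈ J, (Polynomial.X - Polynomial.C (y j)))
        (modes (vprod y J) Z) =
      Polynomial.aeval (shift (Series N)) (∏ j ∈ J, (Polynomial.X + Polynomial.C (y j)))
        (modes 1 (vprod y J * Z)) := by
  induction J using Finset.induction_on generalizing Z with
  | empty => rw [vprod_empty, prod_empty, prod_empty, one_mul]
  | insert a J ha ih =>
    have h1 : Polynomial.aeval (shift (Series N)) (Polynomial.X - Polynomial.C (y a))
        (modes (vprod y (insert a J)) Z) =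
        Polynomial.aeval (shift (Series N)) (Polynomial.X + Polynomial.C (y a))
        (modes (vprod y J) (vop (y a) * Z)) := by
      funext p
      simp only [map_sub, map_add, Polynomial.aeval_X, Polynomial.aeval_C, LinearMap.sub_apply,
        LinearMap.add_apply, Module.algebraMap_end_apply, Pi.sub_apply, Pi.add_apply, shift_apply,
        Pi.smul_apply, smul_eq_mul, modes]
      rw [V_vprod_insert_mul_fop hy ha, show -(p - 1) - 1 = -p by ring]
      ring
    rw [prod_insert ha, mul_comm, map_mul, Module.End.mul_apply, h1, ← Module.End.mul_apply,
      ← map_mul, mul_comm, map_mul, Module.End.mul_apply, ih, ← Module.End.mul_apply, ← map_mul,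
      prod_insert ha, vprod_insert hy ha, ← mul_assoc, vprod_mul_vop hy]

theorem tauSet_insert (hy : ∀ j, constantCoeff (y j) = 0) {a : ι} {J : Finset ι} (ha : a ∉ J) :
    tauSet r y (insert a J) = 2 * lsum (fun l => (-y a) ^ l) fun l : ℕ =>
      modes 1 (vprod y J * (rzop * bop r)) l := by
  rw [tauSet, vprod_insert hy ha, mul_assoc, V_vop (hy a)]
  congr 1
  ext c
  refine finsum_congr fun l => ?_
  dsimp only
  rw [modes, one_mul, ← mul_assoc rzop, rzop_mul_vprod hy, mul_assoc, smul_eq_mul, smul_eq_mul,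
    ← mul_assoc, neg_pow (y a), mul_comm (y a ^ l)]

theorem modes_neg (Z : MvPowerSeries (Fin N ⊕ ℕ) Op) {p : ℤ} (hp : p < 0) : modes 1 Z p = 0 := by
  rw [modes, one_mul, V_fop_pos (by omega)]

theorem discr_mul_modes (hr : ∀ n : ℤ, r n = r (1 - n)) (hy : ∀ j, constantCoeff (y j) = 0)
    (hinj : Function.Injective y) {J : Finset ι} (hJ : Odd J.card) :
    discr y J • modes (vprod y J) (rzop * bop r) =
      ∑ j ∈ J, (cauchyNum y J j * tauSet r y (J.erase j)) •
        modes (vprod y {j}) (rzop * bop r) := by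
  funext p
  have h := defect_fop hr hy hinj hJ (-p)
  rw [defect_apply, sub_eq_zero] at h
  rw [Finset.sum_apply]
  simp only [Pi.smul_apply, smul_eq_mul, modes, vprod_singleton hy]
  exact h

/-- The mode identity is multiplied by `∏ (S - y_j)`, so that every `φ` stands to the left of the
vertex operators and its negative places vanish. Evaluation at `S = -y_a` then turns `φ` into
`V(y_a)`. -/
theorem discr_mul_tauSet_insert (hr : ∀ n : ℤ, r n = r (1 - n))
    (hy : ∀ j, constantCoeff (y j) = 0) (hinj : Function.Injective y) {a : ι} {J : Finset ι}
    (ha : a ∉ J) (hJ : Odd J.card) :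
    discr y J * ((∏ j ∈ J, (-y a + y j)) * tauSet r y (insert a J)) =
      ∑ j ∈ J, cauchyNum y J j * tauSet r y (J.erase j) *
        ((∏ k ∈ J.erase j, (-y a - y k)) * ((-y a + y j) * tauSet r y {a, j})) := by
  have hb : constantCoeff (-y a) = 0 := by rw [map_neg, hy a, neg_zero]
  have hl := locFin_pow hb
  set P := ∏ j ∈ J, (Polynomial.X - Polynomial.C (y j)) with hP
  have h1 := congrArg (Polynomial.aeval (shift (Series N)) P) (discr_mul_modes hr hy hinj hJ)
  rw [map_smul, aeval_shift_modes hy, map_sum] at h1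
  have h2 : ∀ j ∈ J, Polynomial.aeval (shift (Series N)) P
      ((cauchyNum y J j * tauSet r y (J.erase j)) • modes (vprod y {j}) (rzop * bop r)) =
      (cauchyNum y J j * tauSet r y (J.erase j)) •
      Polynomial.aeval (shift (Series N))
        ((∏ k ∈ J.erase j, (Polynomial.X - Polynomial.C (y k))) *
          (Polynomial.X + Polynomial.C (y j)))
        (modes 1 (vprod y {j} * (rzop * bop r))) := by
    intro j hj
    -- In the `j`-th summand only the factor `S - y_j` is consumed; the remaining ones stay as
    -- scalars after evaluation.
    have h3 := aeval_shift_modes hy {j} (rzop * bop r)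
    rw [prod_singleton, prod_singleton] at h3
    rw [map_smul, hP, ← mul_prod_erase _ _ hj, mul_comm (_ - _), map_mul, Module.End.mul_apply, h3,
      ← Module.End.mul_apply, ← map_mul]
  rw [sum_congr rfl h2] at h1
  have h4 := congrArg (fun f : ℤ → Series N =>
    2 * lsum (fun l => (-y a) ^ l) fun l : ℕ => f l) h1
  have hlsum : ∀ (s : Finset ι) (f : ι → ℕ → Series N),
      lsum (fun l => (-y a) ^ l) (fun l => ∑ j ∈ s, f j l) =
        ∑ j ∈ s, lsum (fun l => (-y a) ^ l) (f j) := by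
    intro s f
    induction s using Finset.induction_on with
    | empty =>
      simp only [sum_empty]
      rw [lsum_eq_single 0 fun _ _ => rfl, smul_zero]
    | insert b s hb ih =>
      simp only [sum_insert hb]
      rw [lsum_add hl, ih]
  simp only [Finset.sum_apply, Pi.smul_apply] at h4
  rw [lsum_smul hl, hlsum, mul_sum,
    (lsum_aeval_shift hb _ fun p hp => modes_neg _ hp).2] at h4
  have h5 : ∀ j ∈ J, 2 * lsum (fun l => (-y a) ^ l) (fun l : ℕ =>
        (cauchyNum y J j * tauSet r y (J.erase j)) • Polynomial.aeval (shift (Series N))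
        ((∏ k ∈ J.erase j, (Polynomial.X - Polynomial.C (y k))) *
          (Polynomial.X + Polynomial.C (y j)))
        (modes 1 (vprod y {j} * (rzop * bop r))) l) =
      cauchyNum y J j * tauSet r y (J.erase j) *
        ((∏ k ∈ J.erase j, (-y a - y k)) * ((-y a + y j) * tauSet r y {a, j})) := by
    intro j hj
    rw [lsum_smul hl, (lsum_aeval_shift hb _ fun p hp => modes_neg _ hp).2,
      tauSet_insert (J := {j}) hy (by rintro h; exact ha (mem_singleton.1 h ▸ hj))]
    simp only [Polynomial.eval_mul, Polynomial.eval_prod, Polynomial.eval_sub, Polynomial.eval_add,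
      Polynomial.eval_X, Polynomial.eval_C, smul_eq_mul]
    ring
  rw [sum_congr rfl h5] at h4
  rw [← h4, tauSet_insert hy ha]
  simp only [Polynomial.eval_prod, Polynomial.eval_add,
      Polynomial.eval_X, Polynomial.eval_C, smul_eq_mul]
  ring

/-- `(y_i - y_j) / (y_i + y_j)`. -/
noncomputable def yRatio (y : ι → Series N) (i j : ι) : SeriesField N :=
  (toField (y i) - toField (y j)) / (toField (y i) + toField (y j))

/-- Division by the discriminant and by `∏ (-y_a - y_j)` gives the recursion in terms of ratios, as
`(y_a - y_j)/(y_a + y_j) = (-y_a + y_j)/(-y_a - y_j)`. -/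
theorem toField_tauSet_insert (hr : ∀ n : ℤ, r n = r (1 - n))
    (hy : ∀ j, constantCoeff (y j) = 0) (hinj : Function.Injective y) {a : ι}
    {J : Finset ι} (ha : a ∉ J) (hJ : Odd J.card) (hadd : ∀ j ∈ J, y a + y j ≠ 0) :
    (∏ j ∈ J, yRatio y a j) * toField (tauSet r y (insert a J)) =
      ∑ j ∈ J, cauchyWeight y J j * toField (tauSet r y (J.erase j)) *
        (yRatio y a j * toField (tauSet r y {a, j})) := by
  have hadd' : ∀ j ∈ J, toField (y a) + toField (y j) ≠ 0 := fun j hj => by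
    rw [← map_add]
    exact (map_ne_zero_iff _ (IsFractionRing.injective (Series N) (SeriesField N))).2 (hadd j hj)
  have h := congrArg toField (discr_mul_tauSet_insert hr hy hinj ha hJ)
  simp only [map_mul, map_sum, map_prod, map_add, map_sub, map_neg] at h
  have hd := toField_discr_ne_zero hinj J
  have hp : ∏ j ∈ J, (-toField (y a) - toField (y j)) ≠ 0 := prod_ne_zero_iff.2 fun j hj h0 =>
    hadd' j hj (by linear_combination -h0)
  have hrat : ∀ j, yRatio y a j = (-toField (y a) + toField (y j)) / (-toField (y a) - toField (y j)) := by
    intro j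
    rw [yRatio, ← neg_div_neg_eq]
    congr 1 <;> ring
  apply mul_left_cancel₀ hp
  apply mul_left_cancel₀ hd
  have h1 : (∏ j ∈ J, (-toField (y a) - toField (y j))) * ∏ j ∈ J, yRatio y a j =
      ∏ j ∈ J, (-toField (y a) + toField (y j)) := by
    rw [← prod_mul_distrib]
    refine prod_congr rfl fun j hj => ?_
    rw [hrat, mul_div_cancel₀]
    exact fun h0 => hadd' j hj (by linear_combination -h0)
  rw [← mul_assoc (∏ j ∈ J, (-toField (y a) - toField (y j))), h1, h, mul_sum, mul_sum]
  refine sum_congr rfl fun j hj => ?_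
  have h2 : (-toField (y a) - toField (y j)) * yRatio y a j = -toField (y a) + toField (y j) := by
    rw [hrat, mul_div_cancel₀]
    exact fun h0 => hadd' j hj (by linear_combination -h0)
  rw [toField_cauchyNum hinj hj, ← mul_prod_erase J _ hj, ← h2]
  ring

end Recursion

end BKP

namespace BKP

open MvPowerSeries Finset

/-! ### Pfaffians -/

section Pfaffian

variable {K : Type*}

/-- The product of the entries of `ρ` above the diagonal. -/
def upperProd [CommMonoid K] {n : ℕ} (ρ : Fin n → Fin n → K) : K := ∏ i, ∏ j ∈ Ioi i, ρ i j

theorem upperProd_succ [CommMonoid K] {n : ℕ} (ρ : Fin (n + 1) → Fin (n + 1) → K) :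
    upperProd ρ = (∏ k : Fin n, ρ 0 k.succ) * upperProd fun i j => ρ i.succ j.succ := by
  rw [upperProd, Fin.prod_univ_succ, Fin.prod_Ioi_zero]
  simp only [Fin.prod_Ioi_succ]
  rfl

/-- Bringing `j` to the front reverses its order with the `j` earlier indices, and each reversal
costs one sign by antisymmetry. -/
theorem upperProd_succAbove [CommRing K] {n : ℕ} (ρ : Fin (n + 1) → Fin (n + 1) → K)
    (hρ : ∀ i j, i ≠ j → ρ i j = -ρ j i) (j : Fin (n + 1)) :
    upperProd ρ = (-1) ^ (j : ℕ) * (∏ k : Fin n, ρ j (j.succAbove k)) *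
      upperProd fun a b => ρ (j.succAbove a) (j.succAbove b) := by
  induction n with
  | zero =>
    obtain rfl : j = 0 := Subsingleton.elim (α := Fin 1) _ _
    rw [upperProd_succ]
    simp
  | succ n ih =>
    refine Fin.cases ?_ (fun j => ?_) j
    · rw [upperProd_succ]
      simp
    · rw [upperProd_succ, ih (fun a b => ρ a.succ b.succ)
        (fun a b hab => hρ _ _ fun h => hab (Fin.succ_injective _ h)) j,
        Fin.prod_univ_succAbove _ j, Fin.prod_univ_succ (n := n),
        upperProd_succ fun a b => ρ (j.succ.succAbove a) (j.succ.succAbove b)]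
      simp only [Fin.succ_succAbove_zero, Fin.succ_succAbove_succ, Fin.val_succ]
      rw [hρ 0 j.succ (Fin.succ_ne_zero j).symm]
      ring

theorem pfaffian_succ_succ [CommRing K] (m : ℕ) (Q : Matrix (Fin (m + 2)) (Fin (m + 2)) K) :
    pfaffian (m + 2) Q = ∑ j : Fin (m + 1), (-1) ^ (j : ℕ) * Q 0 j.succ *
      pfaffian m (Q.submatrix (fun a => (j.succAbove a).succ) fun a => (j.succAbove a).succ) := by
  rw [pfaffian]

theorem erase_univ_eq {n : ℕ} (j : Fin (n + 1)) :
    (univ : Finset (Fin (n + 1))).erase j = univ.map (Fin.succAboveEmb j) := by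
  refine Finset.ext fun a => ?_
  simp [Fin.exists_succAbove_eq_iff]

theorem pfaffian_scale_succ_succ [CommRing K] {M k : ℕ} (c : K)
    (ih : ∀ (s : Fin M → K) (Q : Matrix (Fin M) (Fin M) K),
      pfaffian M (Matrix.of fun a b => c * (s a * s b * Q a b)) = c ^ k * (∏ a, s a) * pfaffian M Q)
    (s : Fin (M + 2) → K) (Q : Matrix (Fin (M + 2)) (Fin (M + 2)) K) :
    pfaffian (M + 2) (Matrix.of fun a b => c * (s a * s b * Q a b)) =
      c ^ (k + 1) * (∏ a, s a) * pfaffian (M + 2) Q := by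
  rw [pfaffian_succ_succ, pfaffian_succ_succ, mul_sum]
  refine sum_congr rfl fun j _ => ?_
  have h := ih (fun a => s (j.succAbove a).succ)
    (Q.submatrix (fun a => (j.succAbove a).succ) fun a => (j.succAbove a).succ)
  have e : (Matrix.submatrix (Matrix.of fun a b => c * (s a * s b * Q a b))
      (fun a => (j.succAbove a).succ) fun a => (j.succAbove a).succ) = Matrix.of fun a b : Fin M =>
      c * (s (j.succAbove a).succ * s (j.succAbove b).succ *
        (Q.submatrix (fun a => (j.succAbove a).succ) fun a => (j.succAbove a).succ) a b) := rfl
  rw [e, h, Matrix.of_apply, Fin.prod_univ_succ, Fin.prod_univ_succAbove _ j]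
  ring

theorem pfaffian_scale [CommRing K] (m : ℕ) (c : K) (s : Fin (2 * m) → K)
    (Q : Matrix (Fin (2 * m)) (Fin (2 * m)) K) :
    pfaffian (2 * m) (Matrix.of fun a b => c * (s a * s b * Q a b)) =
      c ^ m * (∏ a, s a) * pfaffian (2 * m) Q := by
  induction m with
  | zero => simp [pfaffian]
  | succ m ih => exact pfaffian_scale_succ_succ c ih s Q

end Pfaffian

section Wick

variable {N : ℕ} {r : ℤ → ℂ}

theorem tauSet_map {ι κ : Type*} (r : ℤ → ℂ) (y : ι → Series N) (e : κ ↪ ι)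
    (J : Finset κ) : tauSet r (fun k => y (e k)) J = tauSet r y (J.map e) := by
  rw [tauSet, tauSet, vprod, vprod, sum_map]

/-- The matrix of normalized two-point functions. -/
noncomputable def pairMatrix (r : ℤ → ℂ) {M : ℕ} (y : Fin M → Series N) :
    Matrix (Fin M) (Fin M) (SeriesField N) :=
  fun a b => yRatio y a b * toField (tauSet r y {a, b})

/-- The Cauchy weight is the inverse of the product of the ratios in row `j`, so it deletes the
index `j`. The sign left over is that of the Pfaffian expansion. -/
theorem upperProd_mul_cauchyWeight {M : ℕ} {y : Fin (M + 1) → Series N}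
    (hinj : Function.Injective y) (hadd : ∀ a b, a ≠ b → y a + y b ≠ 0) (j : Fin (M + 1)) :
    upperProd (yRatio y) * cauchyWeight y univ j =
      (-1) ^ (j : ℕ) * upperProd (yRatio fun k => y (j.succAbove k)) := by
  have hadd' : ∀ a b, a ≠ b → toField (y a) + toField (y b) ≠ 0 := fun a b h => by
    rw [← map_add]
    exact (map_ne_zero_iff _ (IsFractionRing.injective (Series N) (SeriesField N))).2 (hadd a b h)
  have hw : cauchyWeight y univ j = ∏ k : Fin M, (toField (y j) + toField (y (j.succAbove k))) /
      (toField (y j) - toField (y (j.succAbove k))) := by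
    rw [cauchyWeight, erase_univ_eq, prod_map]
    rfl
  rw [upperProd_succAbove _ _ j, hw, mul_right_comm, mul_assoc ((-1) ^ (j : ℕ)),
    ← prod_mul_distrib, prod_eq_one, mul_one]
  · rfl
  · intro k _
    have h1 := hadd' _ _ (Fin.succAbove_ne j k).symm
    have h2 := toField_sub_ne_zero hinj (Fin.succAbove_ne j k).symm
    rw [yRatio]
    field_simp
  · intro a b h
    rw [yRatio, yRatio, add_comm (toField (y b))]
    ring

theorem upperProd_mul_tauSet_succ (hr : ∀ n : ℤ, r n = r (1 - n)) {M : ℕ} (hM : Even M)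
    (ih : ∀ y : Fin M → Series N, (∀ j, constantCoeff (y j) = 0) → Function.Injective y →
      (∀ a b, a ≠ b → y a + y b ≠ 0) →
      upperProd (yRatio y) * toField (tauSet r y univ) = pfaffian M (pairMatrix r y))
    {y : Fin (M + 2) → Series N} (hy : ∀ j, constantCoeff (y j) = 0)
    (hinj : Function.Injective y) (hadd : ∀ a b, a ≠ b → y a + y b ≠ 0) :
    upperProd (yRatio y) * toField (tauSet r y univ) = pfaffian (M + 2) (pairMatrix r y) := by
  set J : Finset (Fin (M + 2)) := univ.map (Fin.succEmb (M + 1)) with hJ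
  have h0 : (0 : Fin (M + 2)) ∉ J := by simp [hJ, Fin.succ_ne_zero]
  have hins : insert 0 J = univ := by
    rw [hJ]
    ext a
    refine Fin.cases ?_ (fun a => ?_) a <;> simp
  have hcard : Odd J.card := by
    rw [hJ, card_map, card_univ, Fintype.card_fin]
    exact hM.add_one
  have key := toField_tauSet_insert hr hy hinj h0 hcard fun j hj =>
    hadd 0 j (by rintro rfl; exact h0 hj)
  rw [hins, hJ, prod_map, sum_map] at key
  -- `A` is the product of the ratios in row `0`; the recursion absorbs it, and the product over the
  -- remaining rows is distributed over the sum.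
  obtain ⟨A, hA, hA'⟩ : ∃ A : SeriesField N, upperProd (yRatio y) =
      A * upperProd (fun i k => yRatio y (Fin.succ i) (Fin.succ k)) ∧
      A * toField (tauSet r y univ) = _ := ⟨_, upperProd_succ _, key⟩
  rw [hA, mul_comm A, mul_assoc, hA', pfaffian_succ_succ, mul_sum]
  refine sum_congr rfl fun j _ => ?_
  set y' : Fin (M + 1) → Series N := fun k => y k.succ with hy'
  have hw : cauchyWeight y (univ.map (Fin.succEmb (M + 1))) (Fin.succEmb (M + 1) j) =
      cauchyWeight y' univ j := by
    rw [cauchyWeight, cauchyWeight, ← map_erase, prod_map]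
    rfl
  have hins' : (univ.map (Fin.succEmb (M + 1))).erase (Fin.succEmb (M + 1) j) =
      univ.map ((Fin.succAboveEmb j).trans (Fin.succEmb (M + 1))) := by
    rw [← map_erase, erase_univ_eq, map_map]
  have h2 := upperProd_mul_cauchyWeight (y := y')
    (fun a b h => Fin.succ_injective _ (hinj h)) (fun a b h => hadd _ _ fun h' =>
      h (Fin.succ_injective _ h')) j
  have h3 := ih (fun k => y' (j.succAbove k)) (fun _ => hy _)
    (fun a b h => Fin.succAbove_right_injective (Fin.succ_injective _ (hinj h)))
    (fun a b h => hadd _ _ fun h' => h (Fin.succAbove_right_injective (Fin.succ_injective _ h')))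
  have h4 : toField (tauSet r y (univ.map ((Fin.succAboveEmb j).trans
      (Fin.succEmb (M + 1))))) = toField (tauSet r (fun k => y' (j.succAbove k)) univ) := by
    rw [← tauSet_map]
    rfl
  have h5 : (pairMatrix r y).submatrix (fun a => (j.succAbove a).succ)
      (fun a => (j.succAbove a).succ) = pairMatrix r fun k => y' (j.succAbove k) := by
    ext a b
    have h : tauSet r (fun k => y' (j.succAbove k)) {a, b} =
        tauSet r y {(j.succAbove a).succ, (j.succAbove b).succ} := by
      have h := tauSet_map r y ((Fin.succAboveEmb j).trans (Fin.succEmb (M + 1))) {a, b}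
      rw [map_insert, map_singleton] at h
      exact h
    exact congrArg (fun u => yRatio y (j.succAbove a).succ (j.succAbove b).succ * toField u) h.symm
  have h6 : pairMatrix r y 0 j.succ =
    yRatio y 0 j.succ * toField (tauSet r y {0, j.succ}) := rfl
  have h7 : upperProd (fun i k => yRatio y (Fin.succ i) (Fin.succ k)) = upperProd (yRatio y') := rfl
  have h8 : Fin.succEmb (M + 1) j = j.succ := rfl
  rw [hw, hins', h4, h5, ← h3, h6, h7, h8]
  linear_combination toField (tauSet r (fun k => y' (j.succAbove k)) univ) *
    (yRatio y 0 j.succ * toField (tauSet r y {0, j.succ})) * h2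
theorem upperProd_mul_tauSet (hr : ∀ n : ℤ, r n = r (1 - n)) (m : ℕ) (y : Fin (2 * m) → Series N)
    (hy : ∀ j, constantCoeff (y j) = 0) (hinj : Function.Injective y)
    (hadd : ∀ a b, a ≠ b → y a + y b ≠ 0) :
    upperProd (yRatio y) * toField (tauSet r y univ) = pfaffian (2 * m) (pairMatrix r y) := by
  induction m with
  | zero =>
    change upperProd (yRatio (y : Fin 0 → Series N)) * toField (tauSet r y (∅ : Finset (Fin 0))) = _
    rw [tauSet_empty]
    simp [upperProd, pfaffian]
  | succ m ih => exact upperProd_mul_tauSet_succ hr (even_two_mul m) ih hy hinj hadd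

end Wick

end BKP

namespace BKP

open MvPowerSeries Finset

/-! ### The tau function as the expectation value of vertex operators -/

section Bridge

theorem finsum_comp_injective {α β M : Type*} [AddCommMonoid M] {g : β → α}
    (hg : Function.Injective g) {f : α → M} (hf : ∀ a, a ∉ Set.range g → f a = 0) :
    ∑ᶠ b, f (g b) = ∑ᶠ a, f a := by
  rw [← finsum_mem_range hg, ← finsum_mem_univ f]
  refine finsum_mem_inter_support_eq f _ _ ?_
  ext a
  simp only [Set.mem_inter_iff, Set.mem_univ, true_and, and_iff_right_iff_imp]
  exact fun ha => by_contra fun h => ha (hf a h)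

variable {κ σ A : Type*} [Ring A] [Algebra ℂ A]

theorem coeff_linearSeries_eq_finsum (h : σ → A) (c : σ →₀ ℕ) :
    coeff c (linearSeries h) = ∑ᶠ s, coeff c (X s : MvPowerSeries σ ℂ) • h s := by
  classical
  by_cases hc : c.degree = 1
  · obtain ⟨s, rfl⟩ := exists_eq_single_of_degree_eq_one hc
    rw [coeff_linearSeries, finsum_eq_single _ s]
    · rw [coeff_X, if_pos rfl, one_smul]
    · intro s' hs'
      rw [coeff_X, if_neg, zero_smul]
      exact fun h => hs' (Finsupp.single_left_injective one_ne_zero h).symm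
  · rw [coeff_linearSeries_of_degree_ne _ hc, finsum_eq_zero_of_forall_eq_zero]
    intro s
    rw [coeff_X, if_neg, zero_smul]
    rintro rfl
    exact hc (Finsupp.degree_single _ _)

theorem hasSubst_X_comp {e : κ → σ} (he : Function.Injective e) :
    HasSubst fun s => (X (e s) : MvPowerSeries σ ℂ) where
  const_coeff s := by
    rw [constantCoeff_X]
    exact IsNilpotent.zero
  coeff_zero d := by
    classical
    refine (Set.Subsingleton.finite fun a ha b hb => ?_ :
      {s | ¬ coeff d (X (e s) : MvPowerSeries σ ℂ) = 0}.Finite)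
    rw [Set.mem_ofPred_eq, coeff_X] at ha hb
    have ha' := (ite_ne_right_iff.1 ha).1
    have hb' := (ite_ne_right_iff.1 hb).1
    exact he (Finsupp.single_left_injective one_ne_zero (ha'.symm.trans hb'))

theorem monomialAt_X_comp (e : κ → σ) (d : κ →₀ ℕ) :
    monomialAt (fun s => (X (e s) : MvPowerSeries σ ℂ)) d = monomial (d.mapDomain e) 1 := by
  induction d using Finsupp.induction_linear with
  | zero => rw [monomialAt_zero, Finsupp.mapDomain_zero]; rfl
  | add f g hf hg =>
    rw [monomialAt_add, hf, hg, Finsupp.mapDomain_add, monomial_mul_monomial, one_mul]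
  | single s n => rw [monomialAt_single, Finsupp.mapDomain_single, X_pow_eq]

theorem coeff_substOp_X_comp {e : κ → σ} (he : Function.Injective e) (G : MvPowerSeries κ A)
    (d : κ →₀ ℕ) : coeff (d.mapDomain e) (substOp (fun s => (X (e s) : MvPowerSeries σ ℂ)) G) =
      coeff d G := by
  classical
  refine (finsum_eq_single _ d fun d' hd' => ?_).trans ?_
  · rw [monomialAt_X_comp, coeff_monomial, if_neg, zero_smul]
    exact fun h => hd' (Finsupp.mapDomain_injective he h).symm
  · rw [monomialAt_X_comp, coeff_monomial, if_pos rfl, one_smul]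

theorem coeff_substOp_X_comp_eq_zero {e : κ → σ} (G : MvPowerSeries κ A) {c : σ →₀ ℕ}
    (h : ∀ d : κ →₀ ℕ, c ≠ d.mapDomain e) :
    coeff c (substOp (fun s => (X (e s) : MvPowerSeries σ ℂ)) G) = 0 := by
  classical
  refine finsum_eq_zero_of_forall_eq_zero fun d => ?_
  rw [monomialAt_X_comp, coeff_monomial, if_neg (h d), zero_smul]

/-- The two factors involve disjoint sets of variables, so only one splitting of the exponent
contributes. -/
theorem coeff_mul_substOp_X (G G' : MvPowerSeries ℕ A) (d : ℕ ⊕ ℕ →₀ ℕ) :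
    coeff d (substOp (fun s => (X (Sum.inl s) : MvPowerSeries (ℕ ⊕ ℕ) ℂ)) G *
      substOp (fun s => (X (Sum.inr s) : MvPowerSeries (ℕ ⊕ ℕ) ℂ)) G') =
    coeff (Finsupp.sumFinsuppEquivProdFinsupp d).1 G *
      coeff (Finsupp.sumFinsuppEquivProdFinsupp d).2 G' := by
  classical
  obtain ⟨⟨d₁, d₂⟩, rfl⟩ := Finsupp.sumFinsuppEquivProdFinsupp.symm.surjective d
  have hl : ∀ (d : ℕ →₀ ℕ) (n : ℕ), d.mapDomain (Sum.inl : ℕ → ℕ ⊕ ℕ) (Sum.inr n) = 0 := fun d n =>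
    Finsupp.mapDomain_of_notMem_range _ _ (by simp)
  have hr : ∀ (d : ℕ →₀ ℕ) (n : ℕ), d.mapDomain (Sum.inr : ℕ → ℕ ⊕ ℕ) (Sum.inl n) = 0 := fun d n =>
    Finsupp.mapDomain_of_notMem_range _ _ (by simp)
  have hdec : Finsupp.sumFinsuppEquivProdFinsupp.symm (d₁, d₂) =
      d₁.mapDomain (Sum.inl : ℕ → ℕ ⊕ ℕ) + d₂.mapDomain (Sum.inr : ℕ → ℕ ⊕ ℕ) := by
    ext (n | n)
    · rw [Finsupp.add_apply, hr, Finsupp.mapDomain_apply Sum.inl_injective]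
      simp
    · rw [Finsupp.add_apply, hl, Finsupp.mapDomain_apply Sum.inr_injective]
      simp
  rw [Equiv.apply_symm_apply, hdec, coeff_mul, Finset.sum_eq_single
    (d₁.mapDomain (Sum.inl : ℕ → ℕ ⊕ ℕ), d₂.mapDomain (Sum.inr : ℕ → ℕ ⊕ ℕ))]
  · rw [coeff_substOp_X_comp Sum.inl_injective, coeff_substOp_X_comp Sum.inr_injective]
  · rintro ⟨p, q⟩ hp hne
    rw [HasAntidiagonal.mem_antidiagonal] at hp
    by_cases h1 : ∃ d : ℕ →₀ ℕ, p = d.mapDomain Sum.inl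
    · by_cases h2 : ∃ d : ℕ →₀ ℕ, q = d.mapDomain Sum.inr
      · exfalso
        obtain ⟨e₁, rfl⟩ := h1
        obtain ⟨e₂, rfl⟩ := h2
        have h1 : e₁ = d₁ := by
          ext n
          have := DFunLike.congr_fun hp (Sum.inl n)
          simpa [hr, Finsupp.mapDomain_apply Sum.inl_injective] using this
        have h2 : e₂ = d₂ := by
          ext n
          have := DFunLike.congr_fun hp (Sum.inr n)
          simpa [hl, Finsupp.mapDomain_apply Sum.inr_injective] using this
        exact hne (by rw [h1, h2])
      · push Not at h2
        rw [coeff_substOp_X_comp_eq_zero (e := Sum.inr) _ h2, mul_zero]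
    · push Not at h1
      rw [coeff_substOp_X_comp_eq_zero (e := Sum.inl) _ h1, zero_mul]
  · intro h
    refine absurd ?_ h
    rw [HasAntidiagonal.mem_antidiagonal]

theorem ham_eq (j : ℕ) : ham (2 * j + 1) = hamiltonian (2 * j + 1) := by
  rw [ham]
  push_cast
  rfl

/-- With both exponentials in one operator-valued series ring, substitution of the times can be
carried out before the expectation value is taken. -/
theorem tau_eq (r : ℤ → ℂ) : tau r = coeffMap ev₀
    (substOp (fun s => (X (Sum.inl s) : MvPowerSeries (ℕ ⊕ ℕ) ℂ))
        (formalExp (linearSeries fun j : ℕ => ham (2 * j + 1))) *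
      substOp (fun s => (X (Sum.inr s) : MvPowerSeries (ℕ ⊕ ℕ) ℂ))
        (formalExp (linearSeries fun j : ℕ => negSym r (2 * j + 1)))) := by
  ext d
  rw [coeff_coeffMap, coeff_mul_substOp_X, funext ham_eq]
  rfl

theorem substOp_X_linearSeries {e : κ → σ} (he : Function.Injective e)
    (h : κ → A) (g : σ → A) (hg : ∀ s, g (e s) = h s) (hg' : ∀ s, s ∉ Set.range e → g s = 0) :
    substOp (fun s => (X (e s) : MvPowerSeries σ ℂ)) (linearSeries h) = linearSeries g := by
  ext c
  rw [coeff_substOp_linearSeries, coeff_linearSeries_eq_finsum]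
  simp only [← hg]
  exact finsum_comp_injective he (f := fun s => coeff c (X s : MvPowerSeries σ ℂ) • g s)
    fun s hs => by rw [hg' s hs, smul_zero]

variable {N : ℕ}

theorem substOp_linearSeries_inr {M : ℕ} (r : ℤ → ℂ) (v : Fin M → Fin N) :
    substOp (Sum.elim (xTimes v) (tStar N))
      (linearSeries (Sum.elim (fun _ : ℕ => (0 : Op)) fun j : ℕ => negSym r (2 * j + 1))) =
      bser r := by
  ext c
  rw [coeff_substOp_linearSeries, bser, coeff_linearSeries_eq_finsum,
    ← finsum_comp_injective (Sum.inr_injective (α := ℕ)),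
    ← finsum_comp_injective (Sum.inr_injective (α := Fin N))]
  · rfl
  · rintro (s | s) hs
    · simp
    · exact absurd ⟨s, rfl⟩ hs
  · rintro (s | s) hs
    · simp
    · exact absurd ⟨s, rfl⟩ hs

theorem xTimes_eq {M : ℕ} (v : Fin M → Fin N) (j : ℕ) :
    xTimes v j = ∑ a, (2 / (2 * j + 1 : ℕ) : ℂ) • xVar (v a) ^ (2 * j + 1) := by
  rw [xTimes, smul_sum]
  refine sum_congr rfl fun a _ => ?_
  rw [Odd.neg_pow ⟨j, rfl⟩, sub_neg_eq_add, ← two_smul ℂ, smul_smul]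
  congr 1
  push_cast
  ring

theorem constantCoeff_xVar (i : Fin N) : constantCoeff (xVar i : Series N) = 0 :=
  constantCoeff_X _

theorem substOp_linearSeries_inl {M : ℕ} (v : Fin M → Fin N) :
    substOp (Sum.elim (xTimes v) (tStar N))
      (linearSeries (Sum.elim (fun j : ℕ => ham (2 * j + 1)) fun _ : ℕ => (0 : Op))) =
      ∑ a, vlog (xVar (v a)) := by
  ext c
  have hinj : Function.Injective fun j : ℕ => 2 * j + 1 := fun i j h => by
    dsimp only at h
    omega
  have h1 : ∀ a, coeff c (vlog (xVar (v a))) = ∑ᶠ j : ℕ, coeff c (xVar (v a) ^ (2 * j + 1)) •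
      ((2 / (2 * j + 1 : ℕ) : ℂ) • ham (2 * j + 1)) := by
    intro a
    rw [vlog, coeff_substOp_unit, ← finsum_comp_injective hinj]
    · refine finsum_congr fun j => ?_
      rw [coeff_vertexLog, if_pos ⟨j, rfl⟩]
    · intro l hl
      rw [coeff_vertexLog, if_neg, smul_zero]
      rintro ⟨j, rfl⟩
      exact hl ⟨j, rfl⟩
  rw [coeff_substOp_linearSeries, ← finsum_comp_injective (Sum.inl_injective (β := ℕ)), map_sum,
    sum_congr rfl fun a _ => h1 a, ← finsum_sum_comm]
  · refine finsum_congr fun j => ?_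
    rw [Sum.elim_inl, Sum.elim_inl, xTimes_eq, map_sum, sum_smul]
    refine sum_congr rfl fun a _ => ?_
    rw [LinearMap.map_smul_of_tower, smul_smul, smul_eq_mul, mul_comm]
  · intro a _
    refine (Set.finite_Iic c.degree).subset fun j hj => ?_
    by_contra h
    refine hj ?_
    dsimp only
    rw [coeff_pow_eq_zero (constantCoeff_xVar _), zero_smul]
    rw [Set.mem_Iic] at h
    omega
  · rintro (s | s) hs
    · exact absurd ⟨s, rfl⟩ hs
    · simp

theorem tauX_eq (r : ℤ → ℂ) {M : ℕ} (v : Fin M → Fin N) :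
    tauX r v = tauSet r (fun a => xVar (v a)) univ := by
  have ha := hasSubst_times (N := N) v
  have hl : substOp (fun s => (X (Sum.inl s) : MvPowerSeries (ℕ ⊕ ℕ) ℂ))
      (linearSeries fun j : ℕ => ham (2 * j + 1)) =
      linearSeries (Sum.elim (fun j : ℕ => ham (2 * j + 1)) fun _ : ℕ => (0 : Op)) :=
    substOp_X_linearSeries Sum.inl_injective _ _ (fun _ => rfl) (by rintro (s | s) hs <;> simp_all)
  have hr : substOp (fun s => (X (Sum.inr s) : MvPowerSeries (ℕ ⊕ ℕ) ℂ))
      (linearSeries fun j : ℕ => negSym r (2 * j + 1)) =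
      linearSeries (Sum.elim (fun _ : ℕ => (0 : Op)) fun j : ℕ => negSym r (2 * j + 1)) :=
    substOp_X_linearSeries Sum.inr_injective _ _ (fun _ => rfl) (by rintro (s | s) hs <;> simp_all)
  rw [tauX, tau_eq, subst_coeffMap ha, substOp_mul ha,
    substOp_formalExp (hasSubst_X_comp Sum.inl_injective) (constantCoeff_linearSeries _),
    substOp_formalExp (hasSubst_X_comp Sum.inr_injective) (constantCoeff_linearSeries _),
    hl, hr, substOp_formalExp ha (constantCoeff_linearSeries _),
    substOp_formalExp ha (constantCoeff_linearSeries _), substOp_linearSeries_inl,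
    substOp_linearSeries_inr]
  rfl

end Bridge

end BKP

namespace BKP

open MvPowerSeries Finset

/-! ### Pfaffian formulas for the tau function -/

section PfaffianFormulas

variable {N : ℕ} {r : ℤ → ℂ}

theorem toField_ne_zero {f : Series N} (h : f ≠ 0) : toField f ≠ 0 :=
  (map_ne_zero_iff _ (IsFractionRing.injective (Series N) (SeriesField N))).2 h

theorem two_ne_zero_seriesField : (2 : SeriesField N) ≠ 0 := by
  have h : (algebraMap ℂ (Series N)) 2 ≠ 0 :=
    (map_ne_zero_iff _ (algebraMap ℂ (Series N)).injective).2 two_ne_zero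
  have h2 := toField_ne_zero h
  rwa [map_ofNat, map_ofNat] at h2

/-- The weights `s` let one statement serve both parities: they are all `1` for even `N`, and the
adjoined variable has weight `2` for odd `N`. -/
theorem pfaffian_pairMatrix (hr : ∀ n : ℤ, r n = r (1 - n)) {M : ℕ} (hM : Even M)
    {y : Fin M → Series N} (hy : ∀ j, constantCoeff (y j) = 0) (hinj : Function.Injective y)
    (hadd : ∀ a b, a ≠ b → y a + y b ≠ 0) (s : Fin M → SeriesField N) :
    2 ^ (M / 2) * pfaffian M (Matrix.of fun a b => (1 / 2) * (s a * s b * pairMatrix r y a b)) =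
      (∏ a, s a) * (upperProd (yRatio y) * toField (tauSet r y univ)) := by
  obtain ⟨m, rfl⟩ := even_iff_exists_two_mul.1 hM
  rw [pfaffian_scale, upperProd_mul_tauSet hr m y hy hinj hadd, Nat.mul_div_cancel_left _ two_pos,
    ← mul_assoc, ← mul_assoc, ← mul_pow, mul_one_div_cancel two_ne_zero_seriesField, one_pow, one_mul]

theorem coeff_xVar_self (i : Fin N) : coeff (Finsupp.single (Sum.inl i) 1) (xVar i) = 1 :=
  coeff_index_single_self_X _

theorem coeff_xVar_of_ne {i k : Fin N} (h : i ≠ k) :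
    coeff (Finsupp.single (Sum.inl i) 1) (xVar k) = 0 := by
  classical
  rw [xVar, coeff_index_single_X, if_neg]
  exact fun h' => h (Sum.inl_injective h')

theorem xVar_injective : Function.Injective (xVar : Fin N → Series N) := fun i j h => by
  by_contra hij
  have h1 := coeff_xVar_self i
  rw [h, coeff_xVar_of_ne hij] at h1
  exact zero_ne_one h1

theorem xVar_ne_zero (i : Fin N) : (xVar i : Series N) ≠ 0 := fun h => by
  have := coeff_xVar_self i
  rw [h, map_zero] at this
  exact zero_ne_one this

theorem xVar_add_ne_zero {i k : Fin N} (h : i ≠ k) : (xVar i + xVar k : Series N) ≠ 0 := fun h' => by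
  have := congrArg (coeff (Finsupp.single (Sum.inl i) 1)) h'
  rw [map_add, coeff_xVar_self, coeff_xVar_of_ne h, map_zero, add_zero] at this
  exact one_ne_zero this

theorem yRatio_xVar (i k : Fin N) : yRatio xVar i k = ratio i k := by
  rw [yRatio, ratio, map_sub, map_add]

theorem Delta_eq : Delta N = upperProd (yRatio (xVar : Fin N → Series N)) := by
  rw [Delta, upperProd]
  simp only [yRatio_xVar]

theorem Delta_ne_zero : Delta N ≠ 0 := by
  rw [Delta_eq, upperProd]
  refine prod_ne_zero_iff.2 fun i _ => prod_ne_zero_iff.2 fun j hj => ?_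
  have hij : i ≠ j := (mem_Ioi.1 hj).ne
  refine div_ne_zero (toField_sub_ne_zero xVar_injective hij) ?_
  rw [← map_add]
  exact toField_ne_zero (xVar_add_ne_zero hij)

theorem tauX_univ (r : ℤ → ℂ) : tauX r (id : Fin N → Fin N) = tauSet r xVar univ := tauX_eq r id

theorem tauX_pair (r : ℤ → ℂ) {i k : Fin N} (h : i ≠ k) :
    tauX r ![i, k] = tauSet r xVar {i, k} := by
  rw [tauX_eq, tauSet, tauSet, vprod, vprod, Fin.sum_univ_two, sum_pair h]
  rfl

theorem tauX_single (r : ℤ → ℂ) (i : Fin N) : tauX r ![i] = tauSet r xVar {i} := by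
  rw [tauX_eq, tauSet, tauSet, vprod, vprod, Fin.sum_univ_one, sum_singleton]
  rfl

theorem yRatio_self {ι : Type*} (y : ι → Series N) (i : ι) : yRatio y i i = 0 := by
  rw [yRatio, sub_self, zero_div]

theorem matR_eq (r : ℤ → ℂ) (i k : Fin N) :
    matR r N i k = (1 / 2) * pairMatrix r xVar i k := by
  rw [matR, pairMatrix, yRatio_xVar, mul_assoc]
  by_cases h : i = k
  · rw [h, ← yRatio_xVar, yRatio_self, zero_mul, zero_mul]
  · rw [tauX_pair r h]

theorem tauX_even (hr : ∀ n : ℤ, r n = r (1 - n)) (hN : Even N) :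
    toField (tauX r (id : Fin N → Fin N)) = 2 ^ (N / 2) * pfaffian N (matR r N) / Delta N := by
  have h := pfaffian_pairMatrix hr hN constantCoeff_xVar xVar_injective
    (fun a b hab => xVar_add_ne_zero hab) fun _ => 1
  have hm : matR r N = Matrix.of fun a b => (1 / 2) * (1 * 1 * pairMatrix r xVar a b) := by
    ext a b
    rw [matR_eq, Matrix.of_apply, one_mul, one_mul]
  rw [hm, h, prod_const_one, one_mul, ← Delta_eq, mul_div_cancel_left₀ _ Delta_ne_zero, tauX_univ]

/-! ### Odd `N`: adjoining the variable `0`. -/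

/-- The variables `x_1, …, x_N, 0`. -/
noncomputable def xZero (N : ℕ) (a : Fin (N + 1)) : Series N :=
  Fin.lastCases (motive := fun _ => Series N) 0 (fun i => xVar i) a

theorem xZero_last : xZero N (Fin.last N) = 0 := Fin.lastCases_last

theorem xZero_castSucc (i : Fin N) : xZero N i.castSucc = xVar i := Fin.lastCases_castSucc _

theorem constantCoeff_xZero (a : Fin (N + 1)) : constantCoeff (xZero N a) = 0 := by
  refine Fin.lastCases ?_ (fun i => ?_) a
  · rw [xZero_last, map_zero]
  · rw [xZero_castSucc, constantCoeff_xVar]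

theorem xZero_injective : Function.Injective (xZero N) := by
  intro a
  refine Fin.lastCases (fun b => ?_) (fun i b => ?_) a <;>
    refine Fin.lastCases (fun h => ?_) (fun j h => ?_) b
  · rfl
  · rw [xZero_last, xZero_castSucc] at h
    exact absurd h.symm (xVar_ne_zero j)
  · rw [xZero_last, xZero_castSucc] at h
    exact absurd h (xVar_ne_zero i)
  · rw [xZero_castSucc, xZero_castSucc] at h
    rw [xVar_injective h]

theorem xZero_add_ne_zero {a b : Fin (N + 1)} : a ≠ b → xZero N a + xZero N b ≠ 0 := by
  refine Fin.lastCases ?_ (fun i => ?_) a <;> refine Fin.lastCases ?_ (fun j => ?_) b <;> intro h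
  · exact absurd rfl h
  · rw [xZero_last, xZero_castSucc, zero_add]
    exact xVar_ne_zero j
  · rw [xZero_last, xZero_castSucc, add_zero]
    exact xVar_ne_zero i
  · rw [xZero_castSucc, xZero_castSucc]
    exact xVar_add_ne_zero fun h' => h (by rw [h'])

theorem tauSet_insert_of_eq_zero {ι : Type*} [DecidableEq ι] {y : ι → Series N}
    (hy : ∀ j, constantCoeff (y j) = 0) {a : ι} (h0 : y a = 0) {J : Finset ι} (ha : a ∉ J) :
    tauSet r y (insert a J) = tauSet r y J := by
  rw [tauSet, vprod_insert hy ha, h0, vop_zero, one_mul, tauSet]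

theorem tauSet_xZero_map (J : Finset (Fin N)) :
    tauSet r (xZero N) (J.map Fin.castSuccEmb) = tauSet r xVar J := by
  rw [← tauSet_map]
  congr 1
  funext i
  exact xZero_castSucc i

theorem yRatio_xZero_last (i : Fin N) : yRatio (xZero N) (Fin.last N) i.castSucc = -1 := by
  have h := toField_ne_zero (xVar_ne_zero i)
  rw [yRatio, xZero_last, xZero_castSucc, map_zero, zero_sub, zero_add, div_eq_iff h, neg_one_mul]

theorem yRatio_last_xZero (i : Fin N) : yRatio (xZero N) i.castSucc (Fin.last N) = 1 := by
  have h := toField_ne_zero (xVar_ne_zero i)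
  rw [yRatio, xZero_last, xZero_castSucc, map_zero, sub_zero, add_zero, div_self h]

theorem yRatio_xZero_castSucc (i k : Fin N) :
    yRatio (xZero N) i.castSucc k.castSucc = yRatio xVar i k := by
  rw [yRatio, yRatio, xZero_castSucc, xZero_castSucc]

theorem yRatio_neg {ι : Type*} (y : ι → Series N) (i j : ι) : yRatio y i j = -yRatio y j i := by
  rw [yRatio, yRatio, add_comm (toField (y j))]
  ring

/-- The row of the zero variable contributes `(-1)^N`, which cancels the sign for moving the last
index to the front. -/
theorem upperProd_xZero : upperProd (yRatio (xZero N)) = Delta N := by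
  rw [upperProd_succAbove _ (fun i j _ => yRatio_neg _ i j) (Fin.last N), Delta_eq]
  simp only [Fin.succAbove_last, yRatio_xZero_last, yRatio_xZero_castSucc]
  rw [prod_const, card_univ, Fintype.card_fin, Fin.val_last, ← mul_pow]
  simp

theorem tauSet_xZero_univ : tauSet r (xZero N) univ = tauSet r xVar univ := by
  have h : (univ : Finset (Fin (N + 1))) = insert (Fin.last N) (univ.map Fin.castSuccEmb) := by
    refine Finset.ext fun a => ?_
    refine Fin.lastCases ?_ (fun i => ?_) a <;> simp
  rw [h, tauSet_insert_of_eq_zero constantCoeff_xZero xZero_last (by simp [Fin.castSucc_ne_last]),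
    tauSet_xZero_map]

theorem tauSet_xZero_last (i : Fin N) :
    tauSet r (xZero N) {Fin.last N, i.castSucc} = tauX r ![i] := by
  rw [tauSet_insert_of_eq_zero constantCoeff_xZero xZero_last
    (by simpa using (Fin.castSucc_ne_last i).symm), tauX_single, ← tauSet_xZero_map]
  rfl

theorem tauSet_xZero_pair (i k : Fin N) :
    tauSet r (xZero N) {i.castSucc, k.castSucc} = tauSet r xVar {i, k} := by
  rw [← tauSet_xZero_map, map_insert, map_singleton]
  rfl

theorem tauX_odd (hr : ∀ n : ℤ, r n = r (1 - n)) (hN : Odd N) :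
    toField (tauX r (id : Fin N → Fin N)) =
      2 ^ ((N - 1) / 2) * pfaffian (N + 1) (matRBordered r N) / Delta N := by
  -- The weight `2` cancels the factor `1/2` in the border, whose entries are `τ` itself.
  set s : Fin (N + 1) → SeriesField N :=
    fun a => Fin.lastCases (motive := fun _ => SeriesField N) 2 (fun _ => 1) a with hs
  have hs1 : s (Fin.last N) = 2 := Fin.lastCases_last
  have hs2 : ∀ i : Fin N, s i.castSucc = 1 := fun i => Fin.lastCases_castSucc _
  have h := pfaffian_pairMatrix hr hN.add_one constantCoeff_xZero xZero_injective
    (fun a b hab => xZero_add_ne_zero hab) s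
  have hm : matRBordered r N =
      Matrix.of fun a b => (1 / 2) * (s a * s b * pairMatrix r (xZero N) a b) := by
    ext a b
    rw [Matrix.of_apply, pairMatrix]
    refine Fin.lastCases ?_ (fun i => ?_) a <;> refine Fin.lastCases ?_ (fun k => ?_) b
    · rw [matRBordered, Fin.lastCases_last, Fin.lastCases_last, yRatio_self, zero_mul, mul_zero,
        mul_zero]
    · rw [matRBordered, Fin.lastCases_last, Fin.lastCases_castSucc, hs1, hs2, tauSet_xZero_last,
        yRatio_xZero_last, mul_one, neg_one_mul, mul_neg, mul_neg, ← mul_assoc,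
        one_div_mul_cancel two_ne_zero_seriesField, one_mul]
    · rw [matRBordered, Fin.lastCases_castSucc, Fin.lastCases_last, hs1, hs2, pair_comm,
        tauSet_xZero_last, yRatio_last_xZero, one_mul, one_mul, ← mul_assoc,
        one_div_mul_cancel two_ne_zero_seriesField, one_mul]
    · rw [matRBordered, Fin.lastCases_castSucc, Fin.lastCases_castSucc, hs2, hs2,
        tauSet_xZero_pair, yRatio_xZero_castSucc, matR_eq, pairMatrix, one_mul, one_mul]
  rw [← hm, Fin.prod_univ_castSucc, hs1, prod_congr rfl fun i _ => hs2 i, prod_const_one, one_mul,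
    upperProd_xZero, tauSet_xZero_univ, ← tauX_univ] at h
  obtain ⟨m, rfl⟩ := hN
  rw [show (2 * m + 1 + 1) / 2 = m + 1 by omega, pow_succ] at h
  rw [show (2 * m + 1 - 1) / 2 = m by omega, eq_div_iff Delta_ne_zero]
  -- The product of the weights is `2`, and it compensates the exponent `(N+1)/2` against the
  -- required `(N-1)/2`.
  apply mul_left_cancel₀ (two_ne_zero_seriesField (N := 2 * m + 1))
  linear_combination -h

end PfaffianFormulas

end BKP

namespace BKP

open MvPowerSeries Finset

/-! ### One- and two-point functions -/

section Points

variable {N : ℕ} {r : ℤ → ℂ}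

/-- The reflection `n ↦ 1 - n` carries the arguments `-l+1, …, 0` to `l, …, 1`. -/
theorem rShift_neg (hr : ∀ n : ℤ, r n = r (1 - n)) (l : ℕ) : rShift r (-l) l = rProd r l := by
  rw [rShift, rProd, ← prod_range_reflect]
  refine prod_congr rfl fun j hj => ?_
  rw [hr]
  congr 1
  have := mem_range.1 hj
  omega

theorem rShift_neg_add (hr : ∀ n : ℤ, r n = r (1 - n)) (n j : ℕ) :
    rShift r (-n) (n + j) = rProd r n * rProd r j := by
  rw [rShift_add, rShift_neg hr, neg_add_cancel, rShift_zero_left]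

theorem rShift_neg_sub (hr : ∀ n : ℤ, r n = r (1 - n)) {m j : ℕ} (h : j ≤ m) :
    rShift r (-m) (m - j) * rProd r j = rProd r m := by
  obtain ⟨k, rfl⟩ := Nat.exists_eq_add_of_le h
  rw [Nat.add_sub_cancel_left, ← rShift_neg hr j, ← rShift_neg hr (j + k), add_comm j k,
    rShift_add]
  congr 2
  push_cast
  ring

theorem lsum_eq_sum {σ : Type*} {f : ℕ → MvPowerSeries σ ℂ} {s : ℕ → MvPowerSeries σ ℂ}
    (t : Finset ℕ) (h : ∀ l ∉ t, s l = 0) : lsum f s = ∑ l ∈ t, f l • s l := by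
  ext c
  rw [map_sum]
  refine finsum_eq_sum_of_support_subset _ fun l hl => ?_
  by_contra hlt
  refine hl ?_
  dsimp only
  rw [h l hlt, smul_zero, map_zero]

theorem V_rzop_mul_fop (m : ℤ) : V (rzop * fop m : MvPowerSeries (Fin N ⊕ ℕ) Op) =
    if m = 0 then (1 / 2 : ℂ) • 1 else 0 := by
  split_ifs with h
  · rw [h, V_mul_fop_zero, ← mul_one (rzop * rzop), mul_assoc, rzop_mul_rzop_mul, V_smul, V_one]
  · rcases lt_or_gt_of_ne h with h | h
    · exact V_mul_fop_neg h _
    · rw [rzop_mul_fop, V_fop_pos h]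

/-- The left vacuum absorbs `e^{-B}` once it is moved there; among the shifted modes only `φ_0`
pairs with `rz`, with value `1/2`. -/
theorem V_fop_rzop_bop (hr : ∀ n : ℤ, r n = r (1 - n)) (l : ℕ) :
    V (fop (-l) * (rzop * bop r)) = (1 / 2 * rProd r l) • (hTimeNeg l : Series N) := by
  have hl := locFin_of_hasWeight (hasWeight_hTimeNeg (N := N))
  rw [← mul_assoc, ← rzop_mul_fop, mul_assoc, fop_mul_bop hr, ← mul_assoc, rzop_mul_bop, mul_assoc,
    V_bop_mul, dressed, mul_lsum hl, V_lsum hl, lsum_eq_single l]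
  · rw [mul_smul_comm, V_smul, V_rzop_mul_fop, if_pos (by ring), rShift_neg hr, smul_smul,
      mul_comm (rProd r l), smul_comm, smul_eq_mul, mul_one]
  · intro k hk
    rw [mul_smul_comm, V_smul, V_rzop_mul_fop, if_neg (by omega), smul_zero]

theorem tauSet_singleton {ι : Type*} [DecidableEq ι] (hr : ∀ n : ℤ, r n = r (1 - n))
    {y : ι → Series N} (hy : ∀ j, constantCoeff (y j) = 0) (a : ι) :
    tauSet r y {a} = lsum (fun l => y a ^ l) fun l => rProd r l • hTime l := by
  rw [tauSet, vprod_singleton hy, V_vop (hy a), ← smul_eq_mul, ← lsum_smul (locFin_pow (hy a))]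
  congr 1
  funext l
  rw [V_fop_rzop_bop hr, hTimeNeg, mul_smul_comm, ← mul_assoc, ← mul_pow, smul_eq_mul,
    neg_one_mul, neg_neg, one_pow, one_mul, mul_smul_comm]
  rw [mul_comm (1 / 2 : ℂ), mul_smul]
  congr 1
  have : (2 : Series N) = algebraMap ℂ _ 2 := (map_ofNat _ 2).symm
  rw [this, ← Algebra.smul_def, smul_smul]
  norm_num

theorem hasSum_of_coeff {σ ι : Type*} {f : ι → MvPowerSeries σ ℂ} {g : MvPowerSeries σ ℂ}
    (h : ∀ c, ∃ t : Finset ι, (∀ i ∉ t, coeff c (f i) = 0) ∧ coeff c g = ∑ i ∈ t, coeff c (f i)) :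
    HasSum f g := by
  rw [WithPiTopology.hasSum_iff_hasSum_coeff]
  intro c
  obtain ⟨t, ht, hg⟩ := h c
  rw [hg]
  exact hasSum_sum_of_ne_finset_zero ht

theorem hasSum_lsum {σ : Type*} {f : ℕ → MvPowerSeries σ ℂ} (hf : LocFin f)
    (s : ℕ → MvPowerSeries σ ℂ) : HasSum (fun l => f l • s l) (lsum f s) := by
  refine hasSum_of_coeff fun c => ?_
  obtain ⟨n, hn⟩ := hf c
  refine ⟨range n, fun l hl => ?_, ?_⟩
  · exact coeff_smul_eq_zero_left _ (hn l (by simpa using hl))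
  · rw [coeff_lsum _ hn, map_sum]

theorem hasSum_tauX_single (hr : ∀ n : ℤ, r n = r (1 - n)) (i : Fin N) :
    HasSum (fun n : ℕ => rProd r n • (xVar i ^ n * hPoly (tStar N) n)) (tauX r ![i]) := by
  rw [tauX_single, tauSet_singleton hr constantCoeff_xVar]
  convert hasSum_lsum (locFin_pow (constantCoeff_xVar i)) _ using 2 with l
  rw [smul_eq_mul, mul_smul_comm]
  rfl

/-- The coefficients `2 (-1)^{p+q} ⟨φ_{-q} φ_{-p} e^{-B}⟩`. -/
noncomputable def pairCoeff (r : ℤ → ℂ) (N p q : ℕ) : Series N :=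
  2 * (-1) ^ (p + q) * V (fop (-q) * (fop (-p) * bop r))

theorem fop_mul_fop {σ : Type*} (m n : ℤ) : (fop m * fop n : MvPowerSeries σ Op) =
    C (if m + n = 0 then (-1 : ℂ) ^ m • (1 : Op) else 0) - fop n * fop m := by
  rw [fop, fop, ← map_mul, ← map_mul, ← map_sub, ← fer_mul_fer]

theorem fop_mul_fop_of_ne {σ : Type*} {m n : ℤ} (h : m + n ≠ 0) :
    (fop m * fop n : MvPowerSeries σ Op) = -(fop n * fop m) := by
  rw [fop_mul_fop, if_neg h, map_zero, zero_sub]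

theorem two_mul_smul_half (f : Series N) : 2 * ((1 / 2 : ℂ) • f) = f := by
  have : (2 : Series N) = algebraMap ℂ _ 2 := (map_ofNat _ 2).symm
  rw [this, ← Algebra.smul_def, smul_smul]
  norm_num

theorem pairCoeff_zero : pairCoeff r N 0 0 = 1 := by
  have h : (fop 0 * fop 0 : MvPowerSeries (Fin N ⊕ ℕ) Op) = C ((1 / 2 : ℂ) • 1) := by
    rw [fop, ← map_mul, fer_zero_sq]
  have h2 : (C ((1 / 2 : ℂ) • (1 : Op)) : MvPowerSeries (Fin N ⊕ ℕ) Op) * bop r =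
      (1 / 2 : ℂ) • bop r := by
    ext c
    rw [coeff_C_mul, smul_mul_assoc, one_mul]
    rfl
  have h3 := V_bop_mul (N := N) r 1
  rw [mul_one, V_one] at h3
  rw [pairCoeff, Nat.cast_zero, neg_zero, ← mul_assoc, h, h2, V_smul, h3, add_zero, pow_zero,
    mul_one, two_mul_smul_half]

theorem pairCoeff_comm {p q : ℕ} (h : p + q ≠ 0) : pairCoeff r N p q = -pairCoeff r N q p := by
  rw [pairCoeff, pairCoeff, ← mul_assoc, fop_mul_fop_of_ne (by omega), neg_mul, map_neg,
    mul_assoc (fop _), add_comm p q]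
  ring

theorem pairCoeff_self {p : ℕ} (h : p ≠ 0) : pairCoeff r N p p = 0 := by
  have h1 := pairCoeff_comm (r := r) (N := N) (p := p) (q := p) (by omega)
  have h2 : (2 : Series N) * pairCoeff r N p p = 0 := by linear_combination h1
  refine (mul_eq_zero.1 h2).resolve_left ?_
  have : (2 : Series N) = algebraMap ℂ _ 2 := (map_ofNat _ 2).symm
  rw [this]
  exact (map_ne_zero_iff _ (algebraMap ℂ (Series N)).injective).2 two_ne_zero

theorem V_fop_mul_fop_pos {j : ℤ} (hj : 0 < j) (m : ℤ) :
    V (fop m * fop j : MvPowerSeries (Fin N ⊕ ℕ) Op) = if m + j = 0 then ((-1 : ℂ) ^ m) • 1 else 0 := by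
  rw [fop_mul_fop, map_sub, V_fop_pos hj, sub_zero, V_C]
  split_ifs
  · rw [map_smul, ev₀_one, smul_eq_mul, mul_one]
    ext c
    classical
    rw [LinearMap.map_smul_of_tower, coeff_C, coeff_one]
    split_ifs <;> simp
  · rw [map_zero, map_zero]

theorem V_fop_bop_fop_pos (hr : ∀ n : ℤ, r n = r (1 - n)) (m : ℕ) {j : ℕ} (hj : 0 < j) :
    V (fop (-m) * (bop r * fop j)) =
      if j ≤ m then ((-1) ^ m * rShift r (-m) (m - j)) • (hTime (m - j) : Series N) else 0 := by
  have hl := locFin_of_hasWeight (hasWeight_hTimeNeg (N := N))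
  rw [← mul_assoc, fop_mul_bop hr, mul_assoc, V_bop_mul, dressed, lsum_mul hl, V_lsum hl]
  have hz : ∀ l : ℕ, l + j ≠ m →
      V (rShift r (-m) l • fop (-m + l) * fop j : MvPowerSeries (Fin N ⊕ ℕ) Op) = 0 := by
    intro l h
    rw [smul_mul_assoc, V_smul, V_fop_mul_fop_pos (by omega), if_neg (by omega), smul_zero]
  split_ifs with h
  · rw [lsum_eq_single (m - j) fun l hl => hz l (by omega), smul_mul_assoc, V_smul,
      V_fop_mul_fop_pos (by omega), if_pos (by omega), hTimeNeg, smul_eq_mul, mul_smul_comm,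
      mul_smul_comm, mul_one]
    have e : (-m + ((m - j : ℕ) : ℤ)) = -(j : ℤ) := by omega
    have e2 : ((-1 : Series N)) ^ (m - j) * hTime (m - j) = ((-1 : ℂ) ^ (m - j)) • hTime (m - j) := by
      rw [Algebra.smul_def, map_pow, map_neg, map_one]
    rw [e, neg_one_zpow_neg, e2, smul_smul, smul_smul, zpow_natCast]
    congr 1
    have : (-1 : ℂ) ^ m = (-1) ^ j * (-1) ^ (m - j) := by rw [← pow_add]; congr 1; omega
    rw [this]
    ring
  · rw [lsum_eq_single 0 fun l _ => hz l (by omega), hz 0 (by omega), smul_zero]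

theorem pairCoeff_eq (hr : ∀ n : ℤ, r n = r (1 - n)) (n m : ℕ) :
    pairCoeff r N n m = (rProd r n * rProd r m) • schurQ (tStar N) n m := by
  have hl := locFin_of_hasWeight (hasWeight_hTimeNeg (N := N))
  have h0 : V (fop (-m) * (bop r * fop 0)) = (1 / 2 * rProd r m) • (hTimeNeg m : Series N) := by
    rw [← mul_assoc, V_mul_fop_zero, mul_assoc, ← rzop_mul_bop, V_fop_rzop_bop hr]
  have hexp : V (fop (-m) * (fop (-n) * bop r)) = lsum hTimeNeg fun k =>
      rShift r (-n) k • (V (fop (-m) * (bop r * fop (-n + k))) : Series N) := by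
    rw [fop_mul_bop hr, ← mul_assoc, dressed, mul_lsum hl, V_lsum hl]
    congr 1
    funext k
    rw [mul_smul_comm, V_smul, mul_assoc]
  have hsgn : ∀ (k : ℕ) (f : Series N), (-1) ^ k * f = ((-1 : ℂ) ^ k) • f := fun k f => by
    rw [Algebra.smul_def, map_pow, map_neg, map_one]
  have htwo : ∀ (f : Series N), 2 * f = (2 : ℂ) • f := fun f => by
    rw [Algebra.smul_def, map_ofNat]
  -- Of the modes `φ_{-n+k}` at the right vacuum, those with `k < n` vanish. The case `k = n` is
  -- `φ_0` and gives `h_n h_m` with half the weight of the others; `k = n + j` pairs with `φ_{-m}`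
  -- only for `j ≤ m`.
  rw [pairCoeff, hexp, lsum_eq_sum ((range (m + 1)).map (addLeftEmbedding n)), sum_map,
    sum_range_succ']
  · simp only [addLeftEmbedding_apply]
    rw [schurQ, add_zero, neg_add_cancel, h0, rShift_neg hr]
    have h1 : ∀ j ∈ range m, (hTimeNeg (n + (j + 1)) : Series N) • rShift r (-n) (n + (j + 1)) •
        (V (fop (-m) * (bop r * fop (-n + ((n + (j + 1) : ℕ) : ℤ)))) : Series N) =
        ((-1) ^ (n + m) * (rProd r n * rProd r m)) •
          ((-1) ^ (j + 1) * hPoly (tStar N) (n + (j + 1)) * hPoly (tStar N) (m - (j + 1))) := by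
      intro j hj
      have hj' := mem_range.1 hj
      rw [show (-n + ((n + (j + 1) : ℕ) : ℤ)) = ((j + 1 : ℕ) : ℤ) by omega,
        V_fop_bop_fop_pos hr _ (by omega), if_pos (by omega), rShift_neg_add hr,
        ← rShift_neg_sub hr (show j + 1 ≤ m by omega), hTimeNeg, smul_eq_mul, hsgn, mul_assoc, hsgn,
        pow_add, ← smul_eq_mul, ← smul_eq_mul]
      simp only [smul_smul, smul_assoc, smul_comm (_ : Series N) (_ : ℂ)]
      change _ • (hTime _ * hTime _) = _ • (hTime _ * hTime _)
      congr 1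
      ring
    rw [sum_congr rfl h1, ← smul_sum, ← Ico_add_one_right_eq_Icc, sum_Ico_eq_sum_range]
    simp only [Nat.add_sub_cancel, add_comm 1]
    rw [mul_assoc, hsgn, htwo, htwo, hTimeNeg, hTimeNeg, hsgn, hsgn, smul_eq_mul]
    simp only [smul_add, smul_smul, smul_mul_assoc, mul_smul_comm]
    rw [add_comm]
    have hs : (-1 : ℂ) ^ (n + m) * (-1) ^ (n + m) = 1 := by rw [← mul_pow]; simp
    congr 1
    · change _ • (hTime _ * hTime _) = _ • (hTime _ * hTime _)
      congr 1
      rw [pow_add] at hs ⊢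
      linear_combination (rProd r n * rProd r m) * hs
    · congr 1
      linear_combination (2 * rProd r n * rProd r m) * hs
  · intro k hk
    rcases lt_or_ge k n with hkn | hkn
    · rw [← mul_assoc, V_mul_fop_neg (by omega), smul_zero]
    · obtain ⟨j, rfl⟩ := Nat.exists_eq_add_of_le hkn
      have hj : m < j := by
        by_contra hcon
        exact hk (mem_map.2 ⟨j, mem_range.2 (by omega), rfl⟩)
      rw [show (-n + ((n + j : ℕ) : ℤ)) = (j : ℤ) by omega, V_fop_bop_fop_pos hr _ (by omega),
        if_neg (by omega), smul_zero]

end Points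

end BKP

namespace BKP

open MvPowerSeries Finset

/-! ### The expansion of the two-point function -/

section PairExpansion

variable {N : ℕ} {r : ℤ → ℂ}

theorem fop_rzop_fop_rzop {σ : Type*} (m n : ℤ) (Z : MvPowerSeries σ Op) :
    fop m * (rzop * (fop n * (rzop * Z))) = (1 / 2 : ℂ) • (fop m * (fop n * Z)) := by
  rw [← mul_assoc rzop, rzop_mul_fop, mul_assoc, rzop_mul_rzop_mul, mul_smul_comm, mul_smul_comm]

/-- The series `∑_{p, q} 2 (-1)^{p+q} x^p y^q ⟨φ_{-q} φ_{-p} e^{-B}⟩`. -/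
noncomputable def pairSeries (r : ℤ → ℂ) {N : ℕ} (x y : Series N) : Series N :=
  lsum (fun p => x ^ p) fun p => lsum (fun q => y ^ q) fun q => pairCoeff r N p q

theorem two_mul_lsum_modes {ι : Type*} [DecidableEq ι] {y : ι → Series N}
    (hy : ∀ j, constantCoeff (y j) = 0) (a b : ι) :
    2 * lsum (fun l => (-y a) ^ l) (fun l : ℕ => modes (vprod y {b}) (rzop * bop r) l) =
      pairSeries r (y a) (y b) := by
  have hb := locFin_pow (hy b)
  have ha : LocFin fun l => (-y a) ^ l := locFin_pow (by rw [map_neg, hy a, neg_zero])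
  have h : ∀ p : ℕ, modes (vprod y {b}) (rzop * bop r) p =
      lsum (fun q => y b ^ q) fun q : ℕ => (-1) ^ q * V (fop (-q) * (fop (-p) * bop r)) := by
    intro p
    rw [modes, vprod_singleton hy, V_vop (hy b), ← smul_eq_mul, ← lsum_smul hb]
    congr 1
    funext q
    rw [fop_rzop_fop_rzop, V_smul, smul_eq_mul, mul_left_comm, two_mul_smul_half]
  rw [← smul_eq_mul, ← lsum_smul ha, pairSeries]
  ext c
  refine finsum_congr fun p => ?_
  dsimp only
  rw [h, ← lsum_smul hb, neg_pow (y a), mul_comm, mul_smul, ← lsum_smul hb]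
  congr 3
  funext q
  rw [pairCoeff, smul_eq_mul, smul_eq_mul]
  ring

/-- Both `τ({a,b})` and the fermionic two-point series are sums over nonnegative modes. The
correction `-2 y_b` is the boundary term of the shift between them. -/
theorem sub_mul_tauSet_pair {ι : Type*} [DecidableEq ι] {y : ι → Series N}
    (hy : ∀ j, constantCoeff (y j) = 0) {a b : ι} (hab : a ≠ b) :
    (y a - y b) * tauSet r y {a, b} = (y a + y b) * pairSeries r (y a) (y b) - 2 * y b := by
  have hc : constantCoeff (-y a) = 0 := by rw [map_neg, hy a, neg_zero]
  have ha := locFin_pow hc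
  set U := modes (vprod y {b}) (rzop * bop r) with hU
  set T := modes 1 (vprod y {b} * (rzop * bop r)) with hT
  have h1 : ∀ p, U (p - 1) + -y b * U p = T (p - 1) + y b * T p := by
    intro p
    have h := congrFun (aeval_shift_modes hy {b} (rzop * bop r)) p
    simp only [prod_singleton, map_sub, map_add, Polynomial.aeval_X, Polynomial.aeval_C,
      LinearMap.sub_apply, LinearMap.add_apply, Module.algebraMap_end_apply, Pi.sub_apply,
      Pi.add_apply, shift_apply, Pi.smul_apply, smul_eq_mul] at h
    rw [neg_mul, ← sub_eq_add_neg]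
    exact h
  have hshift : ∀ f : ℤ → Series N, lsum (fun l => (-y a) ^ l) (fun l : ℕ => f (l - 1)) =
      f (-1) + -y a * lsum (fun l => (-y a) ^ l) fun l : ℕ => f l := by
    intro f
    have e : (fun l : ℕ => f (l - 1)) = fun l =>
        (if l = 0 then f (-1) else 0) + shiftSeq (fun l : ℕ => f l) l := by
      funext l
      rcases l with _ | l
      · simp [shiftSeq]
      · simp [shiftSeq]
    rw [e, lsum_add ha, lsum_pow_shift hc, lsum_eq_single 0 fun l hl => if_neg hl, if_pos rfl,
      pow_zero, one_smul, smul_eq_mul]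
  have h2 := congrArg (lsum fun l => (-y a) ^ l) (funext fun l : ℕ => h1 l)
  have hsm : ∀ (g : Series N) (f : ℕ → Series N), lsum (fun l => (-y a) ^ l) (fun l => g * f l) =
      g * lsum (fun l => (-y a) ^ l) f := fun g f => lsum_smul ha g f
  rw [lsum_add ha, lsum_add ha, hsm, hsm, hshift, hshift] at h2
  -- Place `-1` belongs to `φ_1`, which does not vanish behind `V(y_b)`; without the vertex operator
  -- in front it does, as `hT1` records.
  have hU1 : U (-1) = y b := by
    have h := two_mul_V_fop_rzop_bop (r := r) hy ∅
    rw [tauSet_empty, vprod_empty, one_mul] at h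
    have h3 := V_vop_fop_pos (hy b) one_pos (rzop * bop r)
    rw [Nat.cast_one, pow_one] at h3
    rw [hU, modes, vprod_singleton hy, neg_neg, h3, mul_right_comm, h, one_mul]
  have hT1 : T (-1) = 0 := modes_neg _ (by omega)
  have h3 := tauSet_insert (r := r) (J := {b}) hy (by simpa using hab : a ∉ ({b} : Finset ι))
  rw [← hT] at h3
  rw [← two_mul_lsum_modes hy, ← hU, h3]
  rw [hU1, hT1] at h2
  linear_combination 2 * h2

theorem sum_square {M : Type*} [AddCommMonoid M] (n : ℕ) (G : ℕ → ℕ → M) :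
    ∑ p ∈ range n, ∑ q ∈ range n, G p q =
      ∑ p ∈ range n, G p p + ∑ p ∈ range n, ∑ q ∈ range p, (G p q + G q p) := by
  induction n with
  | zero => simp
  | succ n ih =>
    rw [sum_range_succ, sum_range_succ _ n, sum_range_succ _ n, sum_range_succ _ n, sum_add_distrib]
    simp only [sum_range_succ _ n]
    rw [sum_add_distrib, ih]
    abel

theorem coeff_pairSeries (r : ℤ → ℂ) {x y : Series N} {c : Fin N ⊕ ℕ →₀ ℕ} {n : ℕ}
    (hx : ∀ l ≥ n, ∀ c' ≤ c, coeff c' (x ^ l) = 0) (hy : ∀ l ≥ n, ∀ c' ≤ c, coeff c' (y ^ l) = 0) :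
    coeff c (pairSeries r x y) =
      coeff c (∑ p ∈ range n, ∑ q ∈ range n, x ^ p * (y ^ q * pairCoeff r N p q)) := by
  rw [pairSeries, coeff_lsum _ hx, map_sum, map_sum]
  refine sum_congr rfl fun p _ => ?_
  rw [← mul_sum, ← sub_eq_zero, smul_eq_mul, ← map_sub, ← mul_sub]
  refine coeff_mul_eq_zero_right _ fun c' hc' => ?_
  rw [map_sub, coeff_lsum _ fun l hl c'' hc'' => hy l hl c'' (hc''.trans hc'), sub_eq_zero]
  rfl

/-- Antisymmetry of the coefficients in `p, q` folds the double sum onto `p > q`; on the diagonal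
only `p = q = 0` survives, and it is the subtracted `1`. -/
theorem hasSum_pairSeries (hr : ∀ n : ℤ, r n = r (1 - n)) {x y : Series N}
    (hx : constantCoeff x = 0) (hy : constantCoeff y = 0) :
    HasSum (fun c : {c : ℕ × ℕ // c.2 < c.1} => (rProd r c.1.1 * rProd r c.1.2) •
        ((x ^ c.1.1 * y ^ c.1.2 - x ^ c.1.2 * y ^ c.1.1) * schurQ (tStar N) c.1.1 c.1.2))
      (pairSeries r x y - 1) := by
  refine hasSum_of_coeff fun c => ?_
  obtain ⟨n₁, h₁⟩ := locFin_pow hx c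
  obtain ⟨n₂, h₂⟩ := locFin_pow hy c
  set n := max n₁ n₂ + 1 with hn
  have hx' : ∀ l ≥ n, ∀ c' ≤ c, coeff c' (x ^ l) = 0 := fun l hl => h₁ l (by omega)
  have hy' : ∀ l ≥ n, ∀ c' ≤ c, coeff c' (y ^ l) = 0 := fun l hl => h₂ l (by omega)
  have hterm : ∀ p q : ℕ, (rProd r p * rProd r q) •
      ((x ^ p * y ^ q - x ^ q * y ^ p) * schurQ (tStar N) p q) =
      (x ^ p * y ^ q - x ^ q * y ^ p) * pairCoeff r N p q := fun p q => by
    rw [pairCoeff_eq hr, mul_smul_comm]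
  refine ⟨(range n ×ˢ range n).subtype fun c => c.2 < c.1, ?_, ?_⟩
  · rintro ⟨⟨p, q⟩, hpq⟩ h
    dsimp only at hpq ⊢
    have hp : n ≤ p := by
      rw [mem_subtype, mem_product, mem_range, mem_range] at h
      dsimp only at h
      omega
    rw [hterm, coeff_mul_eq_zero_left]
    intro c' hc'
    rw [map_sub, coeff_mul_eq_zero_left _ fun c'' hc'' => hx' p hp c'' (hc''.trans hc'),
      coeff_mul_eq_zero_right _ fun c'' hc'' => hy' p hp c'' (hc''.trans hc'), sub_zero]
  · have hsub := sum_subtype_eq_sum_filter (s := range n ×ˢ range n)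
      (p := fun e : ℕ × ℕ => e.2 < e.1)
      fun e : ℕ × ℕ => coeff c ((rProd r e.1 * rProd r e.2) •
        ((x ^ e.1 * y ^ e.2 - x ^ e.2 * y ^ e.1) * schurQ (tStar N) e.1 e.2))
    refine Eq.trans ?_ hsub.symm
    rw [sum_filter, sum_product, map_sub, coeff_pairSeries r hx' hy', sum_square, map_add]
    have h0 : ∑ p ∈ range n, x ^ p * (y ^ p * pairCoeff r N p p) = 1 := by
      rw [sum_eq_single 0]
      · rw [pairCoeff_zero, pow_zero, pow_zero, one_mul, one_mul]
      · intro p _ hp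
        rw [pairCoeff_self hp, mul_zero, mul_zero]
      · intro h
        exact absurd (mem_range.2 (by omega)) h
    rw [h0, add_sub_cancel_left, map_sum]
    refine sum_congr rfl fun p hp => ?_
    rw [← sum_filter, map_sum]
    have hf : (range n).filter (fun q => q < p) = range p := by
      ext q
      have := mem_range.1 hp
      simp only [mem_filter, mem_range]
      omega
    rw [hf]
    refine sum_congr rfl fun q hq => ?_
    have := mem_range.1 hq
    rw [hterm, pairCoeff_comm (p := q) (q := p) (by omega)]
    congr 1
    ring

/-- The boundary term becomes the ratio through `1 - 2 x_k/(x_i + x_k) = (x_i - x_k)/(x_i + x_k)`.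
-/
theorem matR_eq_pairSeries {i k : Fin N} (h : i ≠ k) :
    matR r N i k =
      (1 / 2) * ratio i k + (1 / 2) * toField (pairSeries r (xVar i) (xVar k) - 1) := by
  have h1 := congrArg toField (sub_mul_tauSet_pair (r := r) constantCoeff_xVar h)
  have h2 := toField_ne_zero (xVar_add_ne_zero h)
  have h3 : ratio i k * toField (tauSet r xVar {i, k}) =
      ratio i k + toField (pairSeries r (xVar i) (xVar k) - 1) := by
    rw [ratio, div_mul_eq_mul_div, ← map_mul, h1, div_eq_iff h2, add_mul (_ / _), div_mul_cancel₀ _ h2,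
      ← map_mul, ← map_add]
    congr 1
    ring
  rw [matR, tauX_pair r h, mul_assoc, h3, mul_add]

end PairExpansion

end BKP

namespace BKP

open MvPowerSeries Finset

/-! ### The coefficients of the two-point function -/

section PairCoefficients

variable {N : ℕ} {r : ℤ → ℂ}

theorem bop_eq (r : ℤ → ℂ) : (bop r : MvPowerSeries (Fin N ⊕ ℕ) Op) =
    substOp (fun s => (X (Sum.inr s) : Series N))
      (formalExp (linearSeries fun j : ℕ => negSym r (2 * j + 1))) := by
  have h : substOp (fun s => (X (Sum.inr s) : Series N))
      (linearSeries fun j : ℕ => negSym r (2 * j + 1)) = bser r :=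
    substOp_X_linearSeries Sum.inr_injective _ _ (fun _ => rfl) (by rintro (s | s) hs <;> simp_all)
  rw [substOp_formalExp (hasSubst_X_comp Sum.inr_injective) (constantCoeff_linearSeries _), h, bop]

/-- The coefficients of `e^{-B(t*)}`. -/
noncomputable def bopCoeff (r : ℤ → ℂ) (d : ℕ →₀ ℕ) : Op := coeff d (expNegB r)

theorem coeff_bop (r : ℤ → ℂ) (d : ℕ →₀ ℕ) :
    coeff (d.mapDomain (Sum.inr : ℕ → Fin N ⊕ ℕ)) (bop r) = bopCoeff r d := by
  rw [bop_eq, coeff_substOp_X_comp Sum.inr_injective]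
  rfl

theorem coeff_bop_eq_zero (r : ℤ → ℂ) {c : Fin N ⊕ ℕ →₀ ℕ} {i : Fin N} (h : c (Sum.inl i) ≠ 0) :
    coeff c (bop r) = 0 := by
  rw [bop_eq, coeff_substOp_X_comp_eq_zero]
  rintro d rfl
  exact h (Finsupp.mapDomain_of_notMem_range _ _ (by simp))

theorem coeff_X_pow_smul {σ : Type*} [DecidableEq σ] (s : σ) (l : ℕ) (Z : MvPowerSeries σ Op)
    (c : σ →₀ ℕ) : coeff c ((X s : MvPowerSeries σ ℂ) ^ l • Z) =
      ∑ p ∈ antidiagonal c, if p.1 = Finsupp.single s l then coeff p.2 Z else 0 := by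
  rw [SeriesModule.coeff_smul]
  refine sum_congr rfl fun p _ => ?_
  rw [coeff_X_pow]
  split_ifs
  · rw [one_smul]
  · rw [zero_smul]

/-- No `Z l` involves the variable `X s`, so the exponent at `s` singles out one summand. -/
theorem coeff_lsum_X_pow {σ : Type*} (s : σ) {Z : ℕ → MvPowerSeries σ Op}
    (hZ : ∀ l c, c s ≠ 0 → coeff c (Z l) = 0) (l : ℕ) {e : σ →₀ ℕ} (he : e s = 0) :
    coeff (Finsupp.single s l + e) (lsum (fun l => (X s : MvPowerSeries σ ℂ) ^ l) Z) =
      coeff e (Z l) := by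
  classical
  have h : ∀ k, coeff (Finsupp.single s l + e) ((X s : MvPowerSeries σ ℂ) ^ k • Z k) =
      if k = l then coeff e (Z l) else 0 := by
    intro k
    rw [coeff_X_pow_smul]
    split_ifs with hk
    · subst hk
      rw [Finset.sum_eq_single (Finsupp.single s k, e), if_pos rfl]
      · rintro ⟨p, q⟩ hp hne
        rw [HasAntidiagonal.mem_antidiagonal] at hp
        refine if_neg ?_
        rintro rfl
        dsimp only at hp
        exact hne (by rw [add_left_cancel hp])
      · intro h
        refine absurd ?_ h
        rw [HasAntidiagonal.mem_antidiagonal]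
    · refine Finset.sum_eq_zero fun p hp => ?_
      rw [HasAntidiagonal.mem_antidiagonal] at hp
      split_ifs with hp1
      · refine hZ k _ fun h0 => hk ?_
        have := DFunLike.congr_fun hp s
        simpa [hp1, h0, he] using this
      · rfl
  refine (finsum_congr h).trans ?_
  rw [finsum_eq_single _ l fun k hk => if_neg hk, if_pos rfl]

theorem coeff_lsum_X_pow_eq_zero {σ : Type*} {s s' : σ} (hs : s ≠ s') {Z : ℕ → MvPowerSeries σ Op}
    (hZ : ∀ l c, c s' ≠ 0 → coeff c (Z l) = 0) {c : σ →₀ ℕ} (hc : c s' ≠ 0) :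
    coeff c (lsum (fun l => (X s : MvPowerSeries σ ℂ) ^ l) Z) = 0 := by
  classical
  refine finsum_eq_zero_of_forall_eq_zero fun k => ?_
  rw [coeff_X_pow_smul]
  refine Finset.sum_eq_zero fun p hp => ?_
  rw [HasAntidiagonal.mem_antidiagonal] at hp
  split_ifs with hp1
  · refine hZ k _ fun h0 => hc ?_
    rw [← hp, Finsupp.add_apply, hp1, h0, Finsupp.single_apply, if_neg hs]
  · rfl

theorem coeff_tauX_pair (r : ℤ → ℂ) {i k : Fin N} (h : i ≠ k) (p q : ℕ) (d : ℕ →₀ ℕ) :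
    coeff (Finsupp.sumElim (Finsupp.single i p + Finsupp.single k q) d) (tauX r ![i, k]) =
      ev₀ (vx p * (vx q * bopCoeff r d)) := by
  have hk := locFin_pow (constantCoeff_xVar k)
  have hi := locFin_pow (constantCoeff_xVar i)
  have hne : (Sum.inl i : Fin N ⊕ ℕ) ≠ Sum.inl k := fun h' => h (Sum.inl_injective h')
  have he : Finsupp.sumElim (Finsupp.single i p + Finsupp.single k q) d =
      Finsupp.single (Sum.inl i) p + (Finsupp.single (Sum.inl k) q +
        d.mapDomain (Sum.inr : ℕ → Fin N ⊕ ℕ)) := by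
    classical
    ext (s | s)
    · simp [Finsupp.single_apply, Finsupp.mapDomain_of_notMem_range]
    · simp [Finsupp.mapDomain_apply Sum.inr_injective]
  have hd : ∀ s : Fin N, d.mapDomain (Sum.inr : ℕ → Fin N ⊕ ℕ) (Sum.inl s) = 0 := fun s =>
    Finsupp.mapDomain_of_notMem_range _ _ (by simp)
  have hb : ∀ (s : Fin N) (l : ℕ) (c : Fin N ⊕ ℕ →₀ ℕ), c (Sum.inl s) ≠ 0 →
      coeff c (C (vx l) * bop r : MvPowerSeries (Fin N ⊕ ℕ) Op) = 0 := fun s l c hc => by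
    rw [coeff_C_mul, coeff_bop_eq_zero r hc, mul_zero]
  have hb' : ∀ (l : ℕ) (c : Fin N ⊕ ℕ →₀ ℕ), c (Sum.inl i) ≠ 0 →
      coeff c (C (vx l) * lsum (fun q => xVar k ^ q) fun q => C (vx q) * bop r) = 0 :=
    fun l c hc => by
      rw [coeff_C_mul, xVar, coeff_lsum_X_pow_eq_zero hne.symm (hb i) hc, mul_zero]
  rw [tauX_pair r h, tauSet, vprod_insert constantCoeff_xVar (by simpa using h),
    vprod_singleton constantCoeff_xVar, mul_assoc, vop, vop, lsum_mul hk, lsum_mul hi, coeff_V, he]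
  rw [xVar, coeff_lsum_X_pow (Sum.inl i) hb' p, coeff_C_mul, xVar,
    coeff_lsum_X_pow (Sum.inl k) (hb k) q (hd k), coeff_C_mul, coeff_bop]
  rw [Finsupp.add_apply, hd, Finsupp.single_apply, if_neg hne.symm]

theorem ev₀_fer_zero_fer (m : ℤ) (Z : Op) : ev₀ (fer 0 * (fer m * Z)) = ev₀ (fer m * (rz * Z)) := by
  rw [ev₀_fer_zero, ← mul_assoc, rz_mul_fer, mul_assoc]

/-- The left field is replaced by `φ_0` and a vertex operator, which is then moved past the second
fermion. The Cayley coefficients with alternating signs are those of `(1 - z)/(1 + z)` for `z =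
x_k/x_i`. -/
theorem two_mul_ev₀_fer_fer (p : ℤ) (q : ℕ) (Z : Op) :
    2 * ((-1) ^ p * (-1) ^ q * ev₀ (fer (-q) * (fer (-p) * Z))) =
      ∑ l ∈ range (q + 1), cayleyCoeff l * (-1) ^ l *
        (2 * (-1) ^ (p + l) * ev₀ (fer (-(p + l)) * (rz * (vx (q - l) * Z)))) := by
  have h := ev₀_fer_zero_vx q (fer (-p) * Z)
  rw [← mul_assoc (vx q), vx_mul_fer, Finset.Nat.sum_antidiagonal_eq_sum_range_succ_mk, sum_mul,
    mul_sum, map_sum] at h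
  rw [mul_assoc, ← h, mul_sum, mul_sum]
  refine sum_congr rfl fun l _ => ?_
  have hs : (-1 : ℂ) ^ p = (-1) ^ l * (-1) ^ (p + l) := by
    rw [zpow_add₀ (by norm_num), zpow_natCast, mul_left_comm, ← mul_pow]
    simp
  rw [smul_mul_assoc, mul_smul_comm, map_smul, smul_eq_mul, mul_assoc (fer _), ev₀_fer_zero_fer, hs,
    neg_add, ← sub_eq_add_neg]
  ring

theorem ratioMulCoeff_tauX (r : ℤ → ℂ) {i k : Fin N} (h : i ≠ k) (p q : ℤ) :
    (1 / 2 : ℂ) • ratioMulCoeff i k (tauX r ![i, k]) p q = twoPoint r p q := by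
  ext d
  have hR : coeff d (twoPoint r p q) =
      (-1) ^ p * (-1) ^ q * ev₀ (fer (-q) * (fer (-p) * bopCoeff r d)) := by
    have h1 : coeff d (twoPoint r p q) = ev₀ ((((-1 : ℂ) ^ q) • fer (-q)) *
      (((-1 : ℂ) ^ p) • fer (-p)) * bopCoeff r d) := rfl
    rw [h1, smul_mul_smul_comm, smul_mul_assoc, map_smul, smul_eq_mul, mul_assoc (fer _),
      mul_comm ((-1 : ℂ) ^ p)]
  have hxy : ∀ p' q' : ℤ, coeff d (xyCoeff i k (tauX r ![i, k]) p' q') =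
      if 0 ≤ p' ∧ 0 ≤ q' then ev₀ (vx p'.toNat * (vx q'.toNat * bopCoeff r d)) else 0 := by
    intro p' q'
    rw [← coeff_tauX_pair r h]
    rfl
  rw [hR, LinearMap.map_smul_of_tower, ratioMulCoeff, map_sum, smul_eq_mul]
  simp only [LinearMap.map_smul_of_tower, hxy, smul_eq_mul]
  -- A negative exponent makes the leftmost fermion a positive mode, which the left vacuum kills;
  -- this matches the convention that such coefficients are `0`.
  rcases lt_or_ge q 0 with hq | hq
  · rw [ev₀_fer_pos (by omega), mul_zero, Finset.sum_eq_zero, mul_zero]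
    intro l _
    rw [if_neg (by omega : ¬ (0 ≤ p + l ∧ 0 ≤ q - (l : ℤ))), mul_zero]
  · lift q to ℕ using hq
    rw [zpow_natCast, ← mul_right_inj' (two_ne_zero' ℂ), two_mul_ev₀_fer_fer, Int.toNat_natCast,
      ← mul_assoc, mul_one_div_cancel two_ne_zero, one_mul]
    refine sum_congr rfl fun l hl => ?_
    have hlq := mem_range.1 hl
    have hc : (if l = 0 then (1 : ℂ) else 2 * (-1) ^ l) = cayleyCoeff l * (-1) ^ l := by
      rw [cayleyCoeff]
      split_ifs with hl0
      · rw [hl0, pow_zero, one_mul]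
      · rfl
    rw [hc]
    congr 1
    split_ifs with hp
    · obtain ⟨m, hm⟩ := Int.eq_ofNat_of_zero_le hp.1
      rw [hm, Int.toNat_natCast, ev₀_vx, zpow_natCast, show ((q : ℤ) - l).toNat = q - l by omega]
    · rw [ev₀_fer_pos (by omega), mul_zero]

end PairCoefficients

end BKP

theorem proposition7 (r : ℤ → ℂ) (hr : ∀ n : ℤ, r n = r (1 - n)) (N : ℕ) :
    (Even N →
      BKP.toField (BKP.tauX r (id : Fin N → Fin N)) =
        2 ^ (N / 2) * BKP.pfaffian N (BKP.matR r N) / BKP.Delta N) ∧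
    (Odd N →
      BKP.toField (BKP.tauX r (id : Fin N → Fin N)) =
        2 ^ ((N - 1) / 2) * BKP.pfaffian (N + 1) (BKP.matRBordered r N) / BKP.Delta N) ∧
    (∀ i k : Fin N, i ≠ k →
      (∀ p q : ℤ,
        (1 / 2 : ℂ) • BKP.ratioMulCoeff i k (BKP.tauX r ![i, k]) p q = BKP.twoPoint r p q) ∧
      (∃ P : BKP.Series N,
        HasSum (fun c : {c : ℕ × ℕ // c.2 < c.1} =>
          (BKP.rProd r c.1.1 * BKP.rProd r c.1.2) •
            ((BKP.xVar i ^ c.1.1 * BKP.xVar k ^ c.1.2 -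
                BKP.xVar i ^ c.1.2 * BKP.xVar k ^ c.1.1) *
              BKP.schurQ (BKP.tStar N) c.1.1 c.1.2)) P ∧
        BKP.matR r N i k = (1 / 2) * BKP.ratio i k + (1 / 2) * BKP.toField P)) ∧
    (∀ i : Fin N,
      HasSum (fun n : ℕ =>
        BKP.rProd r n • (BKP.xVar i ^ n * BKP.hPoly (BKP.tStar N) n)) (BKP.tauX r ![i])) :=
  ⟨BKP.tauX_even hr, BKP.tauX_odd hr, fun _ _ h => ⟨BKP.ratioMulCoeff_tauX r h, _,
    BKP.hasSum_pairSeries hr (BKP.constantCoeff_xVar _) (BKP.constantCoeff_xVar _),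
    BKP.matR_eq_pairSeries h⟩, BKP.hasSum_tauX_single hr⟩
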